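/- Let $X$ be a smooth variety over $\mathbb C$ (a smooth separated scheme of finite type) and let $\mathfrak E=(E,\phi)$ be a Higgs bundle of rank $r\ge 0$ on $X$: $E$ is a locally free sheaf of rank $r$ and $\phi\colon E\to E\otimes\Omega^1_X$ is an $\mathcal O_X$-linear morphism with $\phi\wedge\phi=0$. For a morphism $f\colon T\to X$ of schemes, a rank $d$ subbundle $F\subset f^*E$ (a rank $d$ locally free subsheaf, locally a direct summand with locally free complement) is called a Higgs subbundle of $f^*\mathfrak E$ if $(f^*\phi)(F)\subset F\otimes f^*\Omega^1_X$. Let $\boldsymbol r=(0\le r_1\le\dots\le r_k\le r)$ be a nondecreasing sequence of integers, and consider the Higgs flag functor $$F_{\boldsymbol r,\mathfrak E}\colon (\mathrm{Sch}/X)^{\mathrm{op}}\to\mathrm{Sets},\qquad (f\colon T\to X)\mapsto\{F_1\subset\dots\subset F_k\subset f^*E \;:\; F_i \text{ a rank } r_i \text{ Higgs subbundle of } f^*\mathfrak E\},$$ with pull-back of flags as its action on morphisms. For $0\le d\le r$, let $\pi\colon \mathrm{Gr}_d(E)\to X$ be the Grassmann bundle of rank $d$ subbundles of $E$, with universal subbundle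 $S\subset\pi^*E$. The Higgs Grassmannian $\mathfrak{Gr}_d(\mathfrak E)$ is the closed subscheme of $\mathrm{Gr}_d(E)$ that is the zero locus of the composition $S\to\pi^*E\to\pi^*E\otimes\pi^*\Omega^1_X\to(\pi^*E/S)\otimes\pi^*\Omega^1_X$; that is, a morphism $g\colon T\to\mathrm{Gr}_d(E)$ factors through it if and only if $g^*S$ is a Higgs subbundle of $(\pi\circ g)^*\mathfrak E$. Theorem. 1. The functor $F_{\boldsymbol r,\mathfrak E}$ is representable by a scheme $\mathfrak{Fl}_{\boldsymbol r}(\mathfrak E)$ over $X$. 2. The representing scheme is unique up to canonical isomorphism: for two schemes over $X$ representing $F_{\boldsymbol r,\mathfrak E}$ there is exactly one isomorphism over $X$ between them under which the universal flags correspond. 3. The Higgs Grassmannians $\mathfrak{Gr}_{r_i}(\mathfrak E)$ exist, and the morphism over $X$ from $\mathfrak{Fl}_{\boldsymbol r}(\mathfrak E)$ to the product over $X$ of $\mathfrak{Gr}_{r_1}(\mathfrak E),\dots,\mathfrak{Gr}_{r_k}(\mathfrak E)$ whose $i$-th component classifies the $i$-th member of the universal flag is a closed immersion. -/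

import Mathlib

open CategoryTheory AlgebraicGeometry Limits TensorProduct Opposite
open scoped AlgebraicGeometry

noncomputable section

namespace HiggsFlag

/-! ### Sections of sheaves of modules -/

section Sections

variable {X : Scheme.{0}}

/-- Restriction of functions. -/
def rres {U V : X.Opens} (h : V ≤ U) : Γ(X, U) →+* Γ(X, V) :=
  (X.presheaf.map (homOfLE h).op).hom

/-- Restriction of sections of a sheaf of modules. -/
def mres (M : X.Modules) {U V : X.Opens} (h : V ≤ U) : Γ(M, U) →ₛₗ[rres h] Γ(M, V) where
  toFun x := M.presheaf.map (homOfLE h).op x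
  map_add' x y := map_add _ x y
  map_smul' a x := Scheme.Modules.map_smul M (homOfLE h) a x

lemma rres_rres {U V W : X.Opens} (h : V ≤ U) (h' : W ≤ V) (a : Γ(X, U)) :
    rres h' (rres h a) = rres (h'.trans h) a := by
  simp only [rres, ← CommRingCat.comp_apply, ← Functor.map_comp]
  rfl

lemma rres_self {U : X.Opens} (a : Γ(X, U)) : rres le_rfl a = a := by
  simp [rres]

lemma mres_mres (M : X.Modules) {U V W : X.Opens} (h : V ≤ U) (h' : W ≤ V) (x : Γ(M, U)) :
    mres M h' (mres M h x) = mres M (h'.trans h) x := by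
  change (M.presheaf.map _) ((M.presheaf.map _) x) = (M.presheaf.map _) x
  rw [← ConcreteCategory.comp_apply, ← Functor.map_comp]
  rfl

lemma mres_self (M : X.Modules) {U : X.Opens} (x : Γ(M, U)) : mres M le_rfl x = x := by
  have : (homOfLE (le_refl U)).op = 𝟙 _ := rfl
  change (M.presheaf.map _) x = x
  rw [this, M.presheaf.map_id]; rfl

lemma app_mres {M N : X.Modules} (α : M ⟶ N) {U V : X.Opens} (h : V ≤ U) (x : Γ(M, U)) :
    α.app V (mres M h x) = mres N h (α.app U x) := by
  have := (Scheme.Modules.Hom.mapPresheaf α).naturality (homOfLE h).op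
  exact congr($this x)

end Sections

section Kaehler
variable {A B Ω : Type} [CommRing A] [CommRing B] [AddCommGroup Ω] [Module A Ω]

/-- `B ⊗_A Ω` for a ring homomorphism `h : A → B`, as a `B`-module. -/
def BaseChange (h : A →+* B) (Ω : Type) [AddCommGroup Ω] [Module A Ω] : Type :=
  @TensorProduct A _ B Ω _ _ h.toAlgebra.toModule _

instance (h : A →+* B) : AddCommGroup (BaseChange h Ω) :=
  @TensorProduct.addCommGroup A _ B Ω _ _ h.toAlgebra.toModule _

instance (h : A →+* B) : Module B (BaseChange h Ω) :=
  @TensorProduct.leftModule A B _ _ B Ω _ _ _ h.toAlgebra.toModule _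
    (@Algebra.to_smulCommClass A B _ _ h.toAlgebra)

/-- The canonical map `ω ↦ 1 ⊗ ω`. -/
def BaseChange.of (h : A →+* B) (Ω : Type) [AddCommGroup Ω] [Module A Ω] :
    Ω →ₛₗ[h] BaseChange h Ω where
  toFun ω := @TensorProduct.tmul A _ B Ω _ _ h.toAlgebra.toModule _ 1 ω
  map_add' x y := @TensorProduct.tmul_add A _ B Ω _ _ h.toAlgebra.toModule _ 1 x y
  map_smul' a x := by
    let := h.toAlgebra
    change (1 : B) ⊗ₜ[A] (a • x) = (h a) • ((1 : B) ⊗ₜ[A] x)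
    rw [TensorProduct.smul_tmul', ← TensorProduct.smul_tmul, Algebra.smul_def]
    rfl

/-- Every `h`-semilinear map `Ω → P` extends to a `B`-linear map `B ⊗_A Ω → P`. -/
lemma BaseChange.exists_lift (h : A →+* B) {B' P : Type} [CommRing B'] [AddCommGroup P] [Module B' P]
    (g : B →+* B') (h' : A →+* B') (hg : ∀ a, g (h a) = h' a) (u : Ω →ₛₗ[h'] P) :
    ∃ v : BaseChange h Ω →ₛₗ[g] P, ∀ ω, v (BaseChange.of h Ω ω) = u ω := by
  let := h.toAlgebra
  let v : B ⊗[A] Ω →+ P := TensorProduct.liftAddHom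
    { toFun := fun b =>
        { toFun := fun ω => g b • u ω
          map_zero' := by simp
          map_add' := by simp }
      map_zero' := by ext; simp
      map_add' := fun b c => by ext; simp [add_smul] }
    (fun a b ω => by
      change g (a • b) • u ω = g b • u (a • ω)
      rw [u.map_smulₛₗ, Algebra.smul_def, smul_smul, ← hg, ← map_mul, mul_comm]
      rfl)
  refine ⟨{ toFun := v, map_add' := fun x y => map_add v x y, map_smul' := fun b x => ?_ }, fun ω => ?_⟩
  · refine TensorProduct.induction_on (R := A) (M := B) (N := Ω)
      (motive := fun x => v ((show B ⊗[A] Ω from b • (show BaseChange h Ω from x))) = g b • v x)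
      x ?_ (fun c ω => ?_) (fun x y hx hy => ?_)
    · rw [map_zero, smul_zero]
      exact (congrArg v (smul_zero (A := BaseChange h Ω) b)).trans (map_zero v)
    · change g (b * c) • u ω = g b • (g c • u ω)
      rw [smul_smul, map_mul]
    · rw [map_add v x y, smul_add, ← hx, ← hy, ← map_add v]
      exact congrArg v (smul_add (A := BaseChange h Ω) b x y)
  · change g 1 • u ω = u ω
    rw [map_one, one_smul]

/-- The wedge product `Ω → Ω → Λ² Ω`. -/
def wedge (A Ω : Type) [CommRing A] [AddCommGroup Ω] [Module A Ω] : Ω →ₗ[A] Ω →ₗ[A] ⋀[A]^2 Ω :=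
  have e0 : ∀ a b x : Ω, Function.update ![a, b] 0 x = ![x, b] := fun a b x => by
    ext i; fin_cases i <;> simp
  have e1 : ∀ a b x : Ω, Function.update ![a, b] 1 x = ![a, x] := fun a b x => by
    ext i; fin_cases i <;> simp
  LinearMap.mk₂ A (fun a b => exteriorPower.ιMulti A 2 ![a, b])
    (fun a a₁ b => by
      have := (exteriorPower.ιMulti A 2).map_update_add ![a, b] 0 a a₁
      rwa [e0, e0, e0] at this)
    (fun c a b => by
      have := (exteriorPower.ιMulti A 2).map_update_smul ![a, b] 0 c a
      rwa [e0, e0] at this)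
    (fun a b b₁ => by
      have := (exteriorPower.ιMulti A 2).map_update_add ![a, b] 1 b b₁
      rwa [e1, e1, e1] at this)
    (fun c a b => by
      have := (exteriorPower.ιMulti A 2).map_update_smul ![a, b] 1 c b
      rwa [e1, e1] at this)

/-- For `φ : M → M ⊗ Ω`, the composition
`φ ∧ φ : M → M ⊗ Ω → M ⊗ Ω ⊗ Ω → M ⊗ Λ² Ω`. -/
def wedgeSquare {M : Type} [AddCommGroup M] [Module A M] (φ : M →ₗ[A] M ⊗[A] Ω) :
    M →ₗ[A] M ⊗[A] (⋀[A]^2 Ω) :=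
  (TensorProduct.lift (wedge A Ω)).lTensor M ∘ₗ (TensorProduct.assoc A M Ω Ω).toLinearMap ∘ₗ
    φ.rTensor Ω ∘ₗ φ

end Kaehler

/-! ### Differentials on affine opens -/
section Diff
variable {X : Scheme.{0}} (s : X ⟶ Spec (CommRingCat.of ℂ))

/-- The `ℂ`-algebra structure on the functions over `U`. -/
abbrev algC (U : X.Opens) : Algebra ℂ Γ(X, U) :=
  ((Scheme.ΓSpecIso (CommRingCat.of ℂ)).inv ≫ s.appLE ⊤ U le_top).hom.toAlgebra

/-- The Kähler differentials `Ω_{𝒪(U)/ℂ}`; for `U` affine these are the sections of `Ω¹_X`. -/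
abbrev Diff (U : X.Opens) : Type := @KaehlerDifferential ℂ Γ(X, U) _ _ (algC s U)

/-- Restriction of differentials. -/
def dres {U V : X.Opens} (h : V ≤ U) : Diff s U →ₛₗ[rres h] Diff s V :=
  letI := algC s U
  letI := algC s V
  letI : Algebra Γ(X, U) Γ(X, V) := (rres h).toAlgebra
  haveI : IsScalarTower ℂ Γ(X, U) Γ(X, V) := IsScalarTower.of_algebraMap_eq (fun c => by
    have e : s.appLE ⊤ U le_top ≫ X.presheaf.map (homOfLE h).op = s.appLE ⊤ V le_top :=
      Scheme.Hom.appLE_map _ _ _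
    have e' := congr((Scheme.ΓSpecIso (CommRingCat.of ℂ)).inv ≫ $e)
    exact (congr($e' c)).symm)
  { toFun := KaehlerDifferential.map ℂ ℂ Γ(X, U) Γ(X, V)
    map_add' := fun x y => map_add _ x y
    map_smul' := fun a x => by
      rw [map_smul]
      exact (algebraMap_smul Γ(X, V) a _).symm }

end Diff


/-! ### Pulling back sections -/
section Pull

variable {X T : Scheme.{0}} (f : T ⟶ X)

/-- A morphism `α : E ⟶ f_* G` on sections, `V ⊆ f⁻¹ U`. -/
def adjSec {E : X.Modules} {G : T.Modules} (α : E ⟶ (Scheme.Modules.pushforward f).obj G)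
    {U : X.Opens} {V : T.Opens} (h : V ≤ f ⁻¹ᵁ U) :
    Γ(E, U) →ₛₗ[(f.appLE U V h).hom] Γ(G, V) where
  toFun x := mres G h (show Γ(G, f ⁻¹ᵁ U) from α.app U x)
  map_add' x y := by rw [map_add]; exact map_add (mres G h) _ _
  map_smul' a x := by
    rw [Scheme.Modules.Hom.app_smul]
    exact (mres G h).map_smulₛₗ (f.app U a) (show Γ(G, f ⁻¹ᵁ U) from α.app U x)

/-- The pull-back of sections `Γ(E, U) → Γ(f^* E, V)`, `V ⊆ f⁻¹ U`. -/
def pullSec (E : X.Modules) {U : X.Opens} {V : T.Opens} (h : V ≤ f ⁻¹ᵁ U) :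
    Γ(E, U) →ₛₗ[(f.appLE U V h).hom] Γ((Scheme.Modules.pullback f).obj E, V) :=
  adjSec f ((Scheme.Modules.pullbackPushforwardAdjunction f).unit.app E) h

variable {f} in
lemma mres_adjSec {E : X.Modules} {G : T.Modules} (α : E ⟶ (Scheme.Modules.pushforward f).obj G)
    {U : X.Opens} {V V' : T.Opens} (h : V ≤ f ⁻¹ᵁ U) (h' : V' ≤ V) (x : Γ(E, U)) :
    mres G h' (adjSec f α h x) = adjSec f α (h'.trans h) x :=
  mres_mres _ _ _ _

variable {f} in
lemma adjSec_mres {E : X.Modules} {G : T.Modules} (α : E ⟶ (Scheme.Modules.pushforward f).obj G)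
    {U U' : X.Opens} {V : T.Opens} (h : V ≤ f ⁻¹ᵁ U') (h' : U' ≤ U) (x : Γ(E, U)) :
    adjSec f α h (mres E h' x) = adjSec f α (h.trans (f.preimage_mono h')) x := by
  change mres G h (show Γ(G, f ⁻¹ᵁ U') from α.app U' _) = _
  rw [app_mres]
  exact mres_mres G _ _ _

variable {f} in
lemma adjSec_self {E : X.Modules} {G : T.Modules} (α : E ⟶ (Scheme.Modules.pushforward f).obj G)
    {U : X.Opens} (x : Γ(E, U)) :
    adjSec f α (le_refl (f ⁻¹ᵁ U)) x = (show Γ(G, f ⁻¹ᵁ U) from α.app U x) :=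
  mres_self _ _

lemma adj_hom_ext {E : X.Modules} {N : T.Modules} (α β : (Scheme.Modules.pullback f).obj E ⟶ N)
    (h : ∀ (U : X.Opens) (x : Γ(E, U)),
      α.app (f ⁻¹ᵁ U) (pullSec f E le_rfl x) = β.app (f ⁻¹ᵁ U) (pullSec f E le_rfl x)) :
    α = β := by
  apply ((Scheme.Modules.pullbackPushforwardAdjunction f).homEquiv _ _).injective
  simp only [Adjunction.homEquiv_unit]
  ext U x
  have e : pullSec f E (le_refl (f ⁻¹ᵁ U)) x =
    ((Scheme.Modules.pullbackPushforwardAdjunction f).unit.app E).app U x := mres_self _ _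
  have := h U x
  rw [e] at this
  exact this

/-- A morphism of sheaves of modules from its action on sections. -/
def homOfSections {M N : X.Modules} (φ : ∀ U : X.Opens, Γ(M, U) →ₗ[Γ(X, U)] Γ(N, U))
    (nat : ∀ (U V : X.Opens) (h : V ≤ U) (x : Γ(M, U)), φ V (mres M h x) = mres N h (φ U x)) :
    M ⟶ N :=
  SheafOfModules.Hom.mk (PresheafOfModules.homMk
    { app := fun U => AddCommGrpCat.ofHom (φ U.unop).toAddMonoidHom
      naturality := fun U V i => by
        ext x
        exact nat U.unop V.unop (leOfHom i.unop) x }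
    (fun U r m => (φ U.unop).map_smul r m))

lemma homOfSections_app {M N : X.Modules} (φ : ∀ U : X.Opens, Γ(M, U) →ₗ[Γ(X, U)] Γ(N, U))
    (nat) (U : X.Opens) (x : Γ(M, U)) : (homOfSections φ nat).app U x = φ U x := rfl

variable {T' T'' : Scheme.{0}}

/-- For `f' = g ≫ f`, the canonical morphism `f^* E ⟶ g_* f'^* E`. -/
def baseMap (f : T ⟶ X) (g : T' ⟶ T) (f' : T' ⟶ X) (w : g ≫ f = f') (E : X.Modules) :
    (Scheme.Modules.pullback f).obj E ⟶
      (Scheme.Modules.pushforward g).obj ((Scheme.Modules.pullback f').obj E) :=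
  ((Scheme.Modules.pullbackPushforwardAdjunction f).homEquiv _ _).symm
    ((Scheme.Modules.pullbackPushforwardAdjunction f').unit.app E ≫
      (Scheme.Modules.pushforwardCongr w.symm).hom.app _ ≫
      (Scheme.Modules.pushforwardComp g f).inv.app _)

/-- The pull-back along `g` of sections of `f^* E` to sections of `f'^* E`, for `f' = g ≫ f`. -/
def pullMap (f : T ⟶ X) (g : T' ⟶ T) (f' : T' ⟶ X) (w : g ≫ f = f') (E : X.Modules)
    {V : T.Opens} {V' : T'.Opens} (h : V' ≤ g ⁻¹ᵁ V) :
    Γ((Scheme.Modules.pullback f).obj E, V) →ₛₗ[(g.appLE V V' h).hom]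
      Γ((Scheme.Modules.pullback f').obj E, V') :=
  adjSec g (baseMap f g f' w E) h

lemma adjSec_adjSec (f : T ⟶ X) (g : T' ⟶ T) {E : X.Modules} {G : T.Modules} {H : T'.Modules}
    (α : E ⟶ (Scheme.Modules.pushforward f).obj G) (β : G ⟶ (Scheme.Modules.pushforward g).obj H)
    {U : X.Opens} {V : T.Opens} {V' : T'.Opens} (h : V ≤ f ⁻¹ᵁ U) (h' : V' ≤ g ⁻¹ᵁ V)
    (h'' : V' ≤ (g ≫ f) ⁻¹ᵁ U) (x : Γ(E, U)) :
    adjSec g β h' (adjSec f α h x) =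
      adjSec (g ≫ f) (α ≫ (Scheme.Modules.pushforward f).map β ≫
        (Scheme.Modules.pushforwardComp g f).hom.app H) h'' x := by
  have e1 : adjSec f α h x = mres _ h (adjSec f α (le_refl (f ⁻¹ᵁ U)) x) :=
    (mres_adjSec α le_rfl h x).symm
  rw [e1, adjSec_mres, adjSec_self]
  rfl

lemma adjSec_congr (f f' : T ⟶ X) (w : f = f') {E : X.Modules} {G : T.Modules}
    (α : E ⟶ (Scheme.Modules.pushforward f).obj G) {U : X.Opens} {V : T.Opens}
    (h : V ≤ f ⁻¹ᵁ U) (h' : V ≤ f' ⁻¹ᵁ U) (x : Γ(E, U)) :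
    adjSec f' (α ≫ (Scheme.Modules.pushforwardCongr w).hom.app G) h' x = adjSec f α h x := by
  subst w
  exact mres_mres G (le_refl (f ⁻¹ᵁ U)) h (show Γ(G, f ⁻¹ᵁ U) from α.app U x)

lemma pullMap_pullSec (f : T ⟶ X) (g : T' ⟶ T) (f' : T' ⟶ X) (w : g ≫ f = f') (E : X.Modules)
    {U : X.Opens} {V : T.Opens} {V' : T'.Opens} (h : V ≤ f ⁻¹ᵁ U) (h' : V' ≤ g ⁻¹ᵁ V)
    (h'' : V' ≤ f' ⁻¹ᵁ U) (x : Γ(E, U)) :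
    pullMap f g f' w E h' (pullSec f E h x) = pullSec f' E h'' x := by
  have key : (Scheme.Modules.pullbackPushforwardAdjunction f).unit.app E ≫
      (Scheme.Modules.pushforward f).map (baseMap f g f' w E) ≫
        (Scheme.Modules.pushforwardComp g f).hom.app _ =
    (Scheme.Modules.pullbackPushforwardAdjunction f').unit.app E ≫
      (Scheme.Modules.pushforwardCongr w.symm).hom.app _ := by
    have : (Scheme.Modules.pullbackPushforwardAdjunction f).unit.app E ≫
        (Scheme.Modules.pushforward f).map (baseMap f g f' w E) =
      (Scheme.Modules.pullbackPushforwardAdjunction f').unit.app E ≫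
        (Scheme.Modules.pushforwardCongr w.symm).hom.app _ ≫
        (Scheme.Modules.pushforwardComp g f).inv.app _ := by
      exact (Adjunction.homEquiv_unit (adj := Scheme.Modules.pullbackPushforwardAdjunction f)
        (X := E) (f := baseMap f g f' w E)).symm.trans (Equiv.apply_symm_apply _ _)
    rw [reassoc_of% this]
    simp
  unfold pullMap pullSec
  have h3 : V' ≤ (g ≫ f) ⁻¹ᵁ U := by rw [w]; exact h''
  rw [adjSec_adjSec f g _ _ h h' h3]
  refine (congr(adjSec (g ≫ f) $key h3 x)).trans ?_
  exact adjSec_congr _ _ w.symm _ _ _ x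

lemma pullMap_comp (f : T ⟶ X) (g : T' ⟶ T) (f' : T' ⟶ X) (w : g ≫ f = f')
    (g' : T'' ⟶ T') (f'' : T'' ⟶ X) (w' : g' ≫ f' = f'') (gg : T'' ⟶ T) (hgg : g' ≫ g = gg)
    (w'' : gg ≫ f = f'') (E : X.Modules)
    {V : T.Opens} {V' : T'.Opens} {V'' : T''.Opens} (h : V' ≤ g ⁻¹ᵁ V) (h' : V'' ≤ g' ⁻¹ᵁ V')
    (h'' : V'' ≤ gg ⁻¹ᵁ V) (x : Γ((Scheme.Modules.pullback f).obj E, V)) :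
    pullMap f' g' f'' w' E h' (pullMap f g f' w E h x) = pullMap f gg f'' w'' E h'' x := by
  subst hgg
  have key : baseMap f g f' w E ≫ (Scheme.Modules.pushforward g).map (baseMap f' g' f'' w' E) ≫
     (Scheme.Modules.pushforwardComp g' g).hom.app _ = baseMap f (g' ≫ g) f'' w'' E := by
    apply adj_hom_ext
    intro U y
    have hU : g ⁻¹ᵁ f ⁻¹ᵁ U ≤ f' ⁻¹ᵁ U := by rw [← w]; exact le_rfl
    have hU' : g' ⁻¹ᵁ g ⁻¹ᵁ f ⁻¹ᵁ U ≤ f'' ⁻¹ᵁ U := by rw [← w'']; exact le_rfl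
    have a1 := pullMap_pullSec f (g' ≫ g) f'' w'' E (U := U) (V := f ⁻¹ᵁ U)
      (V' := (g' ≫ g) ⁻¹ᵁ f ⁻¹ᵁ U) le_rfl le_rfl hU' y
    have a2 := pullMap_pullSec f g f' w E (U := U) (V := f ⁻¹ᵁ U) le_rfl le_rfl hU y
    have a3 := pullMap_pullSec f' g' f'' w' E (U := U) (V := g ⁻¹ᵁ f ⁻¹ᵁ U)
      (V' := g' ⁻¹ᵁ g ⁻¹ᵁ f ⁻¹ᵁ U) hU le_rfl hU' y
    rw [← a2] at a3
    have a4 := a3.trans a1.symm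
    unfold pullMap at a4
    rw [adjSec_adjSec g g' _ _ le_rfl le_rfl le_rfl] at a4
    exact (adjSec_self _ _).symm.trans (a4.trans (adjSec_self _ _))
  unfold pullMap
  rw [adjSec_adjSec g g' _ _ h h' h'']
  exact congr(adjSec (g' ≫ g) $key h'' x)

lemma pullMap_id (f : T ⟶ X) (w : 𝟙 T ≫ f = f) (E : X.Modules)
    {V : T.Opens} {V' : T.Opens} (h : V' ≤ (𝟙 T) ⁻¹ᵁ V)
    (x : Γ((Scheme.Modules.pullback f).obj E, V)) :
    pullMap f (𝟙 T) f w E h x = mres _ h x := by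
  have key : baseMap f (𝟙 T) f w E = (Scheme.Modules.pushforwardId T).inv.app _ := by
    apply adj_hom_ext
    intro U y
    have a1 := pullMap_pullSec f (𝟙 T) f w E (U := U) (V := f ⁻¹ᵁ U) le_rfl le_rfl le_rfl y
    exact ((adjSec_self _ _).symm.trans a1)
  change mres _ h ((baseMap f (𝟙 T) f w E).app V x) = _
  rw [key]
  rfl

end Pull
/-! ### Local frames -/
section Frames

variable {X : Scheme.{0}}

/-- `e` is a frame (local basis) of `M` over `U`: it trivializes `M` on `U`. -/
def IsFrame (M : X.Modules) {ι : Type} [Fintype ι] {U : X.Opens} (e : ι → Γ(M, U)) : Prop :=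
  ∀ (V : X.Opens) (h : V ≤ U) (x : Γ(M, V)),
    ∃! a : ι → Γ(X, V), ∑ i, a i • mres M h (e i) = x

lemma rres_eq_of_locally_eq {U : X.Opens} (x y : Γ(X, U))
    (h : ∀ p ∈ U, ∃ (V : X.Opens) (hV : V ≤ U), p ∈ V ∧ rres hV x = rres hV y) : x = y := by
  choose V hV hp e using h
  refine TopCat.Sheaf.eq_of_locally_eq' X.sheaf (fun p : U => V p.1 p.2) U
    (fun p => homOfLE (hV _ _)) ?_ x y (fun p => e _ _)
  intro p hpU
  exact TopologicalSpace.Opens.mem_iSup.2 ⟨⟨p, hpU⟩, hp _ _⟩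

lemma mres_sum (M : X.Modules) {ι : Type} [Fintype ι] {U V W : X.Opens} (h : V ≤ U) (h' : W ≤ V)
    (a : ι → Γ(X, V)) (e : ι → Γ(M, U)) :
    mres M h' (∑ i, a i • mres M h (e i)) = ∑ i, rres h' (a i) • mres M (h'.trans h) (e i) := by
  rw [map_sum]
  exact Finset.sum_congr rfl fun i _ => by rw [LinearMap.map_smulₛₗ, mres_mres]

variable {M : X.Modules} {ι κ : Type} [Fintype ι] [Fintype κ] {U : X.Opens}

lemma IsFrame.restrict {e : ι → Γ(M, U)} (he : IsFrame M e) {V : X.Opens} (h : V ≤ U) :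
    IsFrame M (fun i => mres M h (e i)) := by
  intro W hW x
  simpa only [mres_mres] using he W (hW.trans h) x

lemma IsFrame.eq_coord {e : ι → Γ(M, U)} (he : IsFrame M e) {V : X.Opens} (h : V ≤ U)
    {a b : ι → Γ(X, V)} (hab : ∑ i, a i • mres M h (e i) = ∑ i, b i • mres M h (e i)) : a = b :=
  (he V h _).unique hab rfl

/-- The coordinates of a section with respect to a frame. -/
def IsFrame.coord {e : ι → Γ(M, U)} (he : IsFrame M e) {V : X.Opens} (h : V ≤ U) (x : Γ(M, V)) :
    ι → Γ(X, V) := (he V h x).choose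

lemma IsFrame.sum_coord {e : ι → Γ(M, U)} (he : IsFrame M e) {V : X.Opens} (h : V ≤ U)
    (x : Γ(M, V)) : ∑ i, he.coord h x i • mres M h (e i) = x := (he V h x).choose_spec.1

lemma IsFrame.coord_eq {e : ι → Γ(M, U)} (he : IsFrame M e) {V : X.Opens} (h : V ≤ U)
    {x : Γ(M, V)} {a : ι → Γ(X, V)} (ha : ∑ i, a i • mres M h (e i) = x) : he.coord h x = a :=
  he.eq_coord h ((he.sum_coord h x).trans ha.symm)

lemma IsFrame.coord_add {e : ι → Γ(M, U)} (he : IsFrame M e) {V : X.Opens} (h : V ≤ U)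
    (x y : Γ(M, V)) : he.coord h (x + y) = he.coord h x + he.coord h y :=
  he.coord_eq h (by
    simp only [Pi.add_apply, add_smul, Finset.sum_add_distrib, he.sum_coord])

lemma IsFrame.coord_smul {e : ι → Γ(M, U)} (he : IsFrame M e) {V : X.Opens} (h : V ≤ U)
    (r : Γ(X, V)) (x : Γ(M, V)) : he.coord h (r • x) = r • he.coord h x :=
  he.coord_eq h (by
    simp only [Pi.smul_apply, smul_assoc, ← Finset.smul_sum, he.sum_coord])

lemma IsFrame.coord_mres {e : ι → Γ(M, U)} (he : IsFrame M e) {V W : X.Opens} (h : V ≤ U)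
    (h' : W ≤ V) (x : Γ(M, V)) (i : ι) :
    he.coord (h'.trans h) (mres M h' x) i = rres h' (he.coord h x i) := by
  have := he.coord_eq (h'.trans h) (x := mres M h' x) (a := fun i => rres h' (he.coord h x i)) (by
    rw [← mres_sum M h h', he.sum_coord])
  rw [this]

lemma IsFrame.coord_self [DecidableEq ι] {e : ι → Γ(M, U)} (he : IsFrame M e) {V : X.Opens}
    (h : V ≤ U) (i : ι) : he.coord h (mres M h (e i)) = Pi.single i 1 :=
  he.coord_eq h (by
    rw [Finset.sum_eq_single i]
    · simp
    · intro j _ hj; simp [hj]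
    · simp)

lemma IsFrame.of_change [DecidableEq ι] {ε : κ → Γ(M, U)} (hε : IsFrame M ε) {e : ι → Γ(M, U)}
    (P : ι → κ → Γ(X, U)) (Q : κ → ι → Γ(X, U)) (h1 : ∀ i, e i = ∑ k, P i k • ε k)
    (h2 : ∀ k, ε k = ∑ i, Q k i • e i)
    (hPQ : ∀ i j, ∑ k, P i k * Q k j = if i = j then 1 else 0) : IsFrame M e := by
  intro V h x
  have h1' : ∀ i, mres M h (e i) = ∑ k, rres h (P i k) • mres M h (ε k) := fun i => by
    rw [h1, map_sum]
    exact Finset.sum_congr rfl fun k _ => LinearMap.map_smulₛₗ _ _ _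
  have h2' : ∀ k, mres M h (ε k) = ∑ i, rres h (Q k i) • mres M h (e i) := fun k => by
    conv_lhs => rw [h2, map_sum]
    exact Finset.sum_congr rfl fun k _ => LinearMap.map_smulₛₗ _ _ _
  have hPQ' : ∀ i j, ∑ k, rres h (P i k) * rres h (Q k j) = if i = j then 1 else 0 := fun i j => by
    have := congrArg (rres h) (hPQ i j)
    rw [map_sum] at this
    simp only [map_mul] at this
    rw [this]
    split <;> simp
  have red : ∀ a : ι → Γ(X, V), ∑ i, a i • mres M h (e i) =
      ∑ k, (∑ i, a i * rres h (P i k)) • mres M h (ε k) := fun a => by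
    simp only [h1', Finset.smul_sum, Finset.sum_smul, smul_smul]
    exact Finset.sum_comm
  refine ⟨fun i => ∑ k, hε.coord h x k * rres h (Q k i), ?_, fun a ha => ?_⟩
  · change ∑ i, (∑ k, hε.coord h x k * rres h (Q k i)) • mres M h (e i) = x
    conv_rhs => rw [← hε.sum_coord h x]
    simp only [Finset.sum_smul, mul_smul]
    rw [Finset.sum_comm]
    refine Finset.sum_congr rfl fun k _ => ?_
    rw [← Finset.smul_sum, ← h2']
  · have hc := hε.coord_eq h ((red a).symm.trans ha)
    funext j
    rw [hc]
    simp only [Finset.sum_mul]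
    rw [Finset.sum_comm]
    simp only [mul_assoc, ← Finset.mul_sum, hPQ']
    simp

/-- The coordinate functions of two frames over the same open set are mutually inverse matrices. -/
lemma IsFrame.coord_mul_coord [DecidableEq ι] {ε : κ → Γ(M, U)} (hε : IsFrame M ε)
    {e : ι → Γ(M, U)} (he : IsFrame M e) (i j : ι) :
    ∑ k, hε.coord le_rfl (e i) k * he.coord le_rfl (ε k) j = if i = j then 1 else 0 := by
  have := he.coord_eq le_rfl (x := e i)
    (a := fun j => ∑ k, hε.coord le_rfl (e i) k * he.coord le_rfl (ε k) j) (by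
      conv_rhs => rw [← hε.sum_coord le_rfl (e i)]
      simp only [Finset.sum_smul, mul_smul]
      rw [Finset.sum_comm]
      refine Finset.sum_congr rfl fun k _ => ?_
      rw [← Finset.smul_sum, he.sum_coord, mres_self])
  have h2 := he.coord_self le_rfl i
  rw [mres_self] at h2
  rw [h2] at this
  rw [← congrFun this j, Pi.single_apply]
  simp [eq_comm]

end Frames

section FramePull

variable {X T : Scheme.{0}} (f : T ⟶ X) {E : X.Modules} {ι : Type} [Fintype ι]

/-- The open set `W ∩ V`. -/
abbrev cut (W V : T.Opens) : T.Opens := W.ι ''ᵁ W.ι ⁻¹ᵁ V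

lemma cut_le (W V : T.Opens) : cut W V ≤ V := Scheme.Hom.image_preimage_le _ _
lemma cut_le_left (W V : T.Opens) : cut W V ≤ W := by
  intro x hx
  obtain ⟨y, -, rfl⟩ := hx
  exact y.2
lemma le_cut {W V : T.Opens} (h : V ≤ W) : V ≤ cut W V := fun x hx => ⟨⟨x, h hx⟩, hx, rfl⟩
lemma cut_mono (W : T.Opens) {V V' : T.Opens} (h : V' ≤ V) : cut W V' ≤ cut W V :=
  Set.image_mono fun _ hx => h hx

/-- The sheaf `V ↦ Γ(M, W ∩ V)`. -/
abbrev cutSheaf (W : T.Opens) (M : T.Modules) : T.Modules :=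
  (Scheme.Modules.pushforward W.ι).obj (M.restrict W.ι)

lemma smul_cutSheaf (W : T.Opens) (M : T.Modules) (V : T.Opens) (r : Γ(T, V))
    (x : Γ(M, cut W V)) :
    (show Γ(M, cut W V) from r • (show Γ(cutSheaf W M, V) from x)) = rres (cut_le W V) r • x := by
  have : (W.ι.appIso (W.ι ⁻¹ᵁ V)).inv.hom ((W.ι.app V).hom r) = rres (cut_le W V) r := by
    have := Scheme.Hom.app_appIso_inv W.ι V
    rw [← CommRingCat.comp_apply, Scheme.Hom.app_appIso_inv]
    rfl
  rw [← this]
  rfl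


/-- The structure sheaf as a sheaf of modules. -/
abbrev unitSheaf (T : Scheme.{0}) : T.Modules := SheafOfModules.unit T.ringCatSheaf

lemma cut_preimage_le (U U' : X.Opens) : cut (f ⁻¹ᵁ U) (f ⁻¹ᵁ U') ≤ f ⁻¹ᵁ (U' ⊓ U) :=
  (le_inf (cut_le (f ⁻¹ᵁ U) (f ⁻¹ᵁ U')) (cut_le_left (f ⁻¹ᵁ U) (f ⁻¹ᵁ U')) :
    cut (f ⁻¹ᵁ U) (f ⁻¹ᵁ U') ≤ f ⁻¹ᵁ U' ⊓ f ⁻¹ᵁ U)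

lemma mres_pullSec {U : X.Opens} {V V' : T.Opens} (h : V ≤ f ⁻¹ᵁ U) (h' : V' ≤ V) (x : Γ(E, U)) :
    mres _ h' (pullSec f E h x) = pullSec f E (h'.trans h) x := mres_adjSec _ _ _ _

lemma pullSec_mres {U U' : X.Opens} {V : T.Opens} (h : V ≤ f ⁻¹ᵁ U') (h' : U' ≤ U) (x : Γ(E, U)) :
    pullSec f E h (mres E h' x) = pullSec f E (h.trans (f.preimage_mono h')) x := adjSec_mres _ _ _ _

/-- The `i`-th coordinate function of a frame over `U`, as a map `E ⟶ f_* (𝒪_T |_{f⁻¹ U})`. -/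
def coordHom {U : X.Opens} {ε : ι → Γ(E, U)} (hε : IsFrame E ε) (i : ι) :
    E ⟶ (Scheme.Modules.pushforward f).obj (cutSheaf (f ⁻¹ᵁ U) (unitSheaf T)) :=
  homOfSections
    (fun U' =>
      { toFun := fun x => show Γ(T, cut (f ⁻¹ᵁ U) (f ⁻¹ᵁ U')) from
          (f.appLE (U' ⊓ U) _ (cut_preimage_le f U U')).hom
            (hε.coord inf_le_right (mres E inf_le_left x) i)
        map_add' := fun x y => by
          rw [map_add, hε.coord_add, Pi.add_apply]
          exact map_add _ _ _
        map_smul' := fun a x => by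
          rw [LinearMap.map_smulₛₗ, hε.coord_smul, Pi.smul_apply, smul_eq_mul]
          have e : (f.appLE (U' ⊓ U) _ (cut_preimage_le f U U')).hom (rres inf_le_left a) =
              rres (cut_le (f ⁻¹ᵁ U) (f ⁻¹ᵁ U')) ((f.app U').hom a) := by
            simp only [rres, ← CommRingCat.comp_apply, Scheme.Hom.map_appLE]
            rfl
          have m := map_mul (f.appLE (U' ⊓ U) _ (cut_preimage_le f U U')).hom (rres inf_le_left a)
            (hε.coord inf_le_right (mres E inf_le_left x) i)
          rw [e] at m
          refine m.trans ?_
          exact (smul_cutSheaf (f ⁻¹ᵁ U) (unitSheaf T) (f ⁻¹ᵁ U') ((f.app U').hom a) _).symm })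
    (fun U' V h x => by
      change (f.appLE (V ⊓ U) _ (cut_preimage_le f U V)).hom
          (hε.coord inf_le_right (mres E inf_le_left (mres E h x)) i) =
        rres (cut_mono _ (f.preimage_mono h)) ((f.appLE (U' ⊓ U) _ (cut_preimage_le f U U')).hom
            (hε.coord inf_le_right (mres E inf_le_left x) i))
      have hle : V ⊓ U ≤ U' ⊓ U := inf_le_inf_right _ h
      have e1 : mres E inf_le_left (mres E h x) = mres E hle (mres E (inf_le_left (b := U)) x) := by
        rw [mres_mres, mres_mres]
      rw [e1, hε.coord_mres inf_le_right hle]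
      simp only [rres, ← CommRingCat.comp_apply, Scheme.Hom.appLE_map, Scheme.Hom.map_appLE])

/-- The corresponding coordinate function on `f^* E`. -/
def pullCoord {U : X.Opens} {ε : ι → Γ(E, U)} (hε : IsFrame E ε) (i : ι) :
    (Scheme.Modules.pullback f).obj E ⟶ cutSheaf (f ⁻¹ᵁ U) (unitSheaf T) :=
  ((Scheme.Modules.pullbackPushforwardAdjunction f).homEquiv _ _).symm (coordHom f hε i)

lemma pullCoord_pullSec {U : X.Opens} {ε : ι → Γ(E, U)} (hε : IsFrame E ε) (i : ι) (U' : X.Opens)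
    (x : Γ(E, U')) :
    (show Γ(T, cut (f ⁻¹ᵁ U) (f ⁻¹ᵁ U')) from
      (pullCoord f hε i).app (f ⁻¹ᵁ U') (pullSec f E le_rfl x)) =
    (f.appLE (U' ⊓ U) _ (cut_preimage_le f U U')).hom
            (hε.coord inf_le_right (mres E inf_le_left x) i) := by
  have : (Scheme.Modules.pullbackPushforwardAdjunction f).unit.app E ≫
      (Scheme.Modules.pushforward f).map (pullCoord f hε i) = coordHom f hε i :=
    (Adjunction.homEquiv_unit (adj := Scheme.Modules.pullbackPushforwardAdjunction f)
        (X := E) (f := pullCoord f hε i)).symm.trans (Equiv.apply_symm_apply _ _)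
  have e : pullSec f E (le_refl (f ⁻¹ᵁ U')) x =
    ((Scheme.Modules.pullbackPushforwardAdjunction f).unit.app E).app U' x := mres_self _ _
  rw [e]
  exact congr(($this).app U' x)

/-- Expansion of a section with respect to the pulled back frame. -/
def expand {U : X.Opens} {ε : ι → Γ(E, U)} (hε : IsFrame E ε) :
    (Scheme.Modules.pullback f).obj E ⟶ cutSheaf (f ⁻¹ᵁ U) ((Scheme.Modules.pullback f).obj E) :=
  homOfSections
    (fun V =>
      { toFun := fun x => show Γ((Scheme.Modules.pullback f).obj E, cut (f ⁻¹ᵁ U) V) from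
          ∑ i, (show Γ(T, cut (f ⁻¹ᵁ U) V) from (pullCoord f hε i).app V x) •
            pullSec f E (cut_le_left (f ⁻¹ᵁ U) V) (ε i)
        map_add' := fun x y => by
          simp only [map_add]
          refine Eq.trans ?_ (Finset.sum_add_distrib
            (M := Γ((Scheme.Modules.pullback f).obj E, cut (f ⁻¹ᵁ U) V)))
          exact Finset.sum_congr rfl fun i _ =>
            add_smul (M := Γ((Scheme.Modules.pullback f).obj E, cut (f ⁻¹ᵁ U) V)) _ _ _
        map_smul' := fun a x => by
          simp only [Scheme.Modules.Hom.app_smul]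
          refine Eq.trans ?_ (smul_cutSheaf (f ⁻¹ᵁ U) _ V a _).symm
          refine Eq.trans ?_ (Finset.smul_sum
            (N := Γ((Scheme.Modules.pullback f).obj E, cut (f ⁻¹ᵁ U) V))).symm
          refine Finset.sum_congr rfl fun i _ => ?_
          refine Eq.trans ?_ (smul_smul (α := Γ((Scheme.Modules.pullback f).obj E, cut (f ⁻¹ᵁ U) V))
            _ _ _).symm
          exact congrArg (· • pullSec f E (cut_le_left (f ⁻¹ᵁ U) V) (ε i))
            (smul_cutSheaf (f ⁻¹ᵁ U) (unitSheaf T) V a ((pullCoord f hε i).app V x)) })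
    (fun V W h x => by
      refine Eq.trans ?_ (map_sum (mres ((Scheme.Modules.pullback f).obj E)
        (cut_mono (f ⁻¹ᵁ U) h))
        (fun i => (show Γ(T, cut (f ⁻¹ᵁ U) V) from (pullCoord f hε i).app V x) •
            pullSec f E (cut_le_left (f ⁻¹ᵁ U) V) (ε i)) Finset.univ).symm
      refine Finset.sum_congr rfl fun i _ => ?_
      rw [LinearMap.map_smulₛₗ, mres_pullSec, app_mres]
      rfl)

lemma expand_eq {U : X.Opens} {ε : ι → Γ(E, U)} (hε : IsFrame E ε) :
    expand f hε = (Scheme.Modules.restrictAdjunction (f ⁻¹ᵁ U).ι).unit.app _ := by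
  apply adj_hom_ext
  intro U' x
  refine Eq.trans (b := (∑ i, (f.appLE (U' ⊓ U) _ (cut_preimage_le f U U')).hom
            (hε.coord inf_le_right (mres E inf_le_left x) i) •
              pullSec f E (cut_le_left (f ⁻¹ᵁ U) (f ⁻¹ᵁ U')) (ε i))) ?_ ?_
  · refine Finset.sum_congr rfl fun i _ => ?_
    rw [← pullCoord_pullSec f hε i U' x]
  · have e1 : pullSec f E (cut_preimage_le f U U') (mres E inf_le_left x) =
        mres _ (cut_le _ _) (pullSec f E (le_refl (f ⁻¹ᵁ U')) x) := by
      rw [pullSec_mres, mres_pullSec]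
    refine Eq.trans ?_ e1
    conv_rhs => rw [← hε.sum_coord inf_le_right (mres E inf_le_left x), map_sum]
    refine Finset.sum_congr rfl fun i _ => ?_
    rw [LinearMap.map_smulₛₗ]
    congr 1
    rw [pullSec_mres]

/-- The pull-back of a frame over `U` is a frame over `f⁻¹ U`. -/
lemma IsFrame.pullSec {U : X.Opens} {ε : ι → Γ(E, U)} (hε : IsFrame E ε) :
    IsFrame ((Scheme.Modules.pullback f).obj E)
      (fun i => HiggsFlag.pullSec f E (le_refl (f ⁻¹ᵁ U)) (ε i)) := by
  classical
  intro V h x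
  have hc := le_cut h
  have key : ∀ y : Γ((Scheme.Modules.pullback f).obj E, V),
      ∑ i, rres hc (show Γ(T, cut (f ⁻¹ᵁ U) V) from (pullCoord f hε i).app V y) •
        mres _ h (HiggsFlag.pullSec f E (le_refl (f ⁻¹ᵁ U)) (ε i)) = y := fun y => by
    have e1 : (∑ i, (show Γ(T, cut (f ⁻¹ᵁ U) V) from (pullCoord f hε i).app V y) •
            HiggsFlag.pullSec f E (cut_le_left (f ⁻¹ᵁ U) V) (ε i)) = mres _ (cut_le (f ⁻¹ᵁ U) V) y :=
      congr(($(expand_eq f hε)).app V y)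
    have e2 := congrArg (mres _ hc) e1
    rw [mres_mres, mres_self, map_sum] at e2
    refine Eq.trans ?_ e2
    refine Finset.sum_congr rfl fun i _ => ?_
    rw [LinearMap.map_smulₛₗ]
    congr 1
    exact (mres_adjSec _ _ _ _).trans (mres_adjSec _ _ _ _).symm
  refine ⟨_, key x, fun a ha => ?_⟩
  funext j
  rw [← ha]
  have e0 : ∀ i, (show Γ(T, cut (f ⁻¹ᵁ U) V) from (pullCoord f hε j).app V
      (mres _ h (HiggsFlag.pullSec f E (le_refl (f ⁻¹ᵁ U)) (ε i)))) = if i = j then 1 else 0 := fun i => by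
    rw [app_mres]
    have := pullCoord_pullSec f hε j U (ε i)
    refine (congrArg (rres (cut_mono _ h)) this).trans ?_
    rw [hε.coord_self, Pi.single_apply]
    by_cases hij : i = j
    · rw [if_pos hij.symm, if_pos hij]
      simp only [map_one]
    · rw [if_neg (Ne.symm hij), if_neg hij]
      simp only [map_zero]
  have e2 : (show Γ(T, cut (f ⁻¹ᵁ U) V) from (pullCoord f hε j).app V
      (∑ i, a i • mres _ h (HiggsFlag.pullSec f E (le_refl (f ⁻¹ᵁ U)) (ε i)))) =
      rres (cut_le _ _) (a j) := by
    refine Eq.trans (b := ∑ i, rres (cut_le (f ⁻¹ᵁ U) V) (a i) * (if i = j then 1 else 0)) ?_ (by simp)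
    rw [map_sum]
    refine Finset.sum_congr rfl fun i _ => ?_
    rw [Scheme.Modules.Hom.app_smul]
    refine (smul_cutSheaf (f ⁻¹ᵁ U) (unitSheaf T) V (a i) _).trans ?_
    exact congrArg (fun z : Γ(T, cut (f ⁻¹ᵁ U) V) => rres (cut_le (f ⁻¹ᵁ U) V) (a i) * z) (e0 i)
  refine Eq.trans ?_ (congrArg (rres hc) e2).symm
  rw [rres_rres, rres_self]

end FramePull

/-! ### Subbundles -/
section Subbundles

variable {X T T' T'' : Scheme.{0}}

/-- `E` is locally free of rank `r`. -/
def IsLocallyFreeOfRank (E : X.Modules) (r : ℕ) : Prop :=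
  ∀ x : X, ∃ (U : X.Opens) (_ : x ∈ U) (e : Fin r → Γ(E, U)), IsFrame E e

/-- A rank `d` subbundle of a sheaf of modules `G`: a subsheaf of `𝒪_T`-submodules `F ⊆ G` such
that, locally on `T`, there is a frame of `G` whose first `d` members generate `F`. Equivalently,
`F` is locally free of rank `d` and is locally a direct summand with locally free complement. -/
@[ext]
structure Subbundle (G : T.Modules) (d : ℕ) where
  /-- the sections of the subsheaf -/
  sec : ∀ V : T.Opens, Submodule Γ(T, V) Γ(G, V)
  res : ∀ {V W : T.Opens} (h : W ≤ V) {x : Γ(G, V)}, x ∈ sec V → mres G h x ∈ sec W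
  glue : ∀ {V : T.Opens} {x : Γ(G, V)},
    (∀ t ∈ V, ∃ (W : T.Opens) (h : W ≤ V), t ∈ W ∧ mres G h x ∈ sec W) → x ∈ sec V
  frame : ∀ t : T, ∃ (V : T.Opens) (_ : t ∈ V) (c : ℕ) (e : Fin d ⊕ Fin c → Γ(G, V)),
    IsFrame G e ∧ ∀ (W : T.Opens) (h : W ≤ V),
      sec W = Submodule.span Γ(T, W) (Set.range fun i : Fin d => mres G h (e (Sum.inl i)))

variable {E : X.Modules}

lemma mres_mem_span_pull {d : ℕ} (f : T ⟶ X) (g : T' ⟶ T) (f' : T' ⟶ X) (w : g ≫ f = f')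
    (F : Subbundle ((Scheme.Modules.pullback f).obj E) d) {V V₁ : T.Opens} {W W₁ : T'.Opens}
    (hg : W ≤ g ⁻¹ᵁ V) (hg₁ : W₁ ≤ g ⁻¹ᵁ V₁) (hV : V₁ ≤ V) (hW : W₁ ≤ W)
    {y : Γ((Scheme.Modules.pullback f').obj E, W)}
    (hy : y ∈ Submodule.span Γ(T', W) (pullMap f g f' w E hg '' (F.sec V))) :
    mres _ hW y ∈ Submodule.span Γ(T', W₁) (pullMap f g f' w E hg₁ '' (F.sec V₁)) := by
  induction hy using Submodule.span_induction with
  | mem y hy =>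
    obtain ⟨z, hz, rfl⟩ := hy
    refine Submodule.subset_span ⟨mres _ hV z, F.res hV hz, ?_⟩
    unfold pullMap
    rw [adjSec_mres, mres_adjSec]
  | zero => rw [map_zero]; exact Submodule.zero_mem _
  | add x y _ _ hx hy => rw [map_add]; exact Submodule.add_mem _ hx hy
  | smul a x _ hx => rw [LinearMap.map_smulₛₗ]; exact Submodule.smul_mem _ _ hx

/-- The sections over `V'` of the image of `g^* F` in `f'^* E`, for `F ⊆ f^* E` and `f' = g ≫ f`:
those which are locally combinations of pull-backs of sections of `F`. -/
def pullSub {d : ℕ} (f : T ⟶ X) (g : T' ⟶ T) (f' : T' ⟶ X) (w : g ≫ f = f')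
    (F : Subbundle ((Scheme.Modules.pullback f).obj E) d)
    (V' : T'.Opens) : Submodule Γ(T', V') Γ((Scheme.Modules.pullback f').obj E, V') where
  carrier := {x | ∀ t ∈ V', ∃ (V : T.Opens) (W : T'.Opens) (h : W ≤ V') (hg : W ≤ g ⁻¹ᵁ V),
    t ∈ W ∧ mres _ h x ∈ Submodule.span Γ(T', W) (pullMap f g f' w E hg '' (F.sec V))}
  zero_mem' t ht :=
    ⟨⊤, V', le_rfl, le_top, ht, by rw [map_zero]; exact Submodule.zero_mem _⟩
  add_mem' {x y} hx hy t ht := by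
    obtain ⟨V, W, h, hg, htW, hm⟩ := hx t ht
    obtain ⟨V₁, W₁, h₁, hg₁, htW₁, hm₁⟩ := hy t ht
    have hgg : W ⊓ W₁ ≤ g ⁻¹ᵁ (V ⊓ V₁) := le_inf (inf_le_left.trans hg) (inf_le_right.trans hg₁)
    refine ⟨V ⊓ V₁, W ⊓ W₁, inf_le_left.trans h, hgg, ⟨htW, htW₁⟩, ?_⟩
    rw [map_add]
    refine Submodule.add_mem _ ?_ ?_
    · have := mres_mem_span_pull f g f' w F hg hgg inf_le_left inf_le_left hm
      rwa [mres_mres] at this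
    · have := mres_mem_span_pull f g f' w F hg₁ hgg inf_le_right inf_le_right hm₁
      rwa [mres_mres] at this
  smul_mem' a x hx t ht := by
    obtain ⟨V, W, h, hg, htW, hm⟩ := hx t ht
    exact ⟨V, W, h, hg, htW, by rw [LinearMap.map_smulₛₗ]; exact Submodule.smul_mem _ _ hm⟩

/-- Frames of `f^* E` pull back to frames of `f'^* E`. -/
lemma IsFrame.pullMap {ι κ : Type} [Fintype ι] [Fintype κ] (f : T ⟶ X) (g : T' ⟶ T)
    (f' : T' ⟶ X) (w : g ≫ f = f') {U : X.Opens}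
    {ε : κ → Γ(E, U)} (hε : IsFrame E ε) {V : T.Opens} (hV : V ≤ f ⁻¹ᵁ U)
    {e : ι → Γ((Scheme.Modules.pullback f).obj E, V)} (he : IsFrame _ e) :
    IsFrame ((Scheme.Modules.pullback f').obj E)
      (fun i => HiggsFlag.pullMap f g f' w E (le_refl (g ⁻¹ᵁ V)) (e i)) := by
  classical
  have hV' : g ⁻¹ᵁ V ≤ f' ⁻¹ᵁ U := by rw [← w]; exact g.preimage_mono hV
  have h1 := (hε.pullSec f).restrict hV
  have h2 := (hε.pullSec f').restrict hV'
  simp only [mres_pullSec] at h1 h2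
  have key : ∀ k, HiggsFlag.pullSec f' E hV' (ε k) = HiggsFlag.pullMap f g f' w E le_rfl
      (HiggsFlag.pullSec f E hV (ε k)) := fun k => (pullMap_pullSec _ _ _ _ _ _ _ _ _).symm
  refine IsFrame.of_change h2
    (fun i k => (g.appLE V (g ⁻¹ᵁ V) le_rfl).hom (h1.coord le_rfl (e i) k))
    (fun k i => (g.appLE V (g ⁻¹ᵁ V) le_rfl).hom
      (he.coord le_rfl (HiggsFlag.pullSec f E hV (ε k)) i)) ?_ ?_ ?_
  · intro i
    conv_lhs => rw [← h1.sum_coord le_rfl (e i), map_sum]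
    refine Finset.sum_congr rfl fun k _ => ?_
    rw [LinearMap.map_smulₛₗ, mres_pullSec, key]
  · intro k
    rw [key]
    conv_lhs => rw [← he.sum_coord le_rfl (HiggsFlag.pullSec f E hV (ε k)), map_sum]
    refine Finset.sum_congr rfl fun i _ => ?_
    rw [LinearMap.map_smulₛₗ, mres_self]
  · intro i j
    have := congrArg (g.appLE V (g ⁻¹ᵁ V) le_rfl).hom (h1.coord_mul_coord he i j)
    rw [map_sum] at this
    simp only [map_mul] at this
    rw [this]
    split <;> simp

/-- Membership in the span of a part of a frame is a local condition. -/
lemma IsFrame.mem_span_of_locally {M : T.Modules} {ι κ : Type} [Fintype ι] [Fintype κ]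
    {U : T.Opens} {e : ι ⊕ κ → Γ(M, U)} (he : IsFrame M e) {V : T.Opens} (h : V ≤ U) (x : Γ(M, V))
    (hx : ∀ t ∈ V, ∃ (W : T.Opens) (hW : W ≤ V), t ∈ W ∧
      mres M hW x ∈ Submodule.span Γ(T, W)
        (Set.range fun i : ι => mres M (hW.trans h) (e (Sum.inl i)))) :
    x ∈ Submodule.span Γ(T, V) (Set.range fun i : ι => mres M h (e (Sum.inl i))) := by
  have hz : ∀ j : κ, he.coord h x (Sum.inr j) = 0 := fun j => by
    refine rres_eq_of_locally_eq _ _ fun t ht => ?_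
    obtain ⟨W, hW, htW, hm⟩ := hx t ht
    refine ⟨W, hW, htW, ?_⟩
    rw [← he.coord_mres h hW, map_zero]
    obtain ⟨a, ha⟩ := (Submodule.mem_span_range_iff_exists_fun _).1 hm
    rw [he.coord_eq (hW.trans h) (a := Sum.elim a 0) (by
      rw [Fintype.sum_sum_type]
      simpa using ha)]
    rfl
  rw [Submodule.mem_span_range_iff_exists_fun]
  refine ⟨fun i => he.coord h x (Sum.inl i), ?_⟩
  conv_rhs => rw [← he.sum_coord h x, Fintype.sum_sum_type]
  simp [hz]

lemma pullSub_res {d : ℕ} (f : T ⟶ X) (g : T' ⟶ T) (f' : T' ⟶ X) (w : g ≫ f = f')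
    (F : Subbundle ((Scheme.Modules.pullback f).obj E) d) {V' W' : T'.Opens} (h' : W' ≤ V')
    {x : Γ((Scheme.Modules.pullback f').obj E, V')} (hx : x ∈ pullSub f g f' w F V') :
    mres _ h' x ∈ pullSub f g f' w F W' := by
  intro t ht
  obtain ⟨V, W, h, hg, htW, hm⟩ := hx t (h' ht)
  have hgg : W ⊓ W' ≤ g ⁻¹ᵁ V := inf_le_left.trans hg
  refine ⟨V, W ⊓ W', inf_le_right, hgg, ⟨htW, ht⟩, ?_⟩
  have := mres_mem_span_pull f g f' w F hg hgg le_rfl inf_le_left hm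
  rwa [mres_mres] at this ⊢

/-- The pull-back of a section of `F` lies in the pull-back of `F`. -/
lemma pullMap_mem_pullSub {d : ℕ} (f : T ⟶ X) (g : T' ⟶ T) (f' : T' ⟶ X) (w : g ≫ f = f')
    (F : Subbundle ((Scheme.Modules.pullback f).obj E) d) {V : T.Opens} {W : T'.Opens}
    (hg : W ≤ g ⁻¹ᵁ V) {y : Γ((Scheme.Modules.pullback f).obj E, V)} (hy : y ∈ F.sec V) :
    pullMap f g f' w E hg y ∈ pullSub f g f' w F W := fun t ht =>
  ⟨V, W, le_rfl, hg, ht, by rw [mres_self]; exact Submodule.subset_span ⟨y, hy, rfl⟩⟩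

/-- If `F` is spanned by a part of a frame over `V`, its pull-back is spanned by the pull-back. -/
lemma pullSub_eq_span {d c : ℕ} (f : T ⟶ X) (g : T' ⟶ T) (f' : T' ⟶ X) (w : g ≫ f = f')
    (F : Subbundle ((Scheme.Modules.pullback f).obj E) d) {V : T.Opens}
    {e : Fin d ⊕ Fin c → Γ((Scheme.Modules.pullback f).obj E, V)}
    (hF : ∀ (W : T.Opens) (h : W ≤ V),
      F.sec W = Submodule.span Γ(T, W) (Set.range fun i : Fin d => mres _ h (e (Sum.inl i))))
    (he : IsFrame ((Scheme.Modules.pullback f').obj E)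
      (fun i => pullMap f g f' w E (le_refl (g ⁻¹ᵁ V)) (e i)))
    {W : T'.Opens} (h : W ≤ g ⁻¹ᵁ V) :
    pullSub f g f' w F W = Submodule.span Γ(T', W)
      (Set.range fun i : Fin d => mres _ h (pullMap f g f' w E (le_refl (g ⁻¹ᵁ V)) (e (Sum.inl i)))) := by
  apply le_antisymm
  · intro x hx
    refine he.mem_span_of_locally h x fun t ht => ?_
    obtain ⟨V₁, W₁, h₁, hg₁, htW₁, hm⟩ := hx t ht
    refine ⟨W₁, h₁, htW₁, ?_⟩
    have hgg : W₁ ≤ g ⁻¹ᵁ (V₁ ⊓ V) := le_inf hg₁ (h₁.trans h)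
    have hm₂ := mres_mem_span_pull f g f' w F hg₁ hgg inf_le_left le_rfl hm
    rw [mres_self] at hm₂
    refine (Submodule.span_le.2 ?_) hm₂
    rintro _ ⟨z, hz, rfl⟩
    rw [hF _ inf_le_right] at hz
    obtain ⟨a, rfl⟩ := (Submodule.mem_span_range_iff_exists_fun _).1 hz
    rw [map_sum]
    refine Submodule.sum_mem _ fun i _ => ?_
    rw [LinearMap.map_smulₛₗ]
    refine Submodule.smul_mem _ _ (Submodule.subset_span ⟨i, ?_⟩)
    unfold pullMap
    rw [adjSec_mres]
    exact mres_adjSec _ _ _ _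
  · refine Submodule.span_le.2 ?_
    rintro _ ⟨i, rfl⟩
    refine pullSub_res f g f' w F h (pullMap_mem_pullSub f g f' w F le_rfl ?_)
    rw [hF _ le_rfl]
    exact Submodule.subset_span ⟨i, mres_self _ _⟩

/-- Adapted frames of a subbundle of `f^* E` exist over small open sets, and pull back. -/
lemma exists_adapted {r d : ℕ} (hE : IsLocallyFreeOfRank E r) (f : T ⟶ X)
    (F : Subbundle ((Scheme.Modules.pullback f).obj E) d) (t : T) :
    ∃ (V : T.Opens) (_ : t ∈ V) (c : ℕ) (e : Fin d ⊕ Fin c → Γ((Scheme.Modules.pullback f).obj E, V)),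
      IsFrame _ e ∧ (∀ (W : T.Opens) (h : W ≤ V),
        F.sec W = Submodule.span Γ(T, W) (Set.range fun i : Fin d => mres _ h (e (Sum.inl i)))) ∧
      ∀ (T' : Scheme.{0}) (g : T' ⟶ T) (f' : T' ⟶ X) (w : g ≫ f = f'),
        IsFrame ((Scheme.Modules.pullback f').obj E)
          (fun i => pullMap f g f' w E (le_refl (g ⁻¹ᵁ V)) (e i)) := by
  obtain ⟨U, hU, ε, hε⟩ := hE (f t)
  obtain ⟨V, hV, c, e, he, hF⟩ := F.frame t
  have he' := he.restrict (V := V ⊓ f ⁻¹ᵁ U) inf_le_left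
  refine ⟨V ⊓ f ⁻¹ᵁ U, ⟨hV, hU⟩, c, _, he', fun W h => ?_, fun T' g f' w =>
    IsFrame.pullMap f g f' w hε inf_le_right he'⟩
  simp only [mres_mres]
  exact hF W _

/-- The pull-back `g^* F ⊆ f'^* E` of a subbundle `F ⊆ f^* E`, for `f' = g ≫ f`. -/
def Subbundle.pull {r d : ℕ} (hE : IsLocallyFreeOfRank E r) (f : T ⟶ X) (g : T' ⟶ T)
    (f' : T' ⟶ X) (w : g ≫ f = f') (F : Subbundle ((Scheme.Modules.pullback f).obj E) d) :
    Subbundle ((Scheme.Modules.pullback f').obj E) d where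
  sec := pullSub f g f' w F
  res h _ hx := pullSub_res f g f' w F h hx
  glue {V' x} H t ht := by
    obtain ⟨W, h, htW, hm⟩ := H t ht
    obtain ⟨V, W₁, h₁, hg, htW₁, hm₁⟩ := hm t htW
    exact ⟨V, W₁, h₁.trans h, hg, htW₁, by rwa [mres_mres] at hm₁⟩
  frame t := by
    obtain ⟨V, hV, c, e, he, hF, hp⟩ := exists_adapted hE f F (g t)
    exact ⟨g ⁻¹ᵁ V, hV, c, _, hp T' g f' w, fun W h => pullSub_eq_span f g f' w F hF (hp T' g f' w) h⟩

lemma Subbundle.pull_id {r d : ℕ} (hE : IsLocallyFreeOfRank E r) (f : T ⟶ X)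
    (w : 𝟙 T ≫ f = f) (F : Subbundle ((Scheme.Modules.pullback f).obj E) d) :
    F.pull hE f (𝟙 T) f w = F := by
  ext V x
  constructor
  · intro hx
    refine F.glue fun t ht => ?_
    obtain ⟨V₁, W, h, hg, htW, hm⟩ := hx t ht
    refine ⟨W, h, htW, ?_⟩
    refine (Submodule.span_le.2 ?_) hm
    rintro _ ⟨z, hz, rfl⟩
    rw [pullMap_id]
    exact F.res hg hz
  · intro hx
    have := pullMap_mem_pullSub f (𝟙 T) f w F (W := V) (V := V) le_rfl hx
    have e : pullMap f (𝟙 T) f w E (V := V) (V' := V) le_rfl x = x :=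
      (pullMap_id f w E _ x).trans (mres_self _ _)
    exact Eq.subst (motive := fun y => y ∈ pullSub f (𝟙 T) f w F V) e this

lemma Subbundle.pull_pull {r d : ℕ} (hE : IsLocallyFreeOfRank E r) (f : T ⟶ X) (g : T' ⟶ T)
    (f' : T' ⟶ X) (w : g ≫ f = f')
    (g' : T'' ⟶ T') (f'' : T'' ⟶ X) (w' : g' ≫ f' = f'') (gg : T'' ⟶ T) (hgg : g' ≫ g = gg)
    (w'' : gg ≫ f = f'') (F : Subbundle ((Scheme.Modules.pullback f).obj E) d) :
    F.pull hE f gg f'' w'' = (F.pull hE f g f' w).pull hE f' g' f'' w' := by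
  ext V x
  constructor
  · intro hx t ht
    obtain ⟨V₁, W, h, hg, htW, hm⟩ := hx t ht
    have hg₁ : W ≤ g' ⁻¹ᵁ (g ⁻¹ᵁ V₁) := by subst hgg; exact hg
    refine ⟨g ⁻¹ᵁ V₁, W, h, hg₁, htW, ?_⟩
    refine (Submodule.span_mono ?_) hm
    rintro _ ⟨z, hz, rfl⟩
    exact ⟨pullMap f g f' w E le_rfl z, pullMap_mem_pullSub f g f' w F le_rfl hz,
      pullMap_comp f g f' w g' f'' w' gg hgg w'' E _ _ _ z⟩
  · intro hx
    refine Subbundle.glue (F.pull hE f gg f'' w'') fun t ht => ?_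
    obtain ⟨V₁, W, h, hg, htW, hm⟩ := hx t ht
    refine ⟨W, h, htW, ?_⟩
    refine (Submodule.span_le.2 ?_) hm
    rintro _ ⟨z, hz, rfl⟩
    refine Subbundle.glue (F.pull hE f gg f'' w'') fun s hs => ?_
    obtain ⟨V₂, W₂, h₂, hg₂, hsW₂, hm₂⟩ := hz (g' s) (hg hs)
    have hle : W ⊓ g' ⁻¹ᵁ W₂ ≤ W := inf_le_left
    refine ⟨W ⊓ g' ⁻¹ᵁ W₂, hle, ⟨hs, hsW₂⟩, ?_⟩
    have e1 : mres _ hle (pullMap f' g' f'' w' E hg z) =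
        pullMap f' g' f'' w' E inf_le_right (mres _ h₂ z) := by
      unfold pullMap
      rw [adjSec_mres, mres_adjSec]
    rw [e1]
    generalize mres _ h₂ z = y at hm₂ ⊢
    induction hm₂ using Submodule.span_induction with
    | mem y hy =>
      obtain ⟨u, hu, rfl⟩ := hy
      have hgg₂ : W ⊓ g' ⁻¹ᵁ W₂ ≤ gg ⁻¹ᵁ V₂ := by
        subst hgg
        exact inf_le_right.trans (g'.preimage_mono hg₂)
      rw [pullMap_comp f g f' w g' f'' w' gg hgg w'' E hg₂ _ hgg₂]
      exact pullMap_mem_pullSub f gg f'' w'' F hgg₂ hu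
    | zero => rw [map_zero]; exact Submodule.zero_mem _
    | add x y _ _ hx hy => rw [map_add]; exact Submodule.add_mem _ hx hy
    | smul a x _ hx => rw [LinearMap.map_smulₛₗ]; exact Submodule.smul_mem _ _ hx

end Subbundles

/-! ### Higgs bundles -/
section Higgs

/-- A Higgs bundle of rank `r` on a smooth `ℂ`-scheme `s : X ⟶ Spec ℂ`: a locally free sheaf `E` of
rank `r` with an `𝒪_X`-linear map `φ : E → E ⊗ Ω¹_X` such that `φ ∧ φ = 0`. The map of
quasi-coherent sheaves `φ` is given by its action on the sections over the affine open sets, where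
`Γ(U, E ⊗ Ω¹_X) = Γ(U, E) ⊗ Ω_{𝒪(U)/ℂ}`. -/
structure HiggsBundle {X : Scheme.{0}} (s : X ⟶ Spec (CommRingCat.of ℂ)) (r : ℕ) where
  E : X.Modules
  locallyFree : IsLocallyFreeOfRank E r
  φ : ∀ U : X.affineOpens, Γ(E, U.1) →ₗ[Γ(X, U.1)] Γ(E, U.1) ⊗[Γ(X, U.1)] Diff s U.1
  φ_res : ∀ (U V : X.affineOpens) (h : V.1 ≤ U.1) (x : Γ(E, U.1)),
    φ V (mres E h x) = TensorProduct.map (mres E h) (dres s h) (φ U x)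
  integrable : ∀ U : X.affineOpens, wedgeSquare (φ U) = 0

variable {X : Scheme.{0}} {s : X ⟶ Spec (CommRingCat.of ℂ)} {r : ℕ} (𝔈 : HiggsBundle s r)
  {T T' : Scheme.{0}}

namespace HiggsBundle

/-- `Γ(V, f^* Ω¹_X) = 𝒪(V) ⊗_{𝒪(U)} Ω_{𝒪(U)/ℂ}` for `V ⊆ f⁻¹ U`, `U` affine. -/
abbrev PullDiff (s : X ⟶ Spec (CommRingCat.of ℂ)) (f : T ⟶ X) {U : X.Opens} {V : T.Opens}
    (h : V ≤ f ⁻¹ᵁ U) : Type :=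
  BaseChange (f.appLE U V h).hom (Diff s U)

/-- The pull-back of sections `Γ(U, E ⊗ Ω¹_X) → Γ(V, f^* E ⊗ f^* Ω¹_X)`. -/
def pullTensor (s : X ⟶ Spec (CommRingCat.of ℂ)) (f : T ⟶ X) (E : X.Modules) {U : X.Opens}
    {V : T.Opens} (h : V ≤ f ⁻¹ᵁ U) :
    Γ(E, U) ⊗[Γ(X, U)] Diff s U →ₛₗ[(f.appLE U V h).hom]
      Γ((Scheme.Modules.pullback f).obj E, V) ⊗[Γ(T, V)] PullDiff s f h :=
  TensorProduct.map (pullSec f E h) (BaseChange.of (f.appLE U V h).hom (Diff s U))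

/-- `(f^* φ)(F) ⊆ F ⊗ f^* Ω¹_X` over `V ⊆ f⁻¹ U`, where `U` is an affine open set with a frame `ε`
of `E`: a section `∑ aᵢ f^* εᵢ` of `F` is mapped by `f^* φ` to `∑ aᵢ f^* (φ εᵢ)`, which has to be
in the image of `F ⊗ f^* Ω¹_X` in `f^* E ⊗ f^* Ω¹_X`. -/
def InvariantOn (f : T ⟶ X)
    (F : ∀ V : T.Opens, Submodule Γ(T, V) Γ((Scheme.Modules.pullback f).obj 𝔈.E, V))
    (U : X.affineOpens) (ε : Fin r → Γ(𝔈.E, U.1)) (V : T.Opens) (h : V ≤ f ⁻¹ᵁ U.1) : Prop :=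
  ∀ (W : T.Opens) (hW : W ≤ V) (a : Fin r → Γ(T, W)),
    ∑ i, a i • pullSec f 𝔈.E (hW.trans h) (ε i) ∈ F W →
    ∑ i, a i • pullTensor s f 𝔈.E (hW.trans h) (𝔈.φ U (ε i)) ∈
      LinearMap.range ((F W).subtype.rTensor (PullDiff s f (hW.trans h)))

/-- A submodule `F ⊆ f^* E` is a Higgs submodule of `f^* 𝔈` if `(f^* φ)(F) ⊆ F ⊗ f^* Ω¹_X`; this is
a local condition on `T`. -/
def IsInvariant (f : T ⟶ X)
    (F : ∀ V : T.Opens, Submodule Γ(T, V) Γ((Scheme.Modules.pullback f).obj 𝔈.E, V)) : Prop :=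
  ∀ t : T, ∃ (U : X.affineOpens) (_ : f t ∈ U.1) (ε : Fin r → Γ(𝔈.E, U.1)) (_ : IsFrame 𝔈.E ε)
    (V : T.Opens) (_ : t ∈ V) (h : V ≤ f ⁻¹ᵁ U.1), 𝔈.InvariantOn f F U ε V h

lemma IsInvariant.pull {d : ℕ} (f : T ⟶ X) (g : T' ⟶ T) (f' : T' ⟶ X) (w : g ≫ f = f')
    (F : Subbundle ((Scheme.Modules.pullback f).obj 𝔈.E) d) (hF : 𝔈.IsInvariant f F.sec) :
    𝔈.IsInvariant f' (F.pull 𝔈.locallyFree f g f' w).sec := by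
  intro t
  obtain ⟨U, hU, ε, hε, V, hV, h, hinv⟩ := hF (g t)
  obtain ⟨V₀, hV₀, c, e, he, hFe, hp⟩ := exists_adapted 𝔈.locallyFree f F (g t)
  have h₁ : g ⁻¹ᵁ (V ⊓ V₀) ≤ f' ⁻¹ᵁ U.1 := by
    rw [← w]; exact g.preimage_mono (inf_le_left.trans h)
  refine ⟨U, by rw [← w]; exact hU, ε, hε, g ⁻¹ᵁ (V ⊓ V₀), ⟨hV, hV₀⟩, h₁, fun W hW a ha => ?_⟩
  have hf : V ⊓ V₀ ≤ f ⁻¹ᵁ U.1 := inf_le_left.trans h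
  have hg : W ≤ g ⁻¹ᵁ (V ⊓ V₀) := hW
  have hfr := (hε.pullSec f).restrict hf
  have hfr' := (hε.pullSec f').restrict (hW.trans h₁)
  simp only [mres_pullSec] at hfr hfr'
  -- the comparison map of the tensor products
  obtain ⟨B, hB⟩ : ∃ B : PullDiff s f hf →ₛₗ[(g.appLE _ _ hg).hom] PullDiff s f' (hW.trans h₁),
      ∀ ω, B (BaseChange.of _ _ ω) = BaseChange.of _ _ ω :=
    BaseChange.exists_lift (f.appLE _ _ hf).hom (g.appLE _ _ hg).hom
      (f'.appLE _ _ (hW.trans h₁)).hom (fun x => by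
        simp only [← CommRingCat.comp_apply, Scheme.Hom.appLE_comp_appLE, w])
      (BaseChange.of (f'.appLE _ _ (hW.trans h₁)).hom (Diff s U.1))
  let C := TensorProduct.map (pullMap f g f' w 𝔈.E hg) B
  have hC : ∀ z, C (pullTensor s f 𝔈.E hf z) = pullTensor s f' 𝔈.E (hW.trans h₁) z := fun z => by
    induction z using TensorProduct.induction_on with
    | zero => simp only [map_zero]
    | tmul x y =>
      change pullMap f g f' w 𝔈.E hg (pullSec f 𝔈.E hf x) ⊗ₜ B (BaseChange.of _ _ y) =
        pullSec f' 𝔈.E (hW.trans h₁) x ⊗ₜ BaseChange.of _ _ y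
      rw [pullMap_pullSec f g f' w 𝔈.E hf hg (hW.trans h₁), hB]
    | add x y hx hy => simp only [map_add, hx, hy]
  have hCr : ∀ z ∈ LinearMap.range ((F.sec (V ⊓ V₀)).subtype.rTensor (PullDiff s f hf)),
      C z ∈ LinearMap.range (((F.pull 𝔈.locallyFree f g f' w).sec W).subtype.rTensor
        (PullDiff s f' (hW.trans h₁))) := by
    rintro _ ⟨z, rfl⟩
    induction z using TensorProduct.induction_on with
    | zero => simp only [map_zero]; exact Submodule.zero_mem _
    | tmul x y =>
      exact ⟨⟨pullMap f g f' w 𝔈.E hg x.1, pullMap_mem_pullSub f g f' w F hg x.2⟩ ⊗ₜ B y, rfl⟩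
    | add x y hx hy => simp only [map_add]; exact Submodule.add_mem _ hx hy
  -- the members of the adapted frame in terms of `ε`
  let u : Fin d → Γ((Scheme.Modules.pullback f).obj 𝔈.E, V ⊓ V₀) :=
    fun l => mres _ inf_le_right (e (Sum.inl l))
  let q : Fin d → Fin r → Γ(T, V ⊓ V₀) := fun l => hfr.coord le_rfl (u l)
  have hu : ∀ l, ∑ j, q l j • pullSec f 𝔈.E hf (ε j) = u l := fun l => by
    have := hfr.sum_coord le_rfl (u l)
    simpa only [mres_self] using this
  have hmem : ∀ l, ∑ j, q l j • pullTensor s f 𝔈.E hf (𝔈.φ U (ε j)) ∈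
      LinearMap.range ((F.sec (V ⊓ V₀)).subtype.rTensor (PullDiff s f hf)) := fun l => by
    refine hinv (V ⊓ V₀) inf_le_left (q l) ?_
    rw [hu, hFe _ inf_le_right]
    exact Submodule.subset_span ⟨l, rfl⟩
  let qq : Fin d → Fin r → Γ(T', W) := fun l j => (g.appLE _ _ hg).hom (q l j)
  have hmem' : ∀ l, ∑ j, qq l j • pullTensor s f' 𝔈.E (hW.trans h₁) (𝔈.φ U (ε j)) ∈
      LinearMap.range (((F.pull 𝔈.locallyFree f g f' w).sec W).subtype.rTensor
        (PullDiff s f' (hW.trans h₁))) := fun l => by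
    have := hCr _ (hmem l)
    rw [map_sum] at this
    simp only [LinearMap.map_smulₛₗ, hC] at this
    exact this
  have hu' : ∀ l, pullMap f g f' w 𝔈.E hg (u l) =
      ∑ j, qq l j • pullSec f' 𝔈.E (hW.trans h₁) (ε j) := fun l => by
    rw [← hu, map_sum]
    refine Finset.sum_congr rfl fun j _ => ?_
    rw [LinearMap.map_smulₛₗ, pullMap_pullSec f g f' w 𝔈.E hf hg (hW.trans h₁)]
  have ha' : ∑ i, a i • pullSec f' 𝔈.E (hW.trans h₁) (ε i) ∈ Submodule.span Γ(T', W)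
      (Set.range fun l => pullMap f g f' w 𝔈.E hg (u l)) := by
    have hgV₀ : W ≤ g ⁻¹ᵁ V₀ := hW.trans (g.preimage_mono inf_le_right)
    have e1 := pullSub_eq_span f g f' w F hFe (hp T' g f' w) hgV₀
    have e2 : ∀ l, mres _ hgV₀ (pullMap f g f' w 𝔈.E (le_refl (g ⁻¹ᵁ V₀)) (e (Sum.inl l))) =
        pullMap f g f' w 𝔈.E hg (u l) := fun l => by
      have e3 := adjSec_mres (f := g) (baseMap f g f' w 𝔈.E) hg (inf_le_right (a := V) (b := V₀))
        (e (Sum.inl l))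
      exact (mres_adjSec _ _ _ _).trans e3.symm
    have e4 : ∑ i, a i • pullSec f' 𝔈.E (hW.trans h₁) (ε i) ∈ pullSub f g f' w F W := ha
    rw [e1] at e4
    simpa only [e2] using e4
  obtain ⟨b, hb⟩ := (Submodule.mem_span_range_iff_exists_fun _).1 ha'
  have hab : a = fun j => ∑ l, b l * qq l j := by
    refine hfr'.eq_coord le_rfl ?_
    simp only [mres_self]
    rw [← hb]
    simp only [hu', Finset.smul_sum, Finset.sum_smul, smul_smul]
    exact Finset.sum_comm
  have : ∑ i, a i • pullTensor s f' 𝔈.E (hW.trans h₁) (𝔈.φ U (ε i)) =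
      ∑ l, b l • ∑ j, qq l j • pullTensor s f' 𝔈.E (hW.trans h₁) (𝔈.φ U (ε j)) := by
    rw [hab]
    simp only [Finset.smul_sum, Finset.sum_smul, smul_smul]
    exact Finset.sum_comm
  rw [this]
  exact Submodule.sum_mem _ fun l _ => Submodule.smul_mem _ _ (hmem' l)

end HiggsBundle

end Higgs

/-! ### Grassmannians and flags -/
section Flags

variable {X : Scheme.{0}}

/-- The functor of rank `d` subbundles of the pull-backs of `E`, represented by the Grassmann
bundle of `E`. -/
def grassFunctor {E : X.Modules} {r : ℕ} (hE : IsLocallyFreeOfRank E r) (d : ℕ) :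
    (Over X)ᵒᵖ ⥤ Type where
  obj T := Subbundle ((Scheme.Modules.pullback T.unop.hom).obj E) d
  map {T T'} g := ↾(fun F => F.pull hE T.unop.hom g.unop.left T'.unop.hom (Over.w g.unop))
  map_id T := ConcreteCategory.hom_ext _ _ fun F => Subbundle.pull_id hE _ _ F
  map_comp g g' := ConcreteCategory.hom_ext _ _ fun F =>
    Subbundle.pull_pull hE _ _ _ _ _ _ _ _ (by rfl) _ F

variable {s : X ⟶ Spec (CommRingCat.of ℂ)} {r : ℕ} (𝔈 : HiggsBundle s r)

/-- A flag `F₁ ⊆ ⋯ ⊆ F_k` of Higgs subbundles of `f^* 𝔈` of ranks `d`. -/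
@[ext]
structure Flag {T : Scheme.{0}} (f : T ⟶ X) {k : ℕ} (d : Fin k → ℕ) where
  sub : ∀ i, Subbundle ((Scheme.Modules.pullback f).obj 𝔈.E) (d i)
  invariant : ∀ i, 𝔈.IsInvariant f (sub i).sec
  le : ∀ i j, i ≤ j → ∀ V, (sub i).sec V ≤ (sub j).sec V

/-- The pull-back of a flag. -/
def Flag.pull {𝔈 : HiggsBundle s r} {T T' : Scheme.{0}} {f : T ⟶ X} {k : ℕ} {d : Fin k → ℕ}
    (F : Flag 𝔈 f d) (g : T' ⟶ T) (f' : T' ⟶ X) (w : g ≫ f = f') : Flag 𝔈 f' d where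
  sub i := (F.sub i).pull 𝔈.locallyFree f g f' w
  invariant i := HiggsBundle.IsInvariant.pull 𝔈 f g f' w (F.sub i) (F.invariant i)
  le i j hij V x hx t ht := by
    obtain ⟨V₀, W, h, hg, htW, hm⟩ := hx t ht
    exact ⟨V₀, W, h, hg, htW, Submodule.span_mono (Set.image_mono (F.le i j hij V₀)) hm⟩

/-- The Higgs flag functor: flags of Higgs subbundles of ranks `d` of the pull-backs of `𝔈`. -/
def flagFunctor {k : ℕ} (d : Fin k → ℕ) : (Over X)ᵒᵖ ⥤ Type where
  obj T := Flag 𝔈 T.unop.hom d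
  map {T T'} g := ↾(fun F => F.pull g.unop.left T'.unop.hom (Over.w g.unop))
  map_id T := ConcreteCategory.hom_ext _ _ fun F =>
    Flag.ext (funext fun i => Subbundle.pull_id 𝔈.locallyFree _ _ (F.sub i))
  map_comp g g' := ConcreteCategory.hom_ext _ _ fun F =>
    Flag.ext (funext fun i =>
      Subbundle.pull_pull 𝔈.locallyFree _ _ _ _ _ _ _ _ (by rfl) _ (F.sub i))

/-- A Higgs Grassmannian of `𝔈`: the closed subscheme of a Grassmann bundle `gr` of `E`, with
universal subbundle `S` on `gr`, which is the zero locus of the composition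
`S → π^* E → π^* E ⊗ π^* Ω¹_X → (π^* E / S) ⊗ π^* Ω¹_X`: a morphism `g : T ⟶ gr` factors through it
if and only if `φ` maps `g^* S` to `g^* S ⊗ Ω¹_X`. -/
structure HiggsGrassmannian (d : ℕ) where
  gr : Over X
  grRep : (grassFunctor 𝔈.locallyFree d).RepresentableBy gr
  obj : Over X
  ι : obj ⟶ gr
  closed : IsClosedImmersion ι.left
  zeroLocus : ∀ (T : Over X) (g : T ⟶ gr), (∃ h : T ⟶ obj, h ≫ ι = g) ↔
    𝔈.IsInvariant T.hom (show Subbundle ((Scheme.Modules.pullback T.hom).obj 𝔈.E) d from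
      grRep.homEquiv g).sec

end Flags

end HiggsFlag

end

/-!
The Grassmann functor of `E` is a Zariski sheaf. A frame `(ε, ε')` of `E` over an open set `U`, with
`d` members `ε`, gives the open subfunctor of the subbundles whose projection to the span of `ε` is
invertible. These are the graphs of matrices, so that the subfunctor is an affine space over `U`; it
is open since its condition is the invertibility of a minor. As some maximal minor of a rank `d`
subbundle does not vanish at a given point, these charts cover the functor, which is therefore
representable (`isRepresentable_grassFunctor`).

The conditions that single out Higgs subbundles and flags are closed by `exists_closed_locus`: a
property of morphisms `T ⟶ Y` which is local on `T`, stable under composition, and given locally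
on `Y` by the vanishing of functions, is the property of factoring through a closed subscheme.

For Higgs subbundles the functions arise as follows. On a smooth scheme the differentials over an
affine open set form a finite projective module, so that the Higgs field `φ` is determined by its
contractions with functionals `l` on the differentials, which are endomorphisms of `E`. A subbundle
is a Higgs subbundle if and only if it is stable under the pull-backs of all these endomorphisms
(`HiggsBundle.IsInvariant.stableOn`, `HiggsBundle.invariantOn_of_stableOn`); here the differentials
of a basic open set are the localization of the differentials, hence functionals extend to smaller
open sets. In a frame adapted to the subbundle, stability is the vanishing of the lower left block
of a matrix (`stableOn_pull_iff`). The Higgs Grassmannian is the resulting closed subscheme of the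
Grassmann bundle (`nonempty_higgsGrassmannian`).

An inclusion of subbundles is also given by the vanishing of coordinates in an adapted frame. Hence
the universal subbundles on the product of the Higgs Grassmannians form a flag on a closed
subscheme, and this subscheme represents the Higgs flag functor (`exists_flagScheme`). The
uniqueness of the representing scheme is the Yoneda lemma, and by it the closed immersion into the
product is transported to any other representing scheme.
-/

noncomputable section

namespace HiggsFlag

/-! ### Closed subschemes defined by local equations -/

section Restrict
variable {X T T' : Scheme.{0}}

lemma appLE_rres (f : T ⟶ X) {U U' : X.Opens} {V : T.Opens} (h : V ≤ f ⁻¹ᵁ U') (h' : U' ≤ U)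
    (a : Γ(X, U)) :
    (f.appLE U' V h).hom (rres h' a) = (f.appLE U V (h.trans (f.preimage_mono h'))).hom a := by
  simp only [rres, ← CommRingCat.comp_apply, Scheme.Hom.map_appLE]

lemma rres_appLE (f : T ⟶ X) {U : X.Opens} {V V' : T.Opens} (h : V ≤ f ⁻¹ᵁ U) (h' : V' ≤ V)
    (a : Γ(X, U)) :
    rres h' ((f.appLE U V h).hom a) = (f.appLE U V' (h'.trans h)).hom a := by
  simp only [rres, ← CommRingCat.comp_apply, Scheme.Hom.appLE_map]

lemma appLE_appLE (f : T ⟶ X) (g : T' ⟶ T) {U : X.Opens} {V : T.Opens} {W : T'.Opens}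
    (h : V ≤ f ⁻¹ᵁ U) (h' : W ≤ g ⁻¹ᵁ V) (h'' : W ≤ (g ≫ f) ⁻¹ᵁ U) (a : Γ(X, U)) :
    (g.appLE V W h').hom ((f.appLE U V h).hom a) = ((g ≫ f).appLE U W h'').hom a := by
  simp only [← CommRingCat.comp_apply, Scheme.Hom.appLE_comp_appLE]

end Restrict

section ClosedLocus
variable {Y : Scheme.{0}}

/-- For `W` affine with an ideal `J` of functions, a scheme over `W` on which exactly the members
of `J` vanish. -/
lemma exists_hom_ker_eq {W : Y.Opens} (hW : IsAffineOpen W) (J : Ideal Γ(Y, W)) :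
    ∃ (T : Scheme.{0}) (g : T ⟶ Y) (h : ⊤ ≤ g ⁻¹ᵁ W), ∀ a, (g.appLE W ⊤ h).hom a = 0 ↔ a ∈ J := by
  let q : Γ(Y, W) ⟶ CommRingCat.of (Γ(Y, W) ⧸ J) := CommRingCat.ofHom (Ideal.Quotient.mk J)
  have h0 : ⊤ ≤ hW.fromSpec ⁻¹ᵁ W := by rw [hW.fromSpec_preimage_self]
  have h1 : (⊤ : (Spec (CommRingCat.of (Γ(Y, W) ⧸ J))).Opens) ≤ Spec.map q ⁻¹ᵁ ⊤ := le_top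
  have h : (⊤ : (Spec (CommRingCat.of (Γ(Y, W) ⧸ J))).Opens) ≤ (Spec.map q ≫ hW.fromSpec) ⁻¹ᵁ W :=
    fun x _ => h0 (Set.mem_univ _)
  refine ⟨Spec (.of (Γ(Y, W) ⧸ J)), Spec.map q ≫ hW.fromSpec, h, fun a => ?_⟩
  have e : (Spec.map q ≫ hW.fromSpec).appLE W ⊤ h = q ≫ (Scheme.ΓSpecIso _).inv := by
    rw [← Scheme.Hom.appLE_comp_appLE _ _ _ ⊤ _ h0 h1, Scheme.ΓSpecIso_inv_naturality]
    congr 1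
    · simp only [Scheme.Hom.appLE, hW.fromSpec_app_self, Category.assoc, ← Functor.map_comp]
      exact (congrArg _ ((Spec Γ(Y, W)).presheaf.map_id _)).trans (Category.comp_id _)
  rw [e, CommRingCat.comp_apply]
  have hi := (ConcreteCategory.bijective_of_isIso
    (Scheme.ΓSpecIso (CommRingCat.of (Γ(Y, W) ⧸ J))).inv).1
  rw [← Ideal.Quotient.eq_zero_iff_mem]
  exact map_eq_zero_iff _ hi

variable (P : ∀ T : Scheme.{0}, (T ⟶ Y) → Prop)

/-- The functions on `U` which vanish under all morphisms with the property `P`. -/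
def locusIdeal (U : Y.Opens) : Ideal Γ(Y, U) where
  carrier := {a | ∀ (T : Scheme.{0}) (g : T ⟶ Y), P T g → (g.app U).hom a = 0}
  zero_mem' _ _ _ := map_zero _
  add_mem' ha hb T g h := by rw [map_add, ha T g h, hb T g h, add_zero]
  smul_mem' c a ha T g h := by rw [smul_eq_mul, map_mul, ha T g h, mul_zero]

variable {P}

lemma rres_mem_locusIdeal {U V : Y.Opens} (h : V ≤ U) {a : Γ(Y, U)} (ha : a ∈ locusIdeal P U) :
    rres h a ∈ locusIdeal P V := fun T g hg => by
  have := congrArg (rres (g.preimage_mono h)) (ha T g hg)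
  rw [map_zero, Scheme.Hom.app_eq_appLE, rres_appLE] at this
  rw [Scheme.Hom.app_eq_appLE, appLE_rres]
  exact this

/-- Where `P` is the vanishing of `S`, the ideal of `P` is generated by `S`. -/
lemma locusIdeal_eq_span (hcomp : ∀ (T T' : Scheme.{0}) (h : T' ⟶ T) g, P T g → P T' (h ≫ g))
    {V : Y.Opens} {S : Set Γ(Y, V)}
    (hS : ∀ T (g : T ⟶ Y) (h : ⊤ ≤ g ⁻¹ᵁ V), P T g ↔ ∀ a ∈ S, (g.appLE V ⊤ h).hom a = 0)
    {W : Y.Opens} (hW : IsAffineOpen W) (hWV : W ≤ V) :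
    locusIdeal P W = Ideal.span (rres hWV '' S) := by
  apply le_antisymm
  · intro a ha
    obtain ⟨T, g, h, hg⟩ := exists_hom_ker_eq hW (Ideal.span (rres hWV '' S))
    rw [← hg]
    -- the closed subscheme of `W` cut out by `S` has the property `P`, so `a` vanishes on it
    have hP : P T g := by
      rw [hS T g (h.trans (g.preimage_mono hWV))]
      intro b hb
      rw [← appLE_rres g h hWV, hg]
      exact Ideal.subset_span ⟨b, hb, rfl⟩
    have := congrArg (rres h) (ha T g hP)
    rwa [map_zero, Scheme.Hom.app_eq_appLE, rres_appLE] at this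
  · rw [Ideal.span_le]
    rintro _ ⟨b, hb, rfl⟩ T g hg
    have h1 : ⊤ ≤ ((g ⁻¹ᵁ W).ι ≫ g) ⁻¹ᵁ V := fun x _ => hWV x.2
    have := (hS _ _ h1).1 (hcomp _ _ (g ⁻¹ᵁ W).ι g hg) b hb
    have h2 : ⊤ ≤ (g ⁻¹ᵁ W).ι ⁻¹ᵁ (g ⁻¹ᵁ W) := fun x _ => x.2
    rw [Scheme.Hom.app_eq_appLE, appLE_rres]
    rw [← appLE_appLE g (g ⁻¹ᵁ W).ι (g.preimage_mono hWV) h2] at this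
    have e : (g ⁻¹ᵁ W).ι.appLE (g ⁻¹ᵁ W) ⊤ h2 = (g ⁻¹ᵁ W).topIso.inv := by
      rw [Scheme.Opens.ι_appLE]
      rfl
    rw [e] at this
    exact (map_eq_zero_iff _ (ConcreteCategory.bijective_of_isIso (g ⁻¹ᵁ W).topIso.inv).1).1 this

/-- If a function vanishes on `P` over `D(f)`, some multiple `f ^ n x` vanishes on `P`. -/
lemma exists_pow_mul_mem_locusIdeal
    (hcomp : ∀ (T T' : Scheme.{0}) (h : T' ⟶ T) g, P T g → P T' (h ≫ g))
    (hS : ∀ y : Y, ∃ (V : Y.Opens) (_ : y ∈ V) (S : Set Γ(Y, V)),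
      ∀ T (g : T ⟶ Y) (h : ⊤ ≤ g ⁻¹ᵁ V), P T g ↔ ∀ a ∈ S, (g.appLE V ⊤ h).hom a = 0)
    {U : Y.Opens} (hU : IsAffineOpen U) (f x : Γ(Y, U))
    (hx : rres (Y.basicOpen_le f) x ∈ locusIdeal P (Y.basicOpen f)) :
    ∃ n : ℕ, f ^ n * x ∈ locusIdeal P U := by
  have key : ∀ p : U, ∃ (W : Y.Opens) (hW : W ≤ U) (n : ℕ), p.1 ∈ W ∧
      rres hW (f ^ n * x) ∈ locusIdeal P W := fun p => by
    obtain ⟨V, hpV, S, hS⟩ := hS p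
    obtain ⟨_, ⟨W, hW, rfl⟩, hpW, hWle⟩ :=
      Y.isBasis_affineOpens.exists_subset_of_mem_open (show p.1 ∈ U ⊓ V from ⟨p.2, hpV⟩)
        (U ⊓ V).isOpen
    have hWU : W ≤ U := fun z hz => (hWle hz).1
    have hWV : W ≤ V := fun z hz => (hWle hz).2
    let f' := rres hWU f
    have hD : Y.basicOpen f' ≤ Y.basicOpen f := by
      refine (Scheme.basicOpen_res _ f (homOfLE hWU).op).le.trans inf_le_right
    have h1 := rres_mem_locusIdeal hD hx
    have hle := Y.basicOpen_le f'
    rw [locusIdeal_eq_span hcomp hS (IsAffineOpen.basicOpen hW f') (hle.trans hWV)] at h1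
    have := IsAffineOpen.isLocalization_basicOpen hW f'
    have hJ : Ideal.span (rres (hle.trans hWV) '' S) =
        (Ideal.span (rres hWV '' S)).map (algebraMap Γ(Y, W) Γ(Y, Y.basicOpen f')) := by
      rw [Ideal.map_span, Set.image_image]
      congr 1
      exact Set.image_congr fun a _ => (rres_rres hWV hle a).symm
    rw [hJ, rres_rres, ← rres_rres hWU hle] at h1
    obtain ⟨_, ⟨n, rfl⟩, hn⟩ := (IsLocalization.algebraMap_mem_map_algebraMap_iff
      (Submonoid.powers f') (S := Γ(Y, Y.basicOpen f')) _ _).1 h1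
    refine ⟨W, hWU, n, hpW, ?_⟩
    rw [locusIdeal_eq_span hcomp hS hW hWV, map_mul, map_pow]
    exact hn
  -- finitely many of the `W p` cover `U`, and the largest exponent works on all of them
  choose W hW n hp hn using key
  obtain ⟨t, ht⟩ := hU.isCompact.elim_finite_subcover (fun p : U => (W p : Set Y))
    (fun p => (W p).isOpen) (fun p hpU => Set.mem_iUnion.2 ⟨⟨p, hpU⟩, hp _⟩)
  refine ⟨t.sup n, fun T g hg => ?_⟩
  refine rres_eq_of_locally_eq _ _ fun z hz => ?_
  obtain ⟨p, hpt, hzp⟩ := Set.mem_iUnion₂.1 (ht hz)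
  refine ⟨g ⁻¹ᵁ W p, g.preimage_mono (hW p), hzp, ?_⟩
  have h2 : rres (hW p) (f ^ t.sup n * x) ∈ locusIdeal P (W p) := by
    rw [← Nat.sub_add_cancel (Finset.le_sup (f := n) hpt), pow_add, mul_assoc, map_mul]
    exact Ideal.mul_mem_left _ _ (hn p)
  have h3 := h2 T g hg
  rw [Scheme.Hom.app_eq_appLE, appLE_rres] at h3
  rw [Scheme.Hom.app_eq_appLE, rres_appLE, map_zero]
  exact h3

/-- A property of morphisms to `Y` which is Zariski-local on the source and which, locally on `Y`,
is the vanishing of a set of functions, is the property of factoring through a closed subscheme: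
the functions that vanish under all these morphisms form a quasi-coherent ideal sheaf. -/
theorem exists_closed_locus
    (hcomp : ∀ (T T' : Scheme.{0}) (h : T' ⟶ T) g, P T g → P T' (h ≫ g))
    (hloc : ∀ (T : Scheme.{0}) (g : T ⟶ Y),
      (∀ t : T, ∃ W : T.Opens, t ∈ W ∧ P W (W.ι ≫ g)) → P T g)
    (hS : ∀ y : Y, ∃ (V : Y.Opens) (_ : y ∈ V) (S : Set Γ(Y, V)),
      ∀ T (g : T ⟶ Y) (h : ⊤ ≤ g ⁻¹ᵁ V), P T g ↔ ∀ a ∈ S, (g.appLE V ⊤ h).hom a = 0) :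
    ∃ (Z : Scheme.{0}) (ι : Z ⟶ Y), IsClosedImmersion ι ∧
      ∀ (T : Scheme.{0}) (g : T ⟶ Y), P T g ↔ ∃ h, h ≫ ι = g := by
  let I : Y.IdealSheafData :=
    { ideal := fun U => locusIdeal P U.1
      map_ideal_basicOpen := fun U f => by
        have := U.2.isLocalization_basicOpen f
        apply le_antisymm
        · exact Ideal.map_le_iff_le_comap.2 fun a ha => rres_mem_locusIdeal (Y.basicOpen_le f) ha
        · intro b hb
          obtain ⟨x, ⟨_, n, rfl⟩, rfl⟩ := IsLocalization.exists_mk'_eq (.powers f) b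
          refine (IsLocalization.mk'_mem_map_algebraMap_iff (.powers f) _ _ _ _).mpr ?_
          obtain ⟨m, hm⟩ := exists_pow_mul_mem_locusIdeal hcomp hS U.2 f x (by
            have e : rres (Y.basicOpen_le f) x =
              algebraMap Γ(Y, U.1) Γ(Y, Y.basicOpen f) x := rfl
            rw [e, ← IsLocalization.mk'_spec _ x (⟨f ^ n, n, rfl⟩ : Submonoid.powers f)]
            exact Ideal.mul_mem_right _ _ hb)
          exact ⟨_, ⟨m, rfl⟩, hm⟩ }
  refine ⟨I.subscheme, I.subschemeι, inferInstance, fun T g => ⟨fun hg => ?_, ?_⟩⟩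
  · have hle : I ≤ g.ker := Scheme.IdealSheafData.le_ofIdeals_iff.2 fun U a ha => ha T g hg
    exact ⟨g.toImage ≫ Scheme.IdealSheafData.inclusion hle, by
      rw [Category.assoc, Scheme.IdealSheafData.inclusion_subschemeι]
      exact g.toImage_imageι⟩
  · rintro ⟨h, rfl⟩
    -- it suffices that the inclusion of the closed subscheme has the property `P`
    refine hcomp _ _ h _ (hloc _ _ fun z => ?_)
    obtain ⟨V, hV, S, hS⟩ := hS (I.subschemeι z)
    obtain ⟨_, ⟨W, hW, rfl⟩, hzW, hWle⟩ :=
      Y.isBasis_affineOpens.exists_subset_of_mem_open hV V.isOpen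
    refine ⟨I.subschemeι ⁻¹ᵁ W, hzW, ?_⟩
    have hk : ∀ a ∈ locusIdeal P W, (I.subschemeι.app W).hom a = 0 := fun a ha => by
      have := Scheme.IdealSheafData.ker_subschemeι_app I ⟨W, hW⟩
      exact this.ge ha
    have h1 : ⊤ ≤ (I.subschemeι ⁻¹ᵁ W).ι ⁻¹ᵁ (I.subschemeι ⁻¹ᵁ W) := fun x _ => x.2
    have h2 : ⊤ ≤ ((I.subschemeι ⁻¹ᵁ W).ι ≫ I.subschemeι) ⁻¹ᵁ V := fun x _ => hWle (h1 trivial)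
    rw [hS _ _ h2]
    intro a ha
    rw [← appLE_appLE I.subschemeι (I.subschemeι ⁻¹ᵁ W).ι (I.subschemeι.preimage_mono hWle) h1,
      ← appLE_rres I.subschemeι le_rfl hWle, ← Scheme.Hom.app_eq_appLE, hk, map_zero]
    rw [locusIdeal_eq_span hcomp hS hW hWle]
    exact Ideal.subset_span ⟨a, ha, rfl⟩

end ClosedLocus

/-! ### Locality and gluing of subbundles -/

section FrameLemmas
variable {X : Scheme.{0}} {M : X.Modules} {ι κ : Type} [Fintype ι] [Fintype κ] {U : X.Opens}

/-- The span of a part of a frame is cut out by the vanishing of the other coordinates. -/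
lemma IsFrame.mem_span_iff {e : ι ⊕ κ → Γ(M, U)} (he : IsFrame M e) {V : X.Opens} (h : V ≤ U)
    (x : Γ(M, V)) :
    x ∈ Submodule.span Γ(X, V) (Set.range fun i : ι => mres M h (e (Sum.inl i))) ↔
      ∀ j, he.coord h x (Sum.inr j) = 0 := by
  rw [Submodule.mem_span_range_iff_exists_fun]
  constructor
  · rintro ⟨a, ha⟩ j
    rw [he.coord_eq h (a := Sum.elim a 0) (by
      rw [Fintype.sum_sum_type]
      simpa using ha)]
    rfl
  · intro hz
    refine ⟨fun i => he.coord h x (Sum.inl i), ?_⟩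
    conv_rhs => rw [← he.sum_coord h x, Fintype.sum_sum_type]
    simp [hz]

end FrameLemmas

section OpenImm
variable {X T T' : Scheme.{0}} {E : X.Modules}

lemma pullMap_mres (f : T ⟶ X) (g : T' ⟶ T) (f' : T' ⟶ X) (w : g ≫ f = f') {V V₁ : T.Opens}
    {W W₁ : T'.Opens} (h : W ≤ g ⁻¹ᵁ V) (hV : V₁ ≤ V) (hW : W₁ ≤ W) (h₁ : W₁ ≤ g ⁻¹ᵁ V₁)
    (x : Γ((Scheme.Modules.pullback f).obj E, V)) :
    pullMap f g f' w E h₁ (mres _ hV x) = mres _ hW (pullMap f g f' w E h x) := by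
  unfold pullMap
  rw [adjSec_mres, mres_adjSec]

/-- Coordinates pull back as functions. -/
lemma IsFrame.coord_pullMap {ι : Type} [Fintype ι] (f : T ⟶ X) (g : T' ⟶ T) (f' : T' ⟶ X)
    (w : g ≫ f = f') {V : T.Opens} {e : ι → Γ((Scheme.Modules.pullback f).obj E, V)}
    (he : IsFrame _ e) (hp : IsFrame ((Scheme.Modules.pullback f').obj E)
      (fun i => HiggsFlag.pullMap f g f' w E (le_refl (g ⁻¹ᵁ V)) (e i)))
    {W : T.Opens} {W' : T'.Opens} (hW : W ≤ V) (hW' : W' ≤ g ⁻¹ᵁ W)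
    (x : Γ((Scheme.Modules.pullback f).obj E, W)) (i : ι) :
    hp.coord (hW'.trans (g.preimage_mono hW)) (HiggsFlag.pullMap f g f' w E hW' x) i =
      (g.appLE W W' hW').hom (he.coord hW x i) := by
  refine congrFun (hp.coord_eq _ (a := fun i => (g.appLE W W' hW').hom (he.coord hW x i)) ?_) i
  conv_rhs => rw [← he.sum_coord hW x, map_sum]
  refine Finset.sum_congr rfl fun i _ => ?_
  rw [LinearMap.map_smulₛₗ, pullMap_mres f g f' w (le_refl (g ⁻¹ᵁ V)) hW _ hW']

lemma appLE_bijective (g : T' ⟶ T) [IsOpenImmersion g] {V : T.Opens} (hV : V ≤ g.opensRange) :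
    Function.Bijective (g.appLE V (g ⁻¹ᵁ V) le_rfl).hom := by
  rw [Scheme.Hom.appLE_eq_app]
  have := g.isIso_app V hV
  exact ConcreteCategory.bijective_of_isIso (g.app V)

/-- Membership in a subbundle can be tested after an open immersion. -/
lemma mem_sec_of_pullMap_mem {r d : ℕ} (hE : IsLocallyFreeOfRank E r) (f : T ⟶ X) (g : T' ⟶ T)
    [IsOpenImmersion g] (f' : T' ⟶ X) (w : g ≫ f = f')
    (F : Subbundle ((Scheme.Modules.pullback f).obj E) d) {V : T.Opens} (hV : V ≤ g.opensRange)
    {y : Γ((Scheme.Modules.pullback f).obj E, V)}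
    (hy : pullMap f g f' w E (le_refl (g ⁻¹ᵁ V)) y ∈ pullSub f g f' w F (g ⁻¹ᵁ V)) :
    y ∈ F.sec V := by
  refine F.glue fun t ht => ?_
  obtain ⟨V₀, hV₀, c, e, he, hF, hp⟩ := exists_adapted hE f F t
  refine ⟨V ⊓ V₀, inf_le_left, ⟨ht, hV₀⟩, ?_⟩
  have h1 := pullSub_res f g f' w F (g.preimage_mono (inf_le_left (a := V) (b := V₀))) hy
  rw [← pullMap_mres f g f' w _ inf_le_left _ le_rfl,
    pullSub_eq_span f g f' w F hF (hp T' g f' w) (g.preimage_mono inf_le_right),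
    IsFrame.mem_span_iff (hp T' g f' w)] at h1
  rw [hF _ inf_le_right, IsFrame.mem_span_iff he]
  intro j
  have h2 := h1 j
  rw [he.coord_pullMap f g f' w (hp T' g f' w) inf_le_right le_rfl] at h2
  exact (map_eq_zero_iff _ (appLE_bijective g (inf_le_left.trans hV)).1).1 h2

/-- Inclusions of subbundles can be tested on the members of an open cover. -/
lemma Subbundle.le_of_cover {r d d' : ℕ} (hE : IsLocallyFreeOfRank E r) {J : Type*}
    {Y : J → Scheme.{0}} (i : ∀ j, Y j ⟶ T) [∀ j, IsOpenImmersion (i j)]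
    (hi : ∀ t : T, ∃ j, t ∈ (i j).opensRange) (f : T ⟶ X)
    (F : Subbundle ((Scheme.Modules.pullback f).obj E) d)
    (F' : Subbundle ((Scheme.Modules.pullback f).obj E) d')
    (h : ∀ j V, (F.pull hE f (i j) (i j ≫ f) rfl).sec V ≤ (F'.pull hE f (i j) (i j ≫ f) rfl).sec V)
    (V : T.Opens) : F.sec V ≤ F'.sec V := by
  intro x hx
  refine F'.glue fun t ht => ?_
  obtain ⟨j, hj⟩ := hi t
  refine ⟨V ⊓ (i j).opensRange, inf_le_left, ⟨ht, hj⟩, ?_⟩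
  refine mem_sec_of_pullMap_mem hE f (i j) (i j ≫ f) rfl F' inf_le_right (h j _ ?_)
  exact pullMap_mem_pullSub f (i j) (i j ≫ f) rfl F
    (le_refl ((i j) ⁻¹ᵁ (V ⊓ (i j).opensRange))) (F.res inf_le_left hx)

lemma Subbundle.ext_of_cover {r d : ℕ} (hE : IsLocallyFreeOfRank E r) {J : Type*} {Y : J → Scheme.{0}}
    (i : ∀ j, Y j ⟶ T) [∀ j, IsOpenImmersion (i j)] (hi : ∀ t : T, ∃ j, t ∈ (i j).opensRange)
    (f : T ⟶ X) (F F' : Subbundle ((Scheme.Modules.pullback f).obj E) d)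
    (h : ∀ j, F.pull hE f (i j) (i j ≫ f) rfl = F'.pull hE f (i j) (i j ≫ f) rfl) : F = F' := by
  ext V : 2
  exact le_antisymm (F.le_of_cover hE i hi f F' (fun j V => by rw [h]) V)
    (F'.le_of_cover hE i hi f F (fun j V => by rw [h]) V)

lemma Subbundle.ext_of_locally {G : T.Modules} {d : ℕ} (F F' : Subbundle G d)
    (h : ∀ t : T, ∃ V : T.Opens, t ∈ V ∧ ∀ W ≤ V, F.sec W = F'.sec W) : F = F' := by
  have key : ∀ F F' : Subbundle G d,
      (∀ t : T, ∃ V : T.Opens, t ∈ V ∧ ∀ W ≤ V, F.sec W = F'.sec W) →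
      ∀ V, F.sec V ≤ F'.sec V := fun F F' h V x hx => by
    refine F'.glue fun t ht => ?_
    obtain ⟨W, htW, hW⟩ := h t
    exact ⟨V ⊓ W, inf_le_left, ⟨ht, htW⟩, (hW _ inf_le_right) ▸ F.res inf_le_left hx⟩
  ext V : 2
  refine le_antisymm (key F F' h V) (key F' F (fun t => ?_) V)
  obtain ⟨W, htW, hW⟩ := h t
  exact ⟨W, htW, fun W' h' => (hW W' h').symm⟩

/-- Frames descend along open immersions. -/
lemma exists_frame_pullMap_eq {κ ι : Type} [Fintype κ] [Fintype ι] (f : T ⟶ X) (g : T' ⟶ T)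
    [IsOpenImmersion g] (f' : T' ⟶ X) (w : g ≫ f = f') {U : X.Opens} {ε : κ → Γ(E, U)}
    (hε : IsFrame E ε) {V : T.Opens} (hV : V ≤ f ⁻¹ᵁ U) (hVg : V ≤ g.opensRange)
    {e : ι → Γ((Scheme.Modules.pullback f').obj E, g ⁻¹ᵁ V)} (he : IsFrame _ e) :
    ∃ e' : ι → Γ((Scheme.Modules.pullback f).obj E, V), IsFrame _ e' ∧
      ∀ i, pullMap f g f' w E (le_refl (g ⁻¹ᵁ V)) (e' i) = e i := by
  classical
  have hV' : g ⁻¹ᵁ V ≤ f' ⁻¹ᵁ U := by rw [← w]; exact g.preimage_mono hV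
  have h1 := (hε.pullSec f).restrict hV
  have h2 := (hε.pullSec f').restrict hV'
  simp only [mres_pullSec] at h1 h2
  have hb := appLE_bijective g hVg
  have key : ∀ k, HiggsFlag.pullSec f' E hV' (ε k) = HiggsFlag.pullMap f g f' w E le_rfl
      (HiggsFlag.pullSec f E hV (ε k)) := fun k => (pullMap_pullSec _ _ _ _ _ _ _ _ _).symm
  choose P hP using fun i k => hb.2 (h2.coord le_rfl (e i) k)
  choose Q hQ using fun k i => hb.2 (he.coord le_rfl (pullSec f' E hV' (ε k)) i)
  have hQP : ∀ k l, ∑ i, Q k i * P i l = if k = l then 1 else 0 := fun k l => by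
    apply hb.1
    rw [map_sum]
    simp only [map_mul, hP, hQ]
    rw [he.coord_mul_coord h2]
    split <;> simp
  have hPQ : ∀ i j, ∑ k, P i k * Q k j = if i = j then 1 else 0 := fun i j => by
    apply hb.1
    rw [map_sum]
    simp only [map_mul, hP, hQ]
    rw [h2.coord_mul_coord he]
    split <;> simp
  refine ⟨fun i => ∑ k, P i k • pullSec f E hV (ε k), IsFrame.of_change h1 P Q (fun _ => rfl)
    (fun k => ?_) hPQ, fun i => ?_⟩
  · simp only [Finset.smul_sum, smul_smul]
    rw [Finset.sum_comm]
    simp only [← Finset.sum_smul, hQP]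
    simp
  · rw [map_sum]
    conv_rhs => rw [← h2.sum_coord le_rfl (e i)]
    refine Finset.sum_congr rfl fun k _ => ?_
    rw [LinearMap.map_smulₛₗ, mres_pullSec, key, hP]

end OpenImm

section Glue
variable {X T : Scheme.{0}} {E : X.Modules} {r d : ℕ} (hE : IsLocallyFreeOfRank E r)
  {J : Type*} {Y : J → Scheme.{0}} (i : ∀ j, Y j ⟶ T)
  [∀ j, IsOpenImmersion (i j)]
  (f : T ⟶ X) (f' : ∀ j, Y j ⟶ X) (w : ∀ j, i j ≫ f = f' j)
  (F : ∀ j, Subbundle ((Scheme.Modules.pullback (f' j)).obj E) d)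

/-- The sections of `f^* E` whose pull-backs to the members of an open cover lie in given
subbundles. -/
def glueSec (V : T.Opens) : Submodule Γ(T, V) Γ((Scheme.Modules.pullback f).obj E, V) :=
  ⨅ j, ((F j).sec (i j ⁻¹ᵁ V)).comap (pullMap f (i j) (f' j) (w j) E (le_refl (i j ⁻¹ᵁ V)))

include hE in
/-- On a member of the cover, the glued subsheaf is the given one. -/
lemma mem_glueSec_iff
    (hF : ∀ (j j' : J) (A : Scheme.{0}) (a : A ⟶ Y j) (b : A ⟶ Y j') (h : A ⟶ X)
      (ha : a ≫ f' j = h) (hb : b ≫ f' j' = h), a ≫ i j = b ≫ i j' →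
        (F j).pull hE (f' j) a h ha = (F j').pull hE (f' j') b h hb)
    (j : J) {V : T.Opens} (hV : V ≤ (i j).opensRange)
    (x : Γ((Scheme.Modules.pullback f).obj E, V)) :
    x ∈ glueSec i f f' w F V ↔
      pullMap f (i j) (f' j) (w j) E (le_refl (i j ⁻¹ᵁ V)) x ∈ (F j).sec (i j ⁻¹ᵁ V) := by
  refine ⟨fun hx => (Submodule.mem_iInf _).1 hx j, fun hx => (Submodule.mem_iInf _).2 fun j' => ?_⟩
  rw [Submodule.mem_comap]
  let a := pullback.fst (i j) (i j')
  let b := pullback.snd (i j) (i j')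
  have hab : a ≫ i j = b ≫ i j' := pullback.condition
  have ha : a ≫ f' j = a ≫ i j ≫ f := by rw [w]
  have hb : b ≫ f' j' = a ≫ i j ≫ f := by rw [← w, ← Category.assoc, ← hab, Category.assoc]
  have hr : i j' ⁻¹ᵁ V ≤ b.opensRange := fun v hv => by
    obtain ⟨u, hu⟩ := hV hv
    obtain ⟨z, -, hz⟩ := Scheme.Pullback.exists_preimage_pullback u v hu
    exact ⟨z, hz⟩
  refine mem_sec_of_pullMap_mem hE (f' j') b _ hb (F j') hr ?_
  have hle : b ⁻¹ᵁ i j' ⁻¹ᵁ V ≤ a ⁻¹ᵁ i j ⁻¹ᵁ V := by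
    change (b ≫ i j') ⁻¹ᵁ V ≤ (a ≫ i j) ⁻¹ᵁ V
    rw [hab]
  have h1 := pullMap_mem_pullSub (f' j) a _ ha (F j) hle hx
  rw [pullMap_comp f (i j) (f' j) (w j) a _ ha (a ≫ i j) rfl (Category.assoc _ _ _) E _ _ hle] at h1
  rw [pullMap_comp f (i j') (f' j') (w j') b _ hb (a ≫ i j) hab.symm (Category.assoc _ _ _) E _ _ hle]
  exact (congrFun (congrArg Subbundle.sec (hF j j' _ a b _ ha hb hab)) _).le h1

include hE in
/-- Near a point of a member of the cover, a frame of `f^* E` adapted to the given subbundle. -/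
lemma exists_adapted_of_cover (j : J) (u : Y j) :
    ∃ (V : T.Opens) (_ : i j u ∈ V) (_ : V ≤ (i j).opensRange) (c : ℕ)
      (e : Fin d ⊕ Fin c → Γ((Scheme.Modules.pullback f).obj E, V)) (_ : IsFrame _ e)
      (_ : IsFrame ((Scheme.Modules.pullback (f' j)).obj E)
        (fun l => pullMap f (i j) (f' j) (w j) E (le_refl (i j ⁻¹ᵁ V)) (e l))),
      ∀ (W : (Y j).Opens) (h : W ≤ i j ⁻¹ᵁ V), (F j).sec W = Submodule.span Γ(Y j, W)
        (Set.range fun l : Fin d => mres _ h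
          (pullMap f (i j) (f' j) (w j) E (le_refl (i j ⁻¹ᵁ V)) (e (Sum.inl l)))) := by
  obtain ⟨U, hU, ε, hε⟩ := hE (f (i j u))
  obtain ⟨W₀, hW₀, c, e, he, hF, -⟩ := exists_adapted hE (f' j) (F j) u
  let V : T.Opens := i j ''ᵁ W₀ ⊓ f ⁻¹ᵁ U
  have hV : i j ⁻¹ᵁ V ≤ W₀ := by
    rintro z ⟨⟨z', hz', hzz⟩, -⟩
    have : z' = z := (i j).isOpenEmbedding.injective hzz
    rwa [← this]
  have hVr : V ≤ (i j).opensRange := by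
    rintro _ ⟨⟨z', -, rfl⟩, -⟩
    exact ⟨z', rfl⟩
  obtain ⟨e', he', hee'⟩ := exists_frame_pullMap_eq f (i j) (f' j) (w j) hε (V := V)
    inf_le_right hVr (he.restrict hV)
  refine ⟨V, ⟨⟨u, hW₀, rfl⟩, hU⟩, hVr, c, e', he', ?_, fun W h => ?_⟩
  · simp only [hee']
    exact he.restrict hV
  · simp only [hee', mres_mres]
    exact hF W _

/-- Subbundles glue along open covers. -/
lemma Subbundle.exists_glue (hi : ∀ t : T, ∃ j, t ∈ (i j).opensRange)
    (hF : ∀ (j j' : J) (A : Scheme.{0}) (a : A ⟶ Y j) (b : A ⟶ Y j') (h : A ⟶ X)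
      (ha : a ≫ f' j = h) (hb : b ≫ f' j' = h), a ≫ i j = b ≫ i j' →
        (F j).pull hE (f' j) a h ha = (F j').pull hE (f' j') b h hb) :
    ∃ G : Subbundle ((Scheme.Modules.pullback f).obj E) d,
      ∀ j, G.pull hE f (i j) (f' j) (w j) = F j := by
  have hspan : ∀ (j : J) (V : T.Opens) (hVr : V ≤ (i j).opensRange) (c : ℕ)
      (e : Fin d ⊕ Fin c → Γ((Scheme.Modules.pullback f).obj E, V)) (_ : IsFrame _ e)
      (_ : IsFrame ((Scheme.Modules.pullback (f' j)).obj E)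
        (fun l => pullMap f (i j) (f' j) (w j) E (le_refl (i j ⁻¹ᵁ V)) (e l)))
      (_ : ∀ (W : (Y j).Opens) (h : W ≤ i j ⁻¹ᵁ V), (F j).sec W = Submodule.span Γ(Y j, W)
        (Set.range fun l : Fin d => mres _ h
          (pullMap f (i j) (f' j) (w j) E (le_refl (i j ⁻¹ᵁ V)) (e (Sum.inl l))))) (W : T.Opens)
      (h : W ≤ V), glueSec i f f' w F W =
        Submodule.span Γ(T, W) (Set.range fun l : Fin d => mres _ h (e (Sum.inl l))) := by
    intro j V hVr c e he hp hs W h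
    ext x
    rw [mem_glueSec_iff hE i f f' w F hF j (h.trans hVr), he.mem_span_iff,
      hs _ ((i j).preimage_mono h), hp.mem_span_iff]
    refine forall_congr' fun l => ?_
    rw [he.coord_pullMap f (i j) (f' j) (w j) hp h le_rfl]
    exact map_eq_zero_iff _ (appLE_bijective (i j) (h.trans hVr)).1
  let G : Subbundle ((Scheme.Modules.pullback f).obj E) d :=
    { sec := glueSec i f f' w F
      res := fun {V W} h x hx => (Submodule.mem_iInf _).2 fun j => by
        rw [Submodule.mem_comap, pullMap_mres f (i j) (f' j) (w j) (le_refl (i j ⁻¹ᵁ V)) h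
          ((i j).preimage_mono h)]
        exact (F j).res _ ((Submodule.mem_iInf _).1 hx j)
      glue := fun {V x} H => (Submodule.mem_iInf _).2 fun j => by
        rw [Submodule.mem_comap]
        refine (F j).glue fun v hv => ?_
        obtain ⟨W, h, hW, hm⟩ := H (i j v) hv
        refine ⟨i j ⁻¹ᵁ W, (i j).preimage_mono h, hW, ?_⟩
        rw [← pullMap_mres f (i j) (f' j) (w j) (le_refl (i j ⁻¹ᵁ V)) h
          ((i j).preimage_mono h) le_rfl]
        exact (Submodule.mem_iInf _).1 hm j
      frame := fun t => by
        obtain ⟨j, u, rfl⟩ := hi t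
        obtain ⟨V, hV, hVr, c, e, he, hp, hs⟩ := exists_adapted_of_cover hE i f f' w F j u
        exact ⟨V, hV, c, e, he, hspan j V hVr c e he hp hs⟩ }
  refine ⟨G, fun j => Subbundle.ext_of_locally _ _ fun u => ?_⟩
  obtain ⟨V, hV, hVr, c, e, he, hp, hs⟩ := exists_adapted_of_cover hE i f f' w F j u
  refine ⟨i j ⁻¹ᵁ V, hV, fun W hW => ?_⟩
  rw [hs W hW]
  exact pullSub_eq_span f (i j) (f' j) (w j) G (hspan j V hVr c e he hp hs) hp hW

end Glue

/-! ### Graphs of matrices as subbundles -/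

section Graph
variable {X T T' : Scheme.{0}} {E : X.Modules} {U : X.Opens} {d c : ℕ}

/-- The subbundle generated by the first `d` members of a global frame. -/
def Subbundle.ofFrame {G : T.Modules} {e : Fin d ⊕ Fin c → Γ(G, ⊤)} (he : IsFrame G e) :
    Subbundle G d where
  sec V := Submodule.span Γ(T, V) (Set.range fun l : Fin d => mres G le_top (e (Sum.inl l)))
  res {V W} h x hx := by
    rw [he.mem_span_iff] at hx ⊢
    intro j
    rw [he.coord_mres le_top h, hx, map_zero]
  glue {V x} H := he.mem_span_of_locally le_top x H
  frame t := ⟨⊤, trivial, c, e, he, fun _ _ => rfl⟩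

/-- The frame `(f^* εₗ + ∑ₘ Mₗₘ f^* ε'ₘ, f^* ε'ₘ)` of `f^* E`, for a frame `(εₗ, ε'ₘ)` of `E` over an open set
that contains the image of `f`. -/
def graphFrame (f : T ⟶ X) (hf : ⊤ ≤ f ⁻¹ᵁ U) (ε : Fin d ⊕ Fin c → Γ(E, U))
    (M : Fin d → Fin c → Γ(T, ⊤)) : Fin d ⊕ Fin c → Γ((Scheme.Modules.pullback f).obj E, ⊤) :=
  Sum.elim (fun l => pullSec f E hf (ε (Sum.inl l)) +
      ∑ m, M l m • pullSec f E hf (ε (Sum.inr m)))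
    (fun m => pullSec f E hf (ε (Sum.inr m)))

variable {ε : Fin d ⊕ Fin c → Γ(E, U)} (hε : IsFrame E ε)

lemma isFrame_pullSec {ι : Type} [Fintype ι] {ε : ι → Γ(E, U)} (hε : IsFrame E ε)
    (f : T ⟶ X) {V : T.Opens} (hf : V ≤ f ⁻¹ᵁ U) :
    IsFrame ((Scheme.Modules.pullback f).obj E) (fun i => pullSec f E hf (ε i)) := by
  have := (hε.pullSec f).restrict hf
  simpa only [mres_pullSec] using this

include hε in
lemma isFrame_graphFrame (f : T ⟶ X) (hf : ⊤ ≤ f ⁻¹ᵁ U) (M : Fin d → Fin c → Γ(T, ⊤)) :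
    IsFrame _ (graphFrame f hf ε M) := by
  refine (isFrame_pullSec hε f hf).of_change
    (Sum.elim (fun l => Sum.elim (Pi.single l 1) (M l)) (fun m => Pi.single (Sum.inr m) 1))
    (Sum.elim (fun l => Sum.elim (Pi.single l 1) (fun m => - M l m))
      (fun m => Pi.single (Sum.inr m) 1)) ?_ ?_ ?_
  · rintro (l | m)
    · simp [graphFrame, Fintype.sum_sum_type, Pi.single_apply]
    · simp [graphFrame, Pi.single_apply]
  · rintro (l | m)
    · simp [graphFrame, Fintype.sum_sum_type, Pi.single_apply, Finset.sum_add_distrib]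
    · simp [graphFrame, Pi.single_apply]
  · rintro (l | m) (l' | m')
    · simp [Fintype.sum_sum_type, Pi.single_apply, eq_comm]
    · simp [Fintype.sum_sum_type, Pi.single_apply]
    · simp [Pi.single_apply]
    · simp [Pi.single_apply, eq_comm]

/-- The graph of the matrix `M`, as a map from the span of the `εₗ` to the span of the `ε'ₘ`. -/
def graphSub (f : T ⟶ X) (hf : ⊤ ≤ f ⁻¹ᵁ U) (M : Fin d → Fin c → Γ(T, ⊤)) :
    Subbundle ((Scheme.Modules.pullback f).obj E) d :=
  Subbundle.ofFrame (isFrame_graphFrame hε f hf M)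

lemma pullMap_graphFrame (f : T ⟶ X) (hf : ⊤ ≤ f ⁻¹ᵁ U) (M : Fin d → Fin c → Γ(T, ⊤))
    (g : T' ⟶ T) (f' : T' ⟶ X) (w : g ≫ f = f') (hf' : ⊤ ≤ f' ⁻¹ᵁ U) (i : Fin d ⊕ Fin c) :
    pullMap f g f' w E (le_refl (g ⁻¹ᵁ ⊤)) (graphFrame f hf ε M i) =
      graphFrame f' hf' ε (fun l m => g.appTop.hom (M l m)) i := by
  have h1 : ∀ i, pullMap f g f' w E (le_refl (g ⁻¹ᵁ ⊤)) (pullSec f E hf (ε i)) =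
      pullSec f' E hf' (ε i) := fun i => pullMap_pullSec _ _ _ _ _ _ _ _ _
  rcases i with l | m
  · change pullMap f g f' w E (le_refl (g ⁻¹ᵁ ⊤)) (pullSec f E hf (ε (Sum.inl l)) +
      ∑ m, M l m • pullSec f E hf (ε (Sum.inr m))) = pullSec f' E hf' (ε (Sum.inl l)) +
      ∑ m, g.appTop.hom (M l m) • pullSec f' E hf' (ε (Sum.inr m))
    rw [map_add, h1, map_sum]
    congr 1
    refine Finset.sum_congr rfl fun m _ => ?_
    rw [LinearMap.map_smulₛₗ, h1, Scheme.Hom.appLE_eq_app]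
    rfl
  · exact h1 _

lemma graphSub_pull {r : ℕ} (hE : IsLocallyFreeOfRank E r) (f : T ⟶ X) (hf : ⊤ ≤ f ⁻¹ᵁ U)
    (M : Fin d → Fin c → Γ(T, ⊤)) (g : T' ⟶ T) (f' : T' ⟶ X) (w : g ≫ f = f')
    (hf' : ⊤ ≤ f' ⁻¹ᵁ U) :
    (graphSub hε f hf M).pull hE f g f' w = graphSub hε f' hf' (fun l m => g.appTop.hom (M l m)) := by
  refine Subbundle.ext_of_locally _ _ fun t => ⟨⊤, trivial, fun W _ => ?_⟩
  have hp : IsFrame ((Scheme.Modules.pullback f').obj E)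
      (fun i => pullMap f g f' w E (le_refl (g ⁻¹ᵁ ⊤)) (graphFrame f hf ε M i)) := by
    simp only [pullMap_graphFrame f hf M g f' w hf']
    exact isFrame_graphFrame hε f' hf' _
  refine (pullSub_eq_span f g f' w (graphSub hε f hf M) (e := graphFrame f hf ε M)
    (fun W h => rfl) hp le_top).trans ?_
  simp only [pullMap_graphFrame f hf M g f' w hf']
  rfl

lemma graphSub_injective (f : T ⟶ X) (hf : ⊤ ≤ f ⁻¹ᵁ U) {M M' : Fin d → Fin c → Γ(T, ⊤)}
    (h : graphSub hε f hf M = graphSub hε f hf M') : M = M' := by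
  have hfr := isFrame_pullSec hε f hf
  funext l m
  have h1 : graphFrame f hf ε M (Sum.inl l) ∈ (graphSub hε f hf M').sec ⊤ := by
    rw [← h]
    exact Submodule.subset_span ⟨l, mres_self _ _⟩
  obtain ⟨a, ha⟩ := (Submodule.mem_span_range_iff_exists_fun _).1 h1
  have key : ∀ (N : Fin d → Fin c → Γ(T, ⊤)) l, graphFrame f hf ε N (Sum.inl l) =
      ∑ i, (Sum.elim (Pi.single l 1) (N l) : Fin d ⊕ Fin c → Γ(T, ⊤)) i • pullSec f E hf (ε i) := by
    intro N l
    simp [graphFrame, Fintype.sum_sum_type, Pi.single_apply]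
  simp only [mres_self, key, Finset.smul_sum, smul_smul] at ha
  rw [Finset.sum_comm] at ha
  simp only [← Finset.sum_smul] at ha
  have h2 := hfr.eq_coord le_rfl (a := fun i => ∑ l', a l' *
    (Sum.elim (Pi.single l' 1) (M' l') : Fin d ⊕ Fin c → Γ(T, ⊤)) i)
    (b := Sum.elim (Pi.single l 1) (M l)) (by simpa only [mres_self] using ha)
  have h3 : a = Pi.single l 1 := by
    funext l'
    have := congrFun h2 (Sum.inl l')
    simpa [Pi.single_apply] using this
  have h4 := congrFun h2 (Sum.inr m)
  rw [h3] at h4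
  simpa [Pi.single_apply] using h4.symm

/-- A subbundle whose projection to the span of the `εₗ` is invertible is a graph. -/
lemma exists_eq_graphSub (f : T ⟶ X) (hf : ⊤ ≤ f ⁻¹ᵁ U)
    (F : Subbundle ((Scheme.Modules.pullback f).obj E) d)
    (u : Fin d → Γ((Scheme.Modules.pullback f).obj E, ⊤))
    (hF : ∀ W : T.Opens, F.sec W = Submodule.span Γ(T, W) (Set.range fun l => mres _ le_top (u l)))
    (hu : IsUnit (Matrix.of fun l l' : Fin d =>
      (isFrame_pullSec hε f hf).coord le_rfl (u l) (Sum.inl l')).det) :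
    ∃ M, F = graphSub hε f hf M := by
  have hfr := isFrame_pullSec hε f hf
  set N : Matrix (Fin d) (Fin d) Γ(T, ⊤) := Matrix.of fun l l' : Fin d =>
      (isFrame_pullSec hε f hf).coord le_rfl (u l) (Sum.inl l') with hN
  let K : Matrix (Fin d) (Fin c) Γ(T, ⊤) := Matrix.of fun l m => hfr.coord le_rfl (u l) (Sum.inr m)
  have hNi : N⁻¹ * N = 1 := Matrix.nonsing_inv_mul _ hu
  have hNi' : N * N⁻¹ = 1 := Matrix.mul_nonsing_inv _ hu
  have hug : ∀ l, u l = ∑ l', N l l' • graphFrame f hf ε (N⁻¹ * K) (Sum.inl l') := fun l => by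
    have hK : K = N * (N⁻¹ * K) := by rw [← Matrix.mul_assoc, hNi', Matrix.one_mul]
    conv_lhs => rw [← hfr.sum_coord le_rfl (u l)]
    simp only [mres_self, Fintype.sum_sum_type, graphFrame, Sum.elim_inl, smul_add,
      Finset.sum_add_distrib, Finset.smul_sum, smul_smul]
    congr 1
    rw [Finset.sum_comm]
    simp only [← Finset.sum_smul]
    refine Finset.sum_congr rfl fun m _ => ?_
    congr 1
    exact congrFun (congrFun hK l) m
  have hgu : ∀ l, graphFrame f hf ε (N⁻¹ * K) (Sum.inl l) = ∑ l', N⁻¹ l l' • u l' := fun l => by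
    simp only [hug, Finset.smul_sum, smul_smul]
    rw [Finset.sum_comm]
    simp only [← Finset.sum_smul, ← Matrix.mul_apply, hNi]
    simp [Matrix.one_apply]
  refine ⟨N⁻¹ * K, ?_⟩
  ext W : 2
  rw [hF]
  apply le_antisymm
  · rw [Submodule.span_le]
    rintro _ ⟨l, rfl⟩
    change mres _ le_top (u l) ∈ Submodule.span _ _
    rw [hug, map_sum]
    refine Submodule.sum_mem _ fun l' _ => ?_
    rw [LinearMap.map_smulₛₗ]
    exact Submodule.smul_mem _ _ (Submodule.subset_span ⟨l', rfl⟩)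
  · refine Submodule.span_le.2 ?_
    rintro _ ⟨l, rfl⟩
    change mres _ le_top (graphFrame f hf ε (N⁻¹ * K) (Sum.inl l)) ∈ Submodule.span _ _
    rw [hgu, map_sum]
    refine Submodule.sum_mem _ fun l' _ => ?_
    rw [LinearMap.map_smulₛₗ]
    exact Submodule.smul_mem _ _ (Submodule.subset_span ⟨l', rfl⟩)

/-- The projection of a graph to the span of the `εₗ` is invertible. -/
lemma isUnit_det_of_eq_graphSub (f : T ⟶ X) (hf : ⊤ ≤ f ⁻¹ᵁ U) (M : Fin d → Fin c → Γ(T, ⊤))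
    {V : T.Opens} (hV : V ≤ f ⁻¹ᵁ U) (u : Fin d → Γ((Scheme.Modules.pullback f).obj E, V))
    (hu : (graphSub hε f hf M).sec V = Submodule.span Γ(T, V) (Set.range u)) :
    IsUnit (Matrix.of fun l l' : Fin d =>
      (isFrame_pullSec hε f hV).coord le_rfl (u l) (Sum.inl l')).det := by
  have hfr := isFrame_pullSec hε f hV
  have h1 : ∀ l, ∃ b : Fin d → Γ(T, V),
      ∑ l', b l' • u l' = mres _ le_top (graphFrame f hf ε M (Sum.inl l)) := fun l => by
    rw [← Submodule.mem_span_range_iff_exists_fun, ← hu]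
    exact Submodule.subset_span ⟨l, rfl⟩
  choose B hB using h1
  refine Matrix.isUnit_det_of_left_inverse (B := Matrix.of B) ?_
  ext l l'
  rw [Matrix.mul_apply]
  have key : mres _ le_top (graphFrame f hf ε M (Sum.inl l)) =
      ∑ i, (Sum.elim (Pi.single l 1) (fun m => rres le_top (M l m)) : Fin d ⊕ Fin c → Γ(T, V)) i •
        pullSec f E hV (ε i) := by
    change mres _ le_top (pullSec f E hf (ε (Sum.inl l)) +
      ∑ m, M l m • pullSec f E hf (ε (Sum.inr m))) = _
    rw [map_add, map_sum]
    simp only [LinearMap.map_smulₛₗ, mres_pullSec]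
    simp [Fintype.sum_sum_type, Pi.single_apply]
  have h2 := hB l
  rw [key] at h2
  have h3 : ∀ l, u l = ∑ i, hfr.coord le_rfl (u l) i • pullSec f E hV (ε i) := fun l => by
    conv_lhs => rw [← hfr.sum_coord le_rfl (u l)]
    simp only [mres_self]
  rw [Finset.sum_congr rfl fun l' _ => by rw [h3 l']] at h2
  simp only [Finset.smul_sum, smul_smul] at h2
  rw [Finset.sum_comm] at h2
  simp only [← Finset.sum_smul] at h2
  have h4 := hfr.eq_coord le_rfl (a := fun i => ∑ l', B l l' * hfr.coord le_rfl (u l') i)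
    (b := Sum.elim (Pi.single l 1) (fun m => rres le_top (M l m)))
    (by simpa only [mres_self] using h2)
  have h5 := congrFun h4 (Sum.inl l')
  simp only [Sum.elim_inl, Pi.single_apply] at h5
  rw [Matrix.one_apply]
  exact h5.trans (by simp [eq_comm])

end Graph

section LinearAlgebra

/-- A matrix over a field with a right inverse has a maximal minor which does not vanish. -/
lemma exists_equiv_det_ne_zero {K : Type} [Field K] {d c r : ℕ} (hr : d + c = r)
    (A : Matrix (Fin d) (Fin r) K) (B : Matrix (Fin r) (Fin d) K) (h : A * B = 1) :
    ∃ σ : Fin d ⊕ Fin c ≃ Fin r, (A.submatrix id (σ ∘ Sum.inl)).det ≠ 0 := by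
  have htop : Submodule.span K (Set.range A.col) = ⊤ := by
    rw [eq_top_iff]
    intro v _
    have : v = A.mulVec (B.mulVec v) := by rw [Matrix.mulVec_mulVec, h, Matrix.one_mulVec]
    rw [this, Matrix.mulVec_eq_sum]
    refine Submodule.sum_mem _ fun i _ => ?_
    rw [op_smul_eq_smul]
    exact Submodule.smul_mem _ _ (Submodule.subset_span (Set.mem_range_self i))
  have hfin : Module.finrank K (Submodule.span K (Set.range A.col)) = d := by
    rw [htop, finrank_top, Module.finrank_fin_fun]
  obtain ⟨v, hv, -, hvi⟩ := Submodule.exists_fun_fin_finrank_span_eq K (Set.range A.col)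
  choose τ hτ using hv
  have hτi : Function.Injective τ := fun i j hij => by
    apply hvi.injective
    rw [← hτ, ← hτ, hij]
  let τ' : Fin d → Fin r := τ ∘ (finCongr hfin.symm)
  have hτ' : Function.Injective τ' := hτi.comp (finCongr hfin.symm).injective
  have hcard : Fintype.card ((Set.range τ')ᶜ : Set (Fin r)) = c := by
    rw [Fintype.card_compl_set, Set.card_range_of_injective hτ', Fintype.card_fin, Fintype.card_fin]
    omega
  let σ : Fin d ⊕ Fin c ≃ Fin r := ((Equiv.ofInjective τ' hτ').sumCongr
    (Fintype.equivFinOfCardEq hcard).symm).trans (Equiv.Set.sumCompl (Set.range τ'))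
  have hσ : σ ∘ Sum.inl = τ' := by
    funext i
    simp [σ]
  refine ⟨σ, ?_⟩
  rw [hσ, ← Matrix.det_transpose, ← isUnit_iff_ne_zero, ← Matrix.isUnit_iff_isUnit_det,
    ← Matrix.linearIndependent_rows_iff_isUnit]
  have : (A.submatrix id τ').transpose.row = v ∘ finCongr hfin.symm := by
    funext i
    exact hτ _
  rw [this]
  exact hvi.comp _ (finCongr hfin.symm).injective

end LinearAlgebra

/-! ### Points of the Grassmann bundle and its charts -/

section Total
variable {X T T' T'' : Scheme.{0}} {E : X.Modules} {r d : ℕ} (hE : IsLocallyFreeOfRank E r)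

/-- A morphism `f : T ⟶ X` together with a rank `d` subbundle of `f^* E`: a `T`-point of the
Grassmann bundle, not relative to `X`. -/
abbrev GrassPoint (E : X.Modules) (d : ℕ) (T : Scheme.{0}) : Type :=
  Σ f : T ⟶ X, Subbundle ((Scheme.Modules.pullback f).obj E) d

/-- The pull-back of a point of the Grassmann bundle. -/
def GrassPoint.pull (x : GrassPoint E d T) (g : T' ⟶ T) : GrassPoint E d T' :=
  ⟨g ≫ x.1, x.2.pull hE x.1 g _ rfl⟩

lemma GrassPoint.mk_pull (f : T ⟶ X) (F : Subbundle ((Scheme.Modules.pullback f).obj E) d)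
    (g : T' ⟶ T) (f' : T' ⟶ X) (w : g ≫ f = f') :
    (⟨f', F.pull hE f g f' w⟩ : GrassPoint E d T') = GrassPoint.pull hE ⟨f, F⟩ g := by
  subst w
  rfl

lemma GrassPoint.pull_id (x : GrassPoint E d T) : x.pull hE (𝟙 T) = x := by
  obtain ⟨f, F⟩ := x
  rw [← mk_pull hE f F (𝟙 T) f (Category.id_comp f), Subbundle.pull_id]

lemma GrassPoint.pull_pull (x : GrassPoint E d T) (g : T' ⟶ T) (g' : T'' ⟶ T') :
    (x.pull hE g).pull hE g' = x.pull hE (g' ≫ g) := by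
  obtain ⟨f, F⟩ := x
  rw [← mk_pull hE f F (g' ≫ g) (g' ≫ g ≫ f) (Category.assoc _ _ _),
    Subbundle.pull_pull hE f g (g ≫ f) rfl g' (g' ≫ g ≫ f) rfl (g' ≫ g) rfl (Category.assoc _ _ _)]
  rfl

lemma GrassPoint.pull_eq_pull {f₁ : T ⟶ X} {f₂ : T' ⟶ X}
    {F₁ : Subbundle ((Scheme.Modules.pullback f₁).obj E) d}
    {F₂ : Subbundle ((Scheme.Modules.pullback f₂).obj E) d} {a : T'' ⟶ T} {b : T'' ⟶ T'}
    {h : T'' ⟶ X} (ha : a ≫ f₁ = h) (hb : b ≫ f₂ = h)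
    (e : GrassPoint.pull hE ⟨f₁, F₁⟩ a = GrassPoint.pull hE ⟨f₂, F₂⟩ b) :
    F₁.pull hE f₁ a h ha = F₂.pull hE f₂ b h hb := by
  rw [← mk_pull hE f₁ F₁ a h ha, ← mk_pull hE f₂ F₂ b h hb] at e
  exact eq_of_heq (Sigma.mk.inj e).2

lemma GrassPoint.ext_of_openCover (𝒰 : T.OpenCover) {x y : GrassPoint E d T}
    (h : ∀ j, x.pull hE (𝒰.f j) = y.pull hE (𝒰.f j)) : x = y := by
  obtain ⟨f, F⟩ := x
  obtain ⟨f', F'⟩ := y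
  obtain rfl : f = f' := 𝒰.hom_ext _ _ fun j => congrArg Sigma.fst (h j)
  refine congrArg _ (Subbundle.ext_of_cover hE 𝒰.f (fun t => ?_) f F F' fun j => ?_)
  · obtain ⟨j, u, hu⟩ := 𝒰.exists_eq t
    exact ⟨j, u, hu⟩
  · exact GrassPoint.pull_eq_pull hE rfl rfl (h j)

lemma GrassPoint.exists_glue (𝒰 : T.OpenCover) (x : ∀ j, GrassPoint E d (𝒰.X j))
    (h : ∀ (j j' : 𝒰.I₀) (A : Scheme.{0}) (a : A ⟶ 𝒰.X j) (b : A ⟶ 𝒰.X j'),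
      a ≫ 𝒰.f j = b ≫ 𝒰.f j' → (x j).pull hE a = (x j').pull hE b) :
    ∃ y : GrassPoint E d T, ∀ j, y.pull hE (𝒰.f j) = x j := by
  let f : T ⟶ X := 𝒰.glueMorphisms (fun j => (x j).1) fun j j' =>
    congrArg Sigma.fst (h j j' _ _ _ pullback.condition)
  have hf : ∀ j, 𝒰.f j ≫ f = (x j).1 := fun j => 𝒰.ι_glueMorphisms _ _ _
  obtain ⟨G, hG⟩ := Subbundle.exists_glue hE 𝒰.f f (fun j => (x j).1) hf (fun j => (x j).2)
    (fun t => by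
      obtain ⟨j, u, hu⟩ := 𝒰.exists_eq t
      exact ⟨j, u, hu⟩)
    (fun j j' A a b k ha hb hab => GrassPoint.pull_eq_pull hE ha hb (h j j' A a b hab))
  refine ⟨⟨f, G⟩, fun j => ?_⟩
  rw [← mk_pull hE f G (𝒰.f j) _ (hf j), hG]

/-- The functor `T ↦ GrassPoint E d T`. -/
def grassPointFunctor (d : ℕ) : Scheme.{0}ᵒᵖ ⥤ Type where
  obj T := GrassPoint E d T.unop
  map g := ↾(fun x => x.pull hE g.unop)
  map_id _ := ConcreteCategory.hom_ext _ _ fun x => GrassPoint.pull_id hE x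
  map_comp g g' := ConcreteCategory.hom_ext _ _ fun x =>
    (GrassPoint.pull_pull hE x g.unop g'.unop).symm

lemma isSheaf_grassPointFunctor (d : ℕ) :
    Presieve.IsSheaf Scheme.zariskiTopology (grassPointFunctor hE d) := by
  rw [Precoverage.isSheaf_toGrothendieck_iff_of_isStableUnderBaseChange]
  rintro T S hS x hx
  obtain ⟨(𝒰 : T.OpenCover), rfl⟩ := Scheme.exists_cover_of_mem_pretopology hS
  obtain ⟨y, hy⟩ := GrassPoint.exists_glue hE 𝒰 (fun j => x (𝒰.f j) (.mk j))
    (fun j j' A a b hab => hx a b _ _ hab)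
  refine ⟨y, ?_, fun y' hy' => ?_⟩
  · rintro Z e ⟨j⟩
    exact hy j
  · refine GrassPoint.ext_of_openCover hE 𝒰 fun j => ?_
    exact (hy' (𝒰.f j) (.mk j)).trans (hy j).symm

end Total

section Chart
variable {X T T' : Scheme.{0}} {E : X.Modules} {U : X.Opens} {r d c : ℕ}
  {ε : Fin d ⊕ Fin c → Γ(E, U)} (hε : IsFrame E ε) (hE : IsLocallyFreeOfRank E r)

/-- The chart of the Grassmann bundle given by a frame over `U`: the space of matrices over `U`. -/
abbrev Chart (U : X.Opens) (d c : ℕ) : Scheme.{0} := AffineSpace (Fin d × Fin c) (U : Scheme.{0})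

/-- The projection of a chart to `X`. -/
def Chart.proj (U : X.Opens) (d c : ℕ) : Chart U d c ⟶ X := (Chart U d c ↘ (U : Scheme.{0})) ≫ U.ι

lemma Chart.le_preimage (h : T ⟶ Chart U d c) : ⊤ ≤ (h ≫ Chart.proj U d c) ⁻¹ᵁ U := fun t _ =>
  ((Chart U d c ↘ (U : Scheme.{0})) (h t)).2

/-- The point of the Grassmann bundle given by a point of a chart: the graph of the matrix. -/
def chartPoint (h : T ⟶ Chart U d c) : GrassPoint E d T :=
  ⟨h ≫ Chart.proj U d c, graphSub hε _ (Chart.le_preimage h)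
    fun l m => h.appTop.hom (AffineSpace.coord _ (l, m))⟩

lemma mk_graphSub_congr {f f' : T ⟶ X} (w : f = f') (hf : ⊤ ≤ f ⁻¹ᵁ U) (hf' : ⊤ ≤ f' ⁻¹ᵁ U)
    {M M' : Fin d → Fin c → Γ(T, ⊤)} (hM : M = M') :
    (⟨f, graphSub hε f hf M⟩ : GrassPoint E d T) = ⟨f', graphSub hε f' hf' M'⟩ := by
  subst w hM
  rfl

lemma chartPoint_pull (h : T ⟶ Chart U d c) (g : T' ⟶ T) :
    (chartPoint hε h).pull hE g = chartPoint hε (g ≫ h) := by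
  have hle : ⊤ ≤ (g ≫ h ≫ Chart.proj U d c) ⁻¹ᵁ U := fun t _ =>
    ((Chart U d c ↘ (U : Scheme.{0})) (h (g t))).2
  unfold chartPoint GrassPoint.pull
  dsimp only
  rw [graphSub_pull hε hE _ _ _ g _ rfl hle]
  refine mk_graphSub_congr hε (Category.assoc _ _ _).symm _ _ ?_
  funext l m
  rw [Scheme.Hom.comp_appTop]
  rfl

lemma chartPoint_injective : Function.Injective (chartPoint (T := T) hε) := by
  intro h h' e
  have e1 : h ≫ Chart.proj U d c = h' ≫ Chart.proj U d c := congrArg Sigma.fst e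
  have e2 : h ≫ (Chart U d c ↘ (U : Scheme.{0})) = h' ≫ (Chart U d c ↘ (U : Scheme.{0})) := by
    rw [← cancel_mono U.ι]
    simpa [Chart.proj] using e1
  refine AffineSpace.hom_ext e2 fun ⟨l, m⟩ => ?_
  have hle := Chart.le_preimage h'
  have e3 : (⟨h' ≫ Chart.proj U d c, graphSub hε _ hle
      fun l m => h.appTop.hom (AffineSpace.coord _ (l, m))⟩ : GrassPoint E d T) =
        chartPoint hε h' := by
    rw [← e]
    exact mk_graphSub_congr hε e1.symm _ _ rfl
  have e4 := graphSub_injective hε _ _ (eq_of_heq (Sigma.mk.inj e3).2)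
  exact congrFun (congrFun e4 l) m

/-- Every graph is a point of the chart. -/
lemma exists_chartPoint_eq (f : T ⟶ X) (hf : ⊤ ≤ f ⁻¹ᵁ U) (M : Fin d → Fin c → Γ(T, ⊤)) :
    ∃ h : T ⟶ Chart U d c, chartPoint hε h = ⟨f, graphSub hε f hf M⟩ := by
  have hr : Set.range f ⊆ Set.range U.ι := by
    rintro _ ⟨t, rfl⟩
    rw [Scheme.Opens.range_ι]
    exact hf trivial
  refine ⟨AffineSpace.homOfVector (IsOpenImmersion.lift U.ι f hr) fun i => M i.1 i.2, ?_⟩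
  refine mk_graphSub_congr hε ?_ _ _ ?_
  · simp [Chart.proj]
  · funext l m
    exact AffineSpace.homOfVector_appTop_coord _ _ _

include hE in
/-- Being a point of a chart is a local property. -/
lemma exists_chartPoint_of_openCover (𝒰 : T.OpenCover) (x : GrassPoint E d T)
    (h : ∀ j, ∃ k : 𝒰.X j ⟶ Chart U d c, chartPoint hε k = x.pull hE (𝒰.f j)) :
    ∃ k : T ⟶ Chart U d c, chartPoint hε k = x := by
  choose k hk using h
  refine ⟨𝒰.glueMorphisms k fun j j' => ?_, ?_⟩
  · apply chartPoint_injective hε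
    rw [← chartPoint_pull hε hE, ← chartPoint_pull hε hE, hk, hk, GrassPoint.pull_pull,
      GrassPoint.pull_pull, pullback.condition]
  · refine GrassPoint.ext_of_openCover hE 𝒰 fun j => ?_
    rw [chartPoint_pull, 𝒰.ι_glueMorphisms, hk]

/-- The morphism of functors given by a chart. -/
def chartHom : yoneda.obj (Chart U d c) ⟶ grassPointFunctor hE d :=
  yonedaEquiv.symm (chartPoint hε (𝟙 _))

lemma chartHom_app (h : T ⟶ Chart U d c) :
    (chartHom hε hE).app (op T) h = chartPoint hε h := by
  change (grassPointFunctor hE d).map h.op (chartPoint hε (𝟙 _)) = _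
  exact (chartPoint_pull hε hE (𝟙 _) h).trans (congrArg _ (Category.comp_id h))

/-- The minor of a family of sections of `f^* E` on the first members of a frame. -/
def minor (f : T ⟶ X) {V : T.Opens} (hV : V ≤ f ⁻¹ᵁ U)
    (u : Fin d → Γ((Scheme.Modules.pullback f).obj E, V)) : Γ(T, V) :=
  (Matrix.of fun l l' : Fin d => (isFrame_pullSec hε f hV).coord le_rfl (u l) (Sum.inl l')).det

lemma minor_pullMap (f : T ⟶ X) {V : T.Opens} (hV : V ≤ f ⁻¹ᵁ U)
    (u : Fin d → Γ((Scheme.Modules.pullback f).obj E, V)) (g : T' ⟶ T) (f' : T' ⟶ X)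
    (w : g ≫ f = f') {V' : T'.Opens} (h : V' ≤ g ⁻¹ᵁ V) (hV' : V' ≤ f' ⁻¹ᵁ U) :
    minor hε f' hV' (fun l => pullMap f g f' w E h (u l)) =
      (g.appLE V V' h).hom (minor hε f hV u) := by
  unfold minor
  rw [RingHom.map_det]
  congr 1
  ext l l'
  simp only [Matrix.of_apply, RingHom.mapMatrix_apply, Matrix.map_apply]
  refine congrFun ((isFrame_pullSec hε f' hV').coord_eq le_rfl (a := fun i =>
    (g.appLE V V' h).hom ((isFrame_pullSec hε f hV).coord le_rfl (u l) i)) ?_) _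
  conv_rhs => rw [← (isFrame_pullSec hε f hV).sum_coord le_rfl (u l), map_sum]
  refine Finset.sum_congr rfl fun i _ => ?_
  rw [LinearMap.map_smulₛₗ, mres_self, mres_self, pullMap_pullSec f g f' w E hV h hV']

/-- A point of the Grassmann bundle belongs to a chart exactly where a minor is invertible. -/
lemma exists_chartPoint_iff_minor (x : GrassPoint E d T) {V : T.Opens} (hV : V ≤ x.1 ⁻¹ᵁ U)
    {c' : ℕ} {e : Fin d ⊕ Fin c' → Γ((Scheme.Modules.pullback x.1).obj E, V)}
    (hF : ∀ (W : T.Opens) (h : W ≤ V),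
      x.2.sec W = Submodule.span Γ(T, W) (Set.range fun i : Fin d => mres _ h (e (Sum.inl i))))
    (hp : ∀ (T' : Scheme.{0}) (g : T' ⟶ T) (f' : T' ⟶ X) (w : g ≫ x.1 = f'),
      IsFrame ((Scheme.Modules.pullback f').obj E)
        (fun i => pullMap x.1 g f' w E (le_refl (g ⁻¹ᵁ V)) (e i)))
    (g : T' ⟶ T) (hg : ⊤ ≤ g ⁻¹ᵁ V) :
    (∃ h : T' ⟶ Chart U d c, chartPoint hε h = x.pull hE g) ↔
      IsUnit ((g.appLE V ⊤ hg).hom (minor hε x.1 hV fun l => e (Sum.inl l))) := by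
  have hf' : ⊤ ≤ (g ≫ x.1) ⁻¹ᵁ U := hg.trans (g.preimage_mono hV)
  have hsec : ∀ W : T'.Opens, (x.2.pull hE x.1 g _ rfl).sec W = Submodule.span Γ(T', W)
      (Set.range fun l => mres _ le_top (pullMap x.1 g (g ≫ x.1) rfl E hg (e (Sum.inl l)))) := by
    intro W
    refine (pullSub_eq_span x.1 g (g ≫ x.1) rfl x.2 hF (hp T' g _ rfl)
      (le_top.trans hg)).trans ?_
    unfold pullMap
    simp only [mres_adjSec]
  rw [← minor_pullMap hε x.1 hV _ g (g ≫ x.1) rfl hg hf']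
  constructor
  · rintro ⟨h, hh⟩
    have e1 : h ≫ Chart.proj U d c = g ≫ x.1 := congrArg Sigma.fst hh
    have e2 : (⟨g ≫ x.1, graphSub hε _ hf'
        fun l m => h.appTop.hom (AffineSpace.coord _ (l, m))⟩ : GrassPoint E d T') =
          x.pull hE g := by
      rw [← hh]
      exact mk_graphSub_congr hε e1.symm _ _ rfl
    have e3 := eq_of_heq (Sigma.mk.inj e2).2
    refine isUnit_det_of_eq_graphSub hε (g ≫ x.1) hf' _ hf' _
      ((congrFun (congrArg Subbundle.sec e3) ⊤).trans ?_)
    rw [hsec]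
    simp only [mres_self]
  · intro hu
    obtain ⟨M, hM⟩ := exists_eq_graphSub hε (g ≫ x.1) hf' _ _ hsec hu
    obtain ⟨h, hh⟩ := exists_chartPoint_eq hε (g ≫ x.1) hf' M
    exact ⟨h, by rw [hh, ← hM]; rfl⟩

end Chart

/-! ### Representability of the Grassmann functor -/

section OpenCharts
variable {X T T' : Scheme.{0}} {E : X.Modules} {U : X.Opens} {r d c : ℕ}
  {ε : Fin d ⊕ Fin c → Γ(E, U)} (hε : IsFrame E ε) (hE : IsLocallyFreeOfRank E r)

lemma isUnit_appLE_of_basicOpen {V : T.Opens} (a : Γ(T, V)) (g : T' ⟶ T) (h : ⊤ ≤ g ⁻¹ᵁ V)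
    (hg : ⊤ ≤ g ⁻¹ᵁ T.basicOpen a) : IsUnit ((g.appLE V ⊤ h).hom a) := by
  rw [← appLE_rres g hg (T.basicOpen_le a)]
  exact (T.toRingedSpace.isUnit_res_basicOpen a).map _

/-- The locus where a point of the Grassmann bundle belongs to a chart: the largest open set over
which it does. -/
lemma exists_open_chartPoint_iff (x : GrassPoint E d T) :
    ∃ (W : T.Opens) (k : (W : Scheme.{0}) ⟶ Chart U d c), chartPoint hε k = x.pull hE W.ι ∧
      ∀ (T' : Scheme.{0}) (g : T' ⟶ T) (h : T' ⟶ Chart U d c), chartPoint hε h = x.pull hE g →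
        ∀ t, g t ∈ W := by
  -- the union of all open sets over which `x` belongs to the chart
  let J := {W : T.Opens // ∃ k : (W : Scheme.{0}) ⟶ Chart U d c, chartPoint hε k = x.pull hE W.ι}
  obtain ⟨k, hk⟩ := exists_chartPoint_of_openCover hε hE
    (Scheme.Opens.iSupOpenCover fun W : J => W.1) (x.pull hE (⨆ W : J, W.1).ι) (fun W => by
      obtain ⟨k, hk⟩ := W.2
      refine ⟨k, hk.trans ?_⟩
      exact (congrArg (x.pull hE) (Scheme.homOfLE_ι _ (le_iSup (fun W : J => W.1) W)).symm).trans
        (GrassPoint.pull_pull hE x _ _).symm)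
  refine ⟨⨆ W : J, W.1, k, hk, fun T' g h hh t => ?_⟩
  obtain ⟨V₀, hV₀, c', e, he, hF, -⟩ := exists_adapted hE x.1 x.2 (g t)
  have hfg : h ≫ Chart.proj U d c = g ≫ x.1 := congrArg Sigma.fst hh
  have htU : x.1 (g t) ∈ U := by
    have h1 : t ∈ (h ≫ Chart.proj U d c) ⁻¹ᵁ U := Chart.le_preimage h trivial
    rw [hfg] at h1
    exact h1
  let V := V₀ ⊓ x.1 ⁻¹ᵁ U
  have hV : V ≤ x.1 ⁻¹ᵁ U := inf_le_right
  let e' : Fin d ⊕ Fin c' → Γ((Scheme.Modules.pullback x.1).obj E, V) := fun i =>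
    mres _ inf_le_left (e i)
  have heV : IsFrame _ e' := he.restrict (inf_le_left : V ≤ V₀)
  have hFV : ∀ (W : T.Opens) (h : W ≤ V), x.2.sec W = Submodule.span Γ(T, W)
      (Set.range fun i : Fin d => mres _ h (e' (Sum.inl i))) := fun W h => by
    simp only [e', mres_mres]
    exact hF W _
  have hp : ∀ (T' : Scheme.{0}) (g : T' ⟶ T) (f' : T' ⟶ X) (w : g ≫ x.1 = f'),
      IsFrame ((Scheme.Modules.pullback f').obj E)
        (fun i => pullMap x.1 g f' w E (le_refl (g ⁻¹ᵁ V)) (e' i)) :=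
    fun T' g f' w => IsFrame.pullMap x.1 g f' w hε hV heV
  obtain ⟨δ, hδdef⟩ : ∃ δ, δ = minor hε x.1 hV fun l => e' (Sum.inl l) := ⟨_, rfl⟩
  have key : ∀ (T' : Scheme.{0}) (g : T' ⟶ T) (hg : ⊤ ≤ g ⁻¹ᵁ V),
      (∃ h : T' ⟶ Chart U d c, chartPoint hε h = x.pull hE g) ↔
        IsUnit ((g.appLE V ⊤ hg).hom δ) := fun T' g hg => by
    rw [hδdef]
    exact exists_chartPoint_iff_minor hε hE x hV hFV hp g hg
  have hδ : T.basicOpen δ ≤ V := T.basicOpen_le δ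
  have hδJ : ∃ k : (T.basicOpen δ : Scheme.{0}) ⟶ Chart U d c,
      chartPoint hε k = x.pull hE (T.basicOpen δ).ι := by
    refine (key _ (T.basicOpen δ).ι fun z _ => hδ z.2).2 ?_
    exact isUnit_appLE_of_basicOpen δ _ _ fun z _ => z.2
  refine TopologicalSpace.Opens.mem_iSup.2 ⟨⟨T.basicOpen δ, hδJ⟩, ?_⟩
  have h2 : ⊤ ≤ ((g ⁻¹ᵁ V).ι ≫ g) ⁻¹ᵁ V := fun z _ => z.2
  have h3 := (key _ ((g ⁻¹ᵁ V).ι ≫ g) h2).1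
    ⟨(g ⁻¹ᵁ V).ι ≫ h, by rw [← chartPoint_pull hε hE, hh, GrassPoint.pull_pull]⟩
  have h4 := Scheme.basicOpen_of_isUnit _ h3
  rw [Scheme.basicOpen_appLE] at h4
  have h5 : (⟨t, hV₀, htU⟩ : g ⁻¹ᵁ V) ∈ ((g ⁻¹ᵁ V).ι ≫ g) ⁻¹ᵁ (T.basicOpen δ) := by
    have h6 : (⟨t, hV₀, htU⟩ : g ⁻¹ᵁ V) ∈ (⊤ : ((g ⁻¹ᵁ V : T'.Opens) : Scheme.{0}).Opens) := trivial
    rw [← h4] at h6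
    exact h6.2
  exact h5

/-- The charts are open subfunctors of the Grassmann functor. -/
lemma isOpenImmersion_chartHom : IsOpenImmersion.presheaf (chartHom hε hE) := by
  refine MorphismProperty.relative.of_exists fun T α => ?_
  obtain ⟨x, hα⟩ : ∃ x : GrassPoint E d T, ∀ {T' : Scheme.{0}} (g : T' ⟶ T),
      α.app (op T') g = GrassPoint.pull hE x g :=
    ⟨yonedaEquiv α, fun g => (map_yonedaEquiv α g).symm⟩
  obtain ⟨W, k, hk, hW⟩ := exists_open_chartPoint_iff hε hE x
  refine ⟨W, yoneda.map k, W.ι, IsPullback.of_forall_isPullback_app fun T' => ?_,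
    (inferInstance : IsOpenImmersion W.ι)⟩
  rw [Types.isPullback_iff]
  refine ⟨?_, ?_, ?_⟩
  · ext (g : T'.unop ⟶ W)
    change (chartHom hε hE).app (op T'.unop) (g ≫ k) = α.app (op T'.unop) (g ≫ W.ι)
    rw [chartHom_app, hα, ← chartPoint_pull hε hE, hk, GrassPoint.pull_pull]
  · rintro (g : T'.unop ⟶ W) (g' : T'.unop ⟶ W) ⟨-, h⟩
    exact (cancel_mono W.ι).1 h
  · intro (h : T'.unop ⟶ Chart U d c) (g : T'.unop ⟶ T) e
    have e' : chartPoint hε h = GrassPoint.pull hE x g := by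
      rw [← hα, ← chartHom_app hε hE]
      exact e
    have hr : Set.range g ⊆ Set.range W.ι := by
      rintro _ ⟨t, rfl⟩
      rw [Scheme.Opens.range_ι]
      exact hW _ g h e' t
    refine ⟨IsOpenImmersion.lift W.ι g hr, ?_, IsOpenImmersion.lift_fac _ _ _⟩
    change IsOpenImmersion.lift W.ι g hr ≫ k = h
    apply chartPoint_injective hε
    rw [← chartPoint_pull hε hE, hk, GrassPoint.pull_pull, IsOpenImmersion.lift_fac, e']

omit hε in
include hE in
/-- The charts cover the Grassmann bundle: at every point some maximal minor does not vanish. -/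
lemma exists_chart_mem (hr : d + c = r) (x : GrassPoint E d T) (t : T) :
    ∃ (U : X.Opens) (ε : Fin d ⊕ Fin c → Γ(E, U)) (hε : IsFrame E ε) (W : T.Opens) (_ : t ∈ W)
      (k : (W : Scheme.{0}) ⟶ Chart U d c), chartPoint hε k = x.pull hE W.ι := by
  obtain ⟨U, hU, η, hη⟩ := hE (x.1 t)
  obtain ⟨V₀, hV₀, c', e, he, hF, -⟩ := exists_adapted hE x.1 x.2 t
  let V := V₀ ⊓ x.1 ⁻¹ᵁ U
  have htV : t ∈ V := ⟨hV₀, hU⟩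
  have hV : V ≤ x.1 ⁻¹ᵁ U := inf_le_right
  let e' : Fin d ⊕ Fin c' → Γ((Scheme.Modules.pullback x.1).obj E, V) := fun i =>
    mres _ inf_le_left (e i)
  have heV : IsFrame _ e' := he.restrict (inf_le_left : V ≤ V₀)
  have hFV : ∀ (W : T.Opens) (h : W ≤ V), x.2.sec W = Submodule.span Γ(T, W)
      (Set.range fun i : Fin d => mres _ h (e' (Sum.inl i))) := fun W h => by
    simp only [e', mres_mres]
    exact hF W _
  have hηV := (hη.pullSec x.1).restrict hV
  simp only [mres_pullSec] at hηV
  -- the frames of `f^* E` over the residue field at `t`: `A` has the right inverse `B`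
  let ev := (T.evaluation V t htV).hom
  let A : Matrix (Fin d) (Fin r) (T.residueField t) := Matrix.of fun l k =>
    ev (hηV.coord le_rfl (e' (Sum.inl l)) k)
  let B : Matrix (Fin r) (Fin d) (T.residueField t) := Matrix.of fun k l =>
    ev (heV.coord le_rfl (pullSec x.1 E hV (η k)) (Sum.inl l))
  have hAB : A * B = 1 := by
    ext l l'
    rw [Matrix.mul_apply, Matrix.one_apply]
    have := congrArg ev (hηV.coord_mul_coord heV (Sum.inl l) (Sum.inl l'))
    rw [map_sum] at this
    simp only [map_mul] at this
    refine this.trans ?_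
    by_cases h : l = l'
    · simp [h]
    · simp [h]
  obtain ⟨σ, hσ⟩ := exists_equiv_det_ne_zero hr A B hAB
  have hε : IsFrame E (η ∘ σ) := by
    intro W hW z
    obtain ⟨a, ha, hu⟩ := hη W hW z
    change ∑ i, a i • mres E hW (η i) = z at ha
    refine ⟨a ∘ σ, ?_, fun b hb => ?_⟩
    · rw [← ha]
      exact σ.sum_comp fun i => a i • mres E hW (η i)
    · have : b ∘ σ.symm = a := hu _ (by
        change ∑ i, (b ∘ σ.symm) i • mres E hW (η i) = z
        rw [← σ.sum_comp]
        simpa using hb)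
      rw [← this]
      funext i
      simp
  have hp : ∀ (T' : Scheme.{0}) (g : T' ⟶ T) (f' : T' ⟶ X) (w : g ≫ x.1 = f'),
      IsFrame ((Scheme.Modules.pullback f').obj E)
        (fun i => pullMap x.1 g f' w E (le_refl (g ⁻¹ᵁ V)) (e' i)) :=
    fun T' g f' w => IsFrame.pullMap x.1 g f' w hη hV heV
  obtain ⟨δ, hδdef⟩ : ∃ δ, δ = minor hε x.1 hV fun l => e' (Sum.inl l) := ⟨_, rfl⟩
  have key : ∀ (T' : Scheme.{0}) (g : T' ⟶ T) (hg : ⊤ ≤ g ⁻¹ᵁ V),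
      (∃ h : T' ⟶ Chart U d c, chartPoint hε h = x.pull hE g) ↔
        IsUnit ((g.appLE V ⊤ hg).hom δ) := fun T' g hg => by
    rw [hδdef]
    exact exists_chartPoint_iff_minor hε hE x hV hFV hp g hg
  have hδ : T.basicOpen δ ≤ V := T.basicOpen_le δ
  have htδ : t ∈ T.basicOpen δ := by
    rw [← Scheme.evaluation_ne_zero_iff_mem_basicOpen T t htV δ]
    have : T.evaluation V t htV δ = (A.submatrix id (σ ∘ Sum.inl)).det := by
      change ev δ = _
      rw [hδdef, minor]
      rw [RingHom.map_det]
      congr 1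
      ext l l'
      simp only [Matrix.of_apply, RingHom.mapMatrix_apply, Matrix.map_apply, Matrix.submatrix_apply,
        A, id, Function.comp_apply]
      congr 1
      refine congrFun ((isFrame_pullSec hε x.1 hV).coord_eq le_rfl (a := fun i =>
        hηV.coord le_rfl (e' (Sum.inl l)) (σ i)) ?_) (Sum.inl l')
      conv_rhs => rw [← hηV.sum_coord le_rfl (e' (Sum.inl l)), ← σ.sum_comp]
      rfl
    rw [this]
    exact hσ
  obtain ⟨k, hk⟩ := (key _ (T.basicOpen δ).ι fun z _ => hδ z.2).2
    (isUnit_appLE_of_basicOpen δ _ _ fun z _ => z.2)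
  exact ⟨U, η ∘ σ, hε, T.basicOpen δ, htδ, k, hk⟩

end OpenCharts

section Representability
variable {X : Scheme.{0}} {E : X.Modules} {r d : ℕ} (hE : IsLocallyFreeOfRank E r)

/-- The charts of the Grassmann bundle: open sets of `X` with a frame of `E`. -/
abbrev ChartIndex (E : X.Modules) (d c : ℕ) : Type :=
  Σ U : X.Opens, {ε : Fin d ⊕ Fin c → Γ(E, U) // IsFrame E ε}

/-- A Zariski sheaf covered by representable open subfunctors is representable. -/
lemma isRepresentable_grassPointFunctor (hd : d ≤ r) : (grassPointFunctor hE d).IsRepresentable := by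
  let F : Sheaf Scheme.zariskiTopology.{0} Type :=
    ⟨grassPointFunctor hE d, (isSheaf_iff_isSheaf_of_type _ _).2 (isSheaf_grassPointFunctor hE d)⟩
  let f : ∀ i : ChartIndex E d (r - d), yoneda.obj (Chart i.1 d (r - d)) ⟶ F.1 :=
    fun i => chartHom i.2.2 hE
  have : Presheaf.IsLocallySurjective Scheme.zariskiTopology (Sigma.desc f) := by
    constructor
    intro T x
    rw [Scheme.mem_grothendieckTopology_iff]
    choose U ε hε W htW k hk using exists_chart_mem (c := r - d) hE (by omega) (T := T) x
    refine ⟨Scheme.openCoverOfIsOpenCover T W (TopologicalSpace.IsOpenCover.mk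
      (TopologicalSpace.Opens.ext (by
        ext t
        simpa using ⟨t, htW t⟩))), ?_⟩
    rintro _ _ ⟨t⟩
    refine ⟨(Sigma.ι (fun i : ChartIndex E d (r - d) => yoneda.obj (Chart i.1 d (r - d)))
      ⟨U t, ε t, hε t⟩).app _ (k t), ?_⟩
    have h1 : Sigma.ι (fun i : ChartIndex E d (r - d) => yoneda.obj (Chart i.1 d (r - d)))
      ⟨U t, ε t, hε t⟩ ≫ Sigma.desc f = chartHom (hε t) hE := Sigma.ι_desc _ _
    refine (congr(($h1).app (op (W t : Scheme.{0})) (k t))).trans ?_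
    exact (chartHom_app (hε t) hE (k t)).trans (hk t)
  exact Scheme.LocalRepresentability.isRepresentable (F := F) (f := f)
    fun i => isOpenImmersion_chartHom i.2.2 hE

/-- The Grassmann bundle exists. -/
theorem isRepresentable_grassFunctor (hd : d ≤ r) : (grassFunctor hE d).IsRepresentable := by
  obtain ⟨Y, ⟨R⟩⟩ := isRepresentable_grassPointFunctor hE hd
  let p : Y ⟶ X := (R.homEquiv (𝟙 Y)).1
  let S : Subbundle ((Scheme.Modules.pullback p).obj E) d := (R.homEquiv (𝟙 Y)).2
  have hR : ∀ {T : Scheme.{0}} (g : T ⟶ Y), R.homEquiv g = GrassPoint.pull hE ⟨p, S⟩ g := fun g => by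
    rw [← Category.comp_id g, R.homEquiv_comp]
    rw [Category.comp_id]
    rfl
  let φ : ∀ T : Over X, (T ⟶ Over.mk p) → Subbundle ((Scheme.Modules.pullback T.hom).obj E) d :=
    fun T g => S.pull hE p g.left T.hom (Over.w g)
  have hφ : ∀ T (g : T ⟶ Over.mk p), (⟨T.hom, φ T g⟩ : GrassPoint E d T.left) = R.homEquiv g.left :=
    fun T g => by rw [hR]; exact GrassPoint.mk_pull hE p S g.left T.hom (Over.w g)
  have hbij : ∀ T, Function.Bijective (φ T) := fun T => by
    constructor
    · intro g g' h
      ext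
      apply R.homEquiv.injective
      rw [← hφ, ← hφ, h]
    · intro F
      let h := R.homEquiv.symm (⟨T.hom, F⟩ : GrassPoint E d T.left)
      have hh : R.homEquiv h = (⟨T.hom, F⟩ : GrassPoint E d T.left) := R.homEquiv.apply_symm_apply _
      have hw : h ≫ p = T.hom := by
        rw [hR] at hh
        exact congrArg Sigma.fst hh
      refine ⟨Over.homMk h hw, ?_⟩
      have := (hφ T (Over.homMk h hw)).trans hh
      exact eq_of_heq (Sigma.mk.inj this).2
  refine ⟨Over.mk p, ⟨{ homEquiv := fun {T} => Equiv.ofBijective (φ T) (hbij T), homEquiv_comp := ?_ }⟩⟩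
  intro T T' f g
  exact Subbundle.pull_pull hE p g.left T'.hom (Over.w g) f.left T.hom (Over.w f) (f ≫ g).left rfl
    (Over.w (f ≫ g)) S

end Representability

/-! ### Stability under endomorphisms -/

section SmoothDiff
variable {X : Scheme.{0}} (s : X ⟶ Spec (CommRingCat.of ℂ))

/-- Over an affine open set of a smooth scheme the differentials have a dual basis. -/
lemma exists_dual_basis_diff [Smooth s] {U : X.Opens} (hU : IsAffineOpen U) :
    ∃ (n : ℕ) (ω : Fin n → Diff s U) (l : Fin n → Diff s U →ₗ[Γ(X, U)] Γ(X, U)),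
      ∀ x, ∑ m, l m x • ω m = x := by
  let := algC s U
  have h1 : (s.appLE ⊤ U le_top).hom.Smooth := s.smooth_appLE (isAffineOpen_top _) hU le_top
  have h2 : ((Scheme.ΓSpecIso (CommRingCat.of ℂ)).inv ≫ s.appLE ⊤ U le_top).hom.Smooth := by
    rw [CommRingCat.hom_comp]
    exact RingHom.Smooth.respectsIso.2 _
      (Scheme.ΓSpecIso (CommRingCat.of ℂ)).symm.commRingCatIsoToRingEquiv h1
  have h3 : Algebra.Smooth ℂ Γ(X, U) := h2
  obtain ⟨n, p, q, -, -, h⟩ := Module.Finite.exists_comp_eq_id_of_projective Γ(X, U) (Diff s U)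
  refine ⟨n, fun m => p (Pi.single m 1), fun m => LinearMap.proj m ∘ₗ q, fun x => ?_⟩
  conv_rhs => rw [← LinearMap.id_apply (R := Γ(X, U)) x, ← h, LinearMap.comp_apply,
    ← LinearMap.sum_single_apply _ (q x), map_sum]
  refine Finset.sum_congr rfl fun m _ => ?_
  rw [LinearMap.comp_apply, LinearMap.proj_apply, ← map_smul]
  congr 1
  ext i
  simp [Pi.single_apply]

/-- Functionals on the differentials over an affine open set extend to basic open sets. -/
lemma exists_functional_basicOpen {U : X.Opens} (hU : IsAffineOpen U) (a : Γ(X, U))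
    (l : Diff s U →ₗ[Γ(X, U)] Γ(X, U)) :
    ∃ l' : Diff s (X.basicOpen a) →ₗ[Γ(X, X.basicOpen a)] Γ(X, X.basicOpen a),
      ∀ ω, l' (dres s (X.basicOpen_le a) ω) = rres (X.basicOpen_le a) (l ω) := by
  let := algC s U
  let := algC s (X.basicOpen a)
  let : Algebra Γ(X, U) Γ(X, X.basicOpen a) := (rres (X.basicOpen_le a)).toAlgebra
  have : IsScalarTower ℂ Γ(X, U) Γ(X, X.basicOpen a) := IsScalarTower.of_algebraMap_eq (fun c => by
    have e : s.appLE ⊤ U le_top ≫ X.presheaf.map (homOfLE (X.basicOpen_le a)).op =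
        s.appLE ⊤ (X.basicOpen a) le_top := Scheme.Hom.appLE_map _ _ _
    have e' := congr((Scheme.ΓSpecIso (CommRingCat.of ℂ)).inv ≫ $e)
    exact (congr($e' c)).symm)
  have h1 : IsLocalization.Away a Γ(X, X.basicOpen a) := hU.isLocalization_basicOpen a
  have h2 : Algebra.FormallyEtale Γ(X, U) Γ(X, X.basicOpen a) :=
    Algebra.FormallyEtale.of_isLocalization (Submonoid.powers a)
  have h3 := KaehlerDifferential.isBaseChange_of_formallyEtale ℂ Γ(X, U) Γ(X, X.basicOpen a)
  exact ⟨h3.lift ((Algebra.linearMap _ _).comp l), fun ω => h3.lift_eq _ ω⟩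

end SmoothDiff

section Stable
variable {X T T' : Scheme.{0}} {E : X.Modules} {U : X.Opens} {ι : Type} [Fintype ι]

/-- The semilinear map `∑ aᵢ f^* εᵢ ↦ ∑ aᵢ f^* ηᵢ` preserves `F ⊆ f^* E` over `V ⊆ f⁻¹ U`. -/
def StableOn (f : T ⟶ X)
    (F : ∀ V : T.Opens, Submodule Γ(T, V) Γ((Scheme.Modules.pullback f).obj E, V))
    (ε η : ι → Γ(E, U)) (V : T.Opens) (h : V ≤ f ⁻¹ᵁ U) : Prop :=
  ∀ (W : T.Opens) (hW : W ≤ V) (a : ι → Γ(T, W)),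
    ∑ i, a i • pullSec f E (hW.trans h) (ε i) ∈ F W →
    ∑ i, a i • pullSec f E (hW.trans h) (η i) ∈ F W

lemma sum_smul_pullSec_sum (f : T ⟶ X) {κ : Type} [Fintype κ] {V : T.Opens} (h : V ≤ f ⁻¹ᵁ U)
    (a : ι → Γ(T, V)) (p : ι → κ → Γ(X, U)) (x : κ → Γ(E, U)) :
    ∑ i, a i • pullSec f E h (∑ j, p i j • x j) =
      ∑ j, (∑ i, a i * (f.appLE U V h).hom (p i j)) • pullSec f E h (x j) := by
  simp only [map_sum, LinearMap.map_smulₛₗ, Finset.smul_sum, Finset.sum_smul, smul_smul]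
  exact Finset.sum_comm

/-- Stability under a linear endomorphism does not depend on the frame. -/
lemma StableOn.change_frame {κ : Type} [Fintype κ] {f : T ⟶ X}
    {F : ∀ V : T.Opens, Submodule Γ(T, V) Γ((Scheme.Modules.pullback f).obj E, V)}
    {ε η : ι → Γ(E, U)} {ε' η' : κ → Γ(E, U)} {V : T.Opens} {h : V ≤ f ⁻¹ᵁ U}
    (hs : StableOn f F ε' η' V h) (p : ι → κ → Γ(X, U)) (hp : ∀ i, ε i = ∑ j, p i j • ε' j)
    (hp' : ∀ i, η i = ∑ j, p i j • η' j) : StableOn f F ε η V h := by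
  intro W hW a ha
  simp only [hp, hp', sum_smul_pullSec_sum] at ha ⊢
  exact hs W hW _ ha

lemma StableOn.of_locally {d : ℕ} {f : T ⟶ X}
    {F : Subbundle ((Scheme.Modules.pullback f).obj E) d}
    {ε η : ι → Γ(E, U)} {V : T.Opens} {h : V ≤ f ⁻¹ᵁ U}
    (hs : ∀ t ∈ V, ∃ (V' : T.Opens) (_ : t ∈ V') (hV' : V' ≤ V),
      StableOn f F.sec ε η V' (hV'.trans h)) : StableOn f F.sec ε η V h := by
  intro W hW a ha
  refine F.glue fun t ht => ?_
  obtain ⟨V', htV', hV', hs'⟩ := hs t (hW ht)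
  have e : ∀ ε : ι → Γ(E, U), mres _ inf_le_left (∑ i, a i • pullSec f E (hW.trans h) (ε i)) =
      ∑ i, rres (inf_le_left : W ⊓ V' ≤ W) (a i) •
        pullSec f E ((inf_le_right : W ⊓ V' ≤ V').trans (hV'.trans h)) (ε i) := fun ε => by
    rw [map_sum]
    refine Finset.sum_congr rfl fun i _ => ?_
    rw [LinearMap.map_smulₛₗ, mres_pullSec]
  refine ⟨W ⊓ V', inf_le_left, ⟨ht, htV'⟩, ?_⟩
  rw [e]
  refine hs' _ inf_le_right _ ?_
  rw [← e]
  exact F.res inf_le_left ha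

/-- The coordinates of the images of the first members of an adapted frame transverse to the
subbundle; their vanishing means stability. -/
def obstruction (f : T ⟶ X) {ε : ι → Γ(E, U)} (hε : IsFrame E ε) (η : ι → Γ(E, U))
    {V : T.Opens} (hV : V ≤ f ⁻¹ᵁ U) {d c : ℕ}
    {e : Fin d ⊕ Fin c → Γ((Scheme.Modules.pullback f).obj E, V)} (he : IsFrame _ e)
    (l : Fin d) (m : Fin c) : Γ(T, V) :=
  he.coord le_rfl (∑ i, (isFrame_pullSec hε f hV).coord le_rfl (e (Sum.inl l)) i •
    pullSec f E hV (η i)) (Sum.inr m)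

/-- The stability of the pull-back of a subbundle is the vanishing of the pull-backs of
finitely many functions. -/
lemma stableOn_pull_iff {r d c : ℕ} (hE : IsLocallyFreeOfRank E r) (f : T ⟶ X)
    (F : Subbundle ((Scheme.Modules.pullback f).obj E) d)
    {ε : ι → Γ(E, U)} (hε : IsFrame E ε) (η : ι → Γ(E, U))
    {V : T.Opens} (hV : V ≤ f ⁻¹ᵁ U)
    {e : Fin d ⊕ Fin c → Γ((Scheme.Modules.pullback f).obj E, V)} (he : IsFrame _ e)
    (hF : ∀ (W : T.Opens) (h : W ≤ V),
      F.sec W = Submodule.span Γ(T, W) (Set.range fun i : Fin d => mres _ h (e (Sum.inl i))))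
    (g : T' ⟶ T) (f' : T' ⟶ X) (w : g ≫ f = f') {V' : T'.Opens} (hg : V' ≤ g ⁻¹ᵁ V)
    (hV' : V' ≤ f' ⁻¹ᵁ U) :
    StableOn f' (F.pull hE f g f' w).sec ε η V' hV' ↔
      ∀ l m, (g.appLE V V' hg).hom (obstruction f hε η hV he l m) = 0 := by
  have hp := IsFrame.pullMap f g f' w hε hV he
  let q : Fin d → ι → Γ(T', V') := fun l i =>
    (g.appLE V V' hg).hom ((isFrame_pullSec hε f hV).coord le_rfl (e (Sum.inl l)) i)
  let b : Fin d → Γ((Scheme.Modules.pullback f').obj E, V') := fun l =>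
    ∑ i, q l i • pullSec f' E hV' (η i)
  have he' : ∀ l, ∑ i, q l i • pullSec f' E hV' (ε i) = pullMap f g f' w E hg (e (Sum.inl l)) :=
    fun l => by
    conv_rhs => rw [← (isFrame_pullSec hε f hV).sum_coord le_rfl (e (Sum.inl l)), map_sum]
    refine Finset.sum_congr rfl fun i _ => ?_
    rw [LinearMap.map_smulₛₗ, mres_self, pullMap_pullSec f g f' w E hV hg hV']
  have hb : ∀ l, pullMap f g f' w E hg (∑ i, (isFrame_pullSec hε f hV).coord le_rfl
      (e (Sum.inl l)) i • pullSec f E hV (η i)) = b l := fun l => by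
    rw [map_sum]
    refine Finset.sum_congr rfl fun i _ => ?_
    rw [LinearMap.map_smulₛₗ, pullMap_pullSec f g f' w E hV hg hV']
  have hsec : ∀ (W : T'.Opens) (hW : W ≤ V'), (F.pull hE f g f' w).sec W = Submodule.span Γ(T', W)
      (Set.range fun l => mres _ hW (pullMap f g f' w E hg (e (Sum.inl l)))) := fun W hW => by
    refine (pullSub_eq_span f g f' w F hF hp (hW.trans hg)).trans ?_
    unfold pullMap
    simp only [mres_adjSec]
  have hbF : ∀ l, b l ∈ (F.pull hE f g f' w).sec V' ↔
      ∀ m, (g.appLE V V' hg).hom (obstruction f hε η hV he l m) = 0 := fun l => by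
    have h1 := hp.mem_span_iff hg (b l)
    rw [← show (F.pull hE f g f' w).sec V' = _ from pullSub_eq_span f g f' w F hF hp hg] at h1
    rw [h1]
    refine forall_congr' fun m => ?_
    rw [← hb, IsFrame.coord_pullMap f g f' w he hp le_rfl hg]
    rfl
  have hres : ∀ (ε : ι → Γ(E, U)) (W : T'.Opens) (hW : W ≤ V') (l : Fin d),
      mres _ hW (∑ i, q l i • pullSec f' E hV' (ε i)) =
        ∑ i, rres hW (q l i) • pullSec f' E (hW.trans hV') (ε i) := fun ε W hW l => by
    rw [map_sum]
    refine Finset.sum_congr rfl fun i _ => ?_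
    rw [LinearMap.map_smulₛₗ, mres_pullSec]
  constructor
  · intro hs l
    rw [← hbF]
    refine hs V' le_rfl (q l) ?_
    have h1 := hsec V' le_rfl
    rw [h1]
    refine Submodule.subset_span ⟨l, ?_⟩
    simp only [mres_self]
    exact (he' l).symm
  · intro h0 W hW a ha
    rw [hsec W hW] at ha
    obtain ⟨x, hx⟩ := (Submodule.mem_span_range_iff_exists_fun _).1 ha
    have ha' : a = fun i => ∑ l, x l * rres hW (q l i) := by
      refine (isFrame_pullSec hε f' (hW.trans hV')).eq_coord le_rfl ?_
      simp only [mres_self]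
      rw [← hx]
      simp only [← he', hres, Finset.smul_sum, Finset.sum_smul, smul_smul]
      exact Finset.sum_comm
    have hη : ∑ i, a i • pullSec f' E (hW.trans hV') (η i) = ∑ l, x l • mres _ hW (b l) := by
      rw [ha']
      simp only [b, hres, Finset.smul_sum, Finset.sum_smul, smul_smul]
      exact Finset.sum_comm
    rw [hη]
    exact Submodule.sum_mem _ fun l _ => Submodule.smul_mem _ _
      ((F.pull hE f g f' w).res hW ((hbF l).2 (h0 l)))

end Stable

/-! ### Higgs Grassmannians -/

namespace HiggsBundle

variable {X : Scheme.{0}} {s : X ⟶ Spec (CommRingCat.of ℂ)} {r : ℕ} (𝔈 : HiggsBundle s r)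
  {T T' : Scheme.{0}}

/-- The contraction of the Higgs field with a functional on the differentials: an endomorphism of
`E` over `U`. -/
def contract (U : X.affineOpens) (l : Diff s U.1 →ₗ[Γ(X, U.1)] Γ(X, U.1)) :
    Γ(𝔈.E, U.1) →ₗ[Γ(X, U.1)] Γ(𝔈.E, U.1) :=
  (TensorProduct.rid _ _).toLinearMap ∘ₗ l.lTensor _ ∘ₗ 𝔈.φ U

lemma contract_mres {U U' : X.affineOpens} (h : U'.1 ≤ U.1)
    {l : Diff s U.1 →ₗ[Γ(X, U.1)] Γ(X, U.1)} {l' : Diff s U'.1 →ₗ[Γ(X, U'.1)] Γ(X, U'.1)}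
    (hl : ∀ ω, l' (dres s h ω) = rres h (l ω)) (x : Γ(𝔈.E, U.1)) :
    𝔈.contract U' l' (mres _ h x) = mres _ h (𝔈.contract U l x) := by
  simp only [contract, LinearMap.comp_apply, 𝔈.φ_res U U' h]
  generalize 𝔈.φ U x = z
  induction z using TensorProduct.induction_on with
  | zero => simp only [map_zero]
  | tmul x y =>
    change l' (dres s h y) • mres _ h x = mres _ h (l y • x)
    rw [hl, LinearMap.map_smulₛₗ]
  | add x y hx hy => simp only [map_add, hx, hy]

/-- Invariance gives stability under the contractions of the Higgs field, over a smaller affine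
open set. -/
lemma InvariantOn.stableOn {f : T ⟶ X}
    {F : ∀ V : T.Opens, Submodule Γ(T, V) Γ((Scheme.Modules.pullback f).obj 𝔈.E, V)}
    {U : X.affineOpens} {ε : Fin r → Γ(𝔈.E, U.1)} {V : T.Opens} {h : V ≤ f ⁻¹ᵁ U.1}
    (hinv : 𝔈.InvariantOn f F U ε V h) {U' : X.affineOpens} (hU : U'.1 ≤ U.1) {V' : T.Opens}
    (hV : V' ≤ V) (h' : V' ≤ f ⁻¹ᵁ U'.1) (l : Diff s U'.1 →ₗ[Γ(X, U'.1)] Γ(X, U'.1)) :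
    StableOn f F (fun i => mres 𝔈.E hU (ε i)) (fun i => 𝔈.contract U' l (mres 𝔈.E hU (ε i)))
      V' h' := by
  intro W hW a ha
  simp only [pullSec_mres] at ha
  have hmem := hinv W (hW.trans hV) a ha
  -- the contraction `K` of `f^* E ⊗ f^* Ω¹` with the pull-back of `l`; it maps `F ⊗ f^* Ω¹` to `F`
  let u : Diff s U.1 →ₛₗ[(f.appLE U.1 W ((hW.trans hV).trans h)).hom] Γ(T, W) :=
    { toFun := fun ω => (f.appLE U'.1 W (hW.trans h')).hom (l (dres s hU ω))
      map_add' := fun x y => by simp only [map_add]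
      map_smul' := fun a x => by
        rw [LinearMap.map_smulₛₗ, map_smul, smul_eq_mul, map_mul, appLE_rres]
        rfl }
  obtain ⟨v, hv⟩ := BaseChange.exists_lift (f.appLE U.1 W ((hW.trans hV).trans h)).hom
    (RingHom.id Γ(T, W)) _ (fun _ => rfl) u
  let K : Γ((Scheme.Modules.pullback f).obj 𝔈.E, W) ⊗[Γ(T, W)]
      PullDiff s f ((hW.trans hV).trans h) →ₗ[Γ(T, W)]
      Γ((Scheme.Modules.pullback f).obj 𝔈.E, W) :=
    (TensorProduct.rid _ _).toLinearMap ∘ₗ v.lTensor _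
  have hK : ∀ x, K (pullTensor s f 𝔈.E ((hW.trans hV).trans h) (𝔈.φ U x)) =
      pullSec f 𝔈.E (hW.trans h') (𝔈.contract U' l (mres 𝔈.E hU x)) := fun x => by
    simp only [contract, LinearMap.comp_apply, 𝔈.φ_res U U' hU]
    generalize 𝔈.φ U x = z
    induction z using TensorProduct.induction_on with
    | zero => simp only [map_zero]
    | tmul x y =>
      change v (BaseChange.of _ _ y) • pullSec f 𝔈.E _ x =
        pullSec f 𝔈.E (hW.trans h') (l (dres s hU y) • mres _ hU x)
      rw [hv, LinearMap.map_smulₛₗ, pullSec_mres]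
      rfl
    | add x y hx hy => simp only [map_add, hx, hy]
  obtain ⟨z, hz⟩ := hmem
  have hKF : ∀ z, K ((F W).subtype.rTensor _ z) ∈ F W := fun z => by
    induction z using TensorProduct.induction_on with
    | zero => simp only [map_zero]; exact Submodule.zero_mem _
    | tmul x y => exact Submodule.smul_mem _ (v y) x.2
    | add x y hx hy => simp only [map_add]; exact Submodule.add_mem _ hx hy
  replace hKF := hKF z
  rw [hz, map_sum] at hKF
  simp only [map_smul, hK] at hKF
  exact hKF

/-- Stability under all contractions of the Higgs field gives invariance: the differentials have a
dual basis. -/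
lemma invariantOn_of_stableOn [Smooth s] {f : T ⟶ X}
    {F : ∀ V : T.Opens, Submodule Γ(T, V) Γ((Scheme.Modules.pullback f).obj 𝔈.E, V)}
    {U : X.affineOpens} {ε : Fin r → Γ(𝔈.E, U.1)} {V : T.Opens} {h : V ≤ f ⁻¹ᵁ U.1}
    (hs : ∀ l, StableOn f F ε (fun i => 𝔈.contract U l (ε i)) V h) :
    𝔈.InvariantOn f F U ε V h := by
  intro W hW a ha
  obtain ⟨n, ω, l, hl⟩ := exists_dual_basis_diff s U.2
  have hφ : ∀ x, 𝔈.φ U x = ∑ m, 𝔈.contract U (l m) x ⊗ₜ ω m := fun x => by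
    simp only [contract, LinearMap.comp_apply]
    generalize 𝔈.φ U x = z
    induction z using TensorProduct.induction_on with
    | zero => simp
    | tmul x y =>
      conv_lhs => rw [← hl y, TensorProduct.tmul_sum]
      refine Finset.sum_congr rfl fun m _ => ?_
      rw [← TensorProduct.smul_tmul]
      rfl
    | add x y hx hy =>
      conv_lhs => rw [hx, hy, ← Finset.sum_add_distrib]
      simp only [map_add, TensorProduct.add_tmul]
  have e : ∑ i, a i • pullTensor s f 𝔈.E (hW.trans h) (𝔈.φ U (ε i)) =
      ∑ m, (∑ i, a i • pullSec f 𝔈.E (hW.trans h) (𝔈.contract U (l m) (ε i))) ⊗ₜ[Γ(T, W)]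
        BaseChange.of (f.appLE U.1 W (hW.trans h)).hom (Diff s U.1) (ω m) := by
    simp only [TensorProduct.sum_tmul]
    rw [Finset.sum_comm]
    refine Finset.sum_congr rfl fun i _ => ?_
    rw [hφ, map_sum, Finset.smul_sum]
    rfl
  rw [e]
  exact Submodule.sum_mem _ fun m _ => ⟨⟨_, hs (l m) W hW a ha⟩ ⊗ₜ _, rfl⟩

/-- A Higgs subbundle is stable under the contractions of the Higgs field over every affine open
set with a frame. -/
lemma IsInvariant.stableOn {d : ℕ} {f : T ⟶ X}
    {F : Subbundle ((Scheme.Modules.pullback f).obj 𝔈.E) d} (hF : 𝔈.IsInvariant f F.sec)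
    (U : X.affineOpens) (ε : Fin r → Γ(𝔈.E, U.1)) (V : T.Opens) (h : V ≤ f ⁻¹ᵁ U.1)
    (l : Diff s U.1 →ₗ[Γ(X, U.1)] Γ(X, U.1)) :
    StableOn f F.sec ε (fun i => 𝔈.contract U l (ε i)) V h := by
  refine StableOn.of_locally fun t ht => ?_
  -- `l` extends to an open set that is basic in `U` and lies in an open set of the definition of
  -- invariance; there, the two frames differ by a matrix of functions
  obtain ⟨U', hU', ε', hε', V', hV', h', hinv⟩ := hF t
  obtain ⟨a, b, hab, htab⟩ := exists_basicOpen_le_affine_inter U.2 U'.2 (f t) ⟨h ht, hU'⟩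
  let U'' : X.affineOpens := ⟨X.basicOpen a, U.2.basicOpen a⟩
  have hU₁ : U''.1 ≤ U.1 := X.basicOpen_le a
  have hU₂ : U''.1 ≤ U'.1 := hab.trans_le (X.basicOpen_le b)
  obtain ⟨l', hl'⟩ := exists_functional_basicOpen s U.2 a l
  refine ⟨V ⊓ V' ⊓ f ⁻¹ᵁ U''.1, ⟨⟨ht, hV'⟩, htab⟩, inf_le_left.trans inf_le_left, ?_⟩
  have h₁ := hinv.stableOn 𝔈 hU₂ (V' := V ⊓ V' ⊓ f ⁻¹ᵁ U''.1) (inf_le_left.trans inf_le_right)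
    inf_le_right l'
  have hp : ∀ i, mres 𝔈.E hU₁ (ε i) =
      ∑ j, hε'.coord hU₂ (mres 𝔈.E hU₁ (ε i)) j • mres 𝔈.E hU₂ (ε' j) :=
    fun i => (hε'.sum_coord hU₂ _).symm
  have h₂ := h₁.change_frame (ε := fun i => mres 𝔈.E hU₁ (ε i))
    (η := fun i => mres 𝔈.E hU₁ (𝔈.contract U l (ε i))) _ hp (fun i => by
      rw [← 𝔈.contract_mres hU₁ hl']
      conv_lhs => rw [hp i]
      simp only [map_sum, map_smul])
  intro W hW a ha
  have := h₂ W hW a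
  simp only [pullSec_mres] at this
  exact this ha

/-- Near a point, the locus where the pull-back of a subbundle is stable under the contractions of
the Higgs field is given by equations. -/
lemma exists_equations {Y : Scheme.{0}} {d : ℕ} (π : Y ⟶ X)
    (S : Subbundle ((Scheme.Modules.pullback π).obj 𝔈.E) d) (y : Y) :
    ∃ (U : X.affineOpens) (ε : Fin r → Γ(𝔈.E, U.1)) (_ : IsFrame 𝔈.E ε) (V : Y.Opens) (_ : y ∈ V)
      (hV : V ≤ π ⁻¹ᵁ U.1) (A : Set Γ(Y, V)), ∀ (T : Scheme.{0}) (g : T ⟶ Y) (V' : T.Opens)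
        (hg : V' ≤ g ⁻¹ᵁ V), (∀ l, StableOn (g ≫ π) (S.pull 𝔈.locallyFree π g (g ≫ π) rfl).sec ε
            (fun i => 𝔈.contract U l (ε i)) V' (hg.trans (g.preimage_mono hV))) ↔
          ∀ a ∈ A, (g.appLE V V' hg).hom a = 0 := by
  obtain ⟨U₀, hU₀, ε, hε⟩ := 𝔈.locallyFree (π y)
  obtain ⟨U, hU, hyU, hUU₀⟩ := exists_isAffineOpen_mem_and_subset hU₀
  obtain ⟨V₀, hV₀, c, e, he, hF, -⟩ := exists_adapted 𝔈.locallyFree π S y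
  have hε' := hε.restrict hUU₀
  have hV : V₀ ⊓ π ⁻¹ᵁ U ≤ π ⁻¹ᵁ U := inf_le_right
  have he' := he.restrict (inf_le_left : V₀ ⊓ π ⁻¹ᵁ U ≤ V₀)
  refine ⟨⟨U, hU⟩, _, hε', V₀ ⊓ π ⁻¹ᵁ U, ⟨hV₀, hyU⟩, hV,
    {a | ∃ l i j, a = obstruction π hε' (fun i => 𝔈.contract ⟨U, hU⟩ l (mres _ hUU₀ (ε i)))
      hV he' i j}, fun T g V' hg => ?_⟩
  have key := fun l : Diff s U →ₗ[Γ(X, U)] Γ(X, U) => stableOn_pull_iff 𝔈.locallyFree π S hε'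
    (fun i => 𝔈.contract ⟨U, hU⟩ l (mres _ hUU₀ (ε i))) hV he' (fun W h => by
      simp only [mres_mres]
      exact hF W _) g (g ≫ π) rfl hg (hg.trans (g.preimage_mono hV))
  refine (forall_congr' key).trans ⟨?_, fun h l i j => h _ ⟨l, i, j, rfl⟩⟩
  rintro h _ ⟨l, i, j, rfl⟩
  exact h l i j

/-- The locus where a subbundle of `π^* E` is a Higgs subbundle is a closed subscheme. -/
theorem exists_closed_invariant [Smooth s] {Y : Scheme.{0}} {d : ℕ} (π : Y ⟶ X)
    (S : Subbundle ((Scheme.Modules.pullback π).obj 𝔈.E) d) :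
    ∃ (Z : Scheme.{0}) (ι : Z ⟶ Y), IsClosedImmersion ι ∧ ∀ (T : Scheme.{0}) (g : T ⟶ Y),
      𝔈.IsInvariant (g ≫ π) (S.pull 𝔈.locallyFree π g (g ≫ π) rfl).sec ↔ ∃ h, h ≫ ι = g := by
  have hcomp : ∀ (T T' : Scheme.{0}) (h : T' ⟶ T) (g : T ⟶ Y),
      𝔈.IsInvariant (g ≫ π) (S.pull 𝔈.locallyFree π g (g ≫ π) rfl).sec →
      𝔈.IsInvariant ((h ≫ g) ≫ π) (S.pull 𝔈.locallyFree π (h ≫ g) ((h ≫ g) ≫ π) rfl).sec := by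
    intro T T' h g hg
    have := IsInvariant.pull 𝔈 (g ≫ π) h ((h ≫ g) ≫ π) (Category.assoc _ _ _).symm _ hg
    rwa [← Subbundle.pull_pull 𝔈.locallyFree π g (g ≫ π) rfl h ((h ≫ g) ≫ π)
      (Category.assoc _ _ _).symm (h ≫ g) rfl rfl] at this
  refine exists_closed_locus hcomp ?_ ?_
  · intro T g hg t
    obtain ⟨U, ε, hε, V, hV, hVU, A, hA⟩ := 𝔈.exists_equations π S (g t)
    obtain ⟨W, htW, hW⟩ := hg t
    have hWV : W ⊓ g ⁻¹ᵁ V ≤ g ⁻¹ᵁ V := inf_le_right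
    refine ⟨U, hVU hV, ε, hε, W ⊓ g ⁻¹ᵁ V, ⟨htW, hV⟩, hWV.trans (g.preimage_mono hVU), ?_⟩
    refine 𝔈.invariantOn_of_stableOn ((hA T g _ hWV).2 fun a ha => ?_)
    -- the equations vanish on `W ⊓ g ⁻¹ᵁ V`, since they do after the open immersion `W.ι`
    have hW' : W.ι ⁻¹ᵁ (W ⊓ g ⁻¹ᵁ V) ≤ (W.ι ≫ g) ⁻¹ᵁ V := fun z hz => hz.2
    have h1 := (hA W (W.ι ≫ g) (W.ι ⁻¹ᵁ (W ⊓ g ⁻¹ᵁ V)) hW').1 (fun l => hW.stableOn 𝔈 U ε _ _ l) a ha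
    refine (appLE_bijective W.ι (V := W ⊓ g ⁻¹ᵁ V) ?_).1 ?_
    · rw [Scheme.Opens.opensRange_ι]
      exact inf_le_left
    · rw [appLE_appLE g W.ι hWV le_rfl hW', map_zero, h1]
  · intro y
    obtain ⟨U, ε, hε, V, hV, hVU, A, hA⟩ := 𝔈.exists_equations π S y
    refine ⟨V, hV, A, fun T g h => ⟨fun hg => (hA T g ⊤ h).1 fun l => hg.stableOn 𝔈 U ε _ _ l,
      fun ha t => ?_⟩⟩
    exact ⟨U, hVU (h (Set.mem_univ t)), ε, hε, ⊤, trivial, h.trans (g.preimage_mono hVU),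
      𝔈.invariantOn_of_stableOn ((hA T g ⊤ h).2 ha)⟩

end HiggsBundle

section HiggsGrassmannian
variable {X : Scheme.{0}} {s : X ⟶ Spec (CommRingCat.of ℂ)} {r : ℕ} (𝔈 : HiggsBundle s r) {d : ℕ}

/-- A morphism to a Grassmann bundle classifies the pull-back of the universal subbundle. -/
lemma homEquiv_eq_pull {E : X.Modules} (hE : IsLocallyFreeOfRank E r) {G : Over X}
    (R : (grassFunctor hE d).RepresentableBy G) {T : Over X} (g : T ⟶ G) :
    R.homEquiv g = Subbundle.pull hE G.hom g.left T.hom (Over.w g) (R.homEquiv (𝟙 G)) := by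
  conv_lhs => rw [← Category.comp_id g, R.homEquiv_comp]
  rfl

/-- The Higgs Grassmannians exist. -/
theorem nonempty_higgsGrassmannian [Smooth s] (hd : d ≤ r) : Nonempty (HiggsGrassmannian 𝔈 d) := by
  obtain ⟨G, ⟨R⟩⟩ := isRepresentable_grassFunctor 𝔈.locallyFree hd
  obtain ⟨Z, ι, hι, hZ⟩ := 𝔈.exists_closed_invariant G.hom (R.homEquiv (𝟙 G))
  refine ⟨⟨G, R, Over.mk (ι ≫ G.hom), Over.homMk ι rfl, hι, fun T g => ?_⟩⟩
  rw [homEquiv_eq_pull 𝔈.locallyFree R g]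
  have key : ∀ (f : T.left ⟶ X) (w : g.left ≫ G.hom = f), 𝔈.IsInvariant f
      (Subbundle.pull 𝔈.locallyFree G.hom g.left f w (R.homEquiv (𝟙 G))).sec ↔
        ∃ h, h ≫ ι = g.left := by
    rintro _ rfl
    exact hZ _ _
  refine Iff.trans ?_ (key T.hom (Over.w g)).symm
  constructor
  · rintro ⟨h, rfl⟩
    exact ⟨h.left, rfl⟩
  · rintro ⟨h, hh⟩
    refine ⟨Over.homMk h ?_, ?_⟩
    · change h ≫ ι ≫ G.hom = _
      rw [← Category.assoc, hh, Over.w]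
    · ext
      exact hh

end HiggsGrassmannian

/-! ### The Higgs flag scheme -/

section Inclusion
variable {X Y : Scheme.{0}} {E : X.Modules} {r : ℕ} (hE : IsLocallyFreeOfRank E r) (π : Y ⟶ X)

lemma Subbundle.pull_mono {T T' : Scheme.{0}} {d d' : ℕ} {f : T ⟶ X}
    {F : Subbundle ((Scheme.Modules.pullback f).obj E) d}
    {F' : Subbundle ((Scheme.Modules.pullback f).obj E) d'} (h : ∀ V, F.sec V ≤ F'.sec V)
    (g : T' ⟶ T) (f' : T' ⟶ X) (w : g ≫ f = f') (V : T'.Opens) :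
    (F.pull hE f g f' w).sec V ≤ (F'.pull hE f g f' w).sec V := by
  intro x hx t ht
  obtain ⟨V₀, W, h₀, hg, htW, hm⟩ := hx t ht
  exact ⟨V₀, W, h₀, hg, htW, Submodule.span_mono (Set.image_mono (h V₀)) hm⟩

/-- Near a point, the inclusion of a subbundle in another one is given by equations: the
coordinates of the members of an adapted frame of the first transverse to the second. -/
lemma exists_equations_le {d d' : ℕ} (F : Subbundle ((Scheme.Modules.pullback π).obj E) d)
    (F' : Subbundle ((Scheme.Modules.pullback π).obj E) d') (y : Y) :
    ∃ (V : Y.Opens) (_ : y ∈ V) (A : Set Γ(Y, V)), ∀ (T : Scheme.{0}) (g : T ⟶ Y)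
      (h : ⊤ ≤ g ⁻¹ᵁ V), (∀ W, (F.pull hE π g (g ≫ π) rfl).sec W ≤
        (F'.pull hE π g (g ≫ π) rfl).sec W) ↔ ∀ a ∈ A, (g.appLE V ⊤ h).hom a = 0 := by
  obtain ⟨V₁, hV₁, c, e, he, hF, hp⟩ := exists_adapted hE π F y
  obtain ⟨V₂, hV₂, c', e', he', hF', hp'⟩ := exists_adapted hE π F' y
  refine ⟨V₁ ⊓ V₂, ⟨hV₁, hV₂⟩, {a | ∃ l m, a = he'.coord (inf_le_right : V₁ ⊓ V₂ ≤ V₂)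
    (mres _ inf_le_left (e (Sum.inl l))) (Sum.inr m)}, fun T g h => ?_⟩
  have h₁ : ⊤ ≤ g ⁻¹ᵁ V₁ := h.trans (g.preimage_mono inf_le_left)
  have h₂ : ⊤ ≤ g ⁻¹ᵁ V₂ := h.trans (g.preimage_mono inf_le_right)
  have hsec : ∀ W : T.Opens, (F.pull hE π g (g ≫ π) rfl).sec W = Submodule.span Γ(T, W)
      (Set.range fun l => mres _ le_top (pullMap π g (g ≫ π) rfl E h₁ (e (Sum.inl l)))) := by
    intro W
    refine (pullSub_eq_span π g (g ≫ π) rfl F hF (hp T g _ rfl) (le_top.trans h₁)).trans ?_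
    unfold pullMap
    simp only [mres_adjSec]
  have hmem : ∀ l, pullMap π g (g ≫ π) rfl E h₁ (e (Sum.inl l)) ∈
      (F'.pull hE π g (g ≫ π) rfl).sec ⊤ ↔ ∀ m, (g.appLE _ ⊤ h).hom
        (he'.coord (inf_le_right : V₁ ⊓ V₂ ≤ V₂) (mres _ inf_le_left (e (Sum.inl l)))
          (Sum.inr m)) = 0 := fun l => by
    have h3 := (hp' T g _ rfl).mem_span_iff h₂ (pullMap π g (g ≫ π) rfl E h₁ (e (Sum.inl l)))
    rw [← show (F'.pull hE π g (g ≫ π) rfl).sec ⊤ = _ from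
      pullSub_eq_span π g (g ≫ π) rfl F' hF' (hp' T g _ rfl) h₂] at h3
    rw [h3]
    refine forall_congr' fun m => ?_
    rw [← IsFrame.coord_pullMap π g (g ≫ π) rfl he' (hp' T g _ rfl) inf_le_right h,
      pullMap_mres π g (g ≫ π) rfl h₁ inf_le_left le_rfl h, mres_self]
  constructor
  · rintro hle _ ⟨l, m, rfl⟩
    refine (hmem l).1 (hle ⊤ ?_) m
    rw [hsec]
    exact Submodule.subset_span ⟨l, mres_self _ _⟩
  · intro h0 W
    rw [hsec, Submodule.span_le]
    rintro _ ⟨l, rfl⟩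
    exact (F'.pull hE π g (g ≫ π) rfl).res le_top ((hmem l).2 fun m => h0 _ ⟨l, m, rfl⟩)

/-- The locus where the members of a family of subbundles of `π^* E` form a flag is a closed
subscheme. -/
theorem exists_closed_flag {k : ℕ} {d : Fin k → ℕ}
    (F : ∀ i, Subbundle ((Scheme.Modules.pullback π).obj E) (d i)) :
    ∃ (Z : Scheme.{0}) (ι : Z ⟶ Y), IsClosedImmersion ι ∧ ∀ (T : Scheme.{0}) (g : T ⟶ Y),
      (∀ i j, i ≤ j → ∀ W, ((F i).pull hE π g (g ≫ π) rfl).sec W ≤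
        ((F j).pull hE π g (g ≫ π) rfl).sec W) ↔ ∃ h, h ≫ ι = g := by
  have hpull : ∀ (T T' : Scheme.{0}) (h : T' ⟶ T) (g : T ⟶ Y) (i : Fin k),
      (F i).pull hE π (h ≫ g) ((h ≫ g) ≫ π) rfl =
        ((F i).pull hE π g (g ≫ π) rfl).pull hE (g ≫ π) h (h ≫ g ≫ π) rfl :=
    fun T T' h g i => Subbundle.pull_pull hE _ _ _ _ _ _ _ _ rfl _ _
  refine exists_closed_locus (fun T T' h g hg i j hij W => ?_) (fun T g hg i j hij => ?_)
    (fun y => ?_)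
  · have := Subbundle.pull_mono hE (hg i j hij) h ((h ≫ g) ≫ π) (Category.assoc _ _ _).symm W
    rwa [← Subbundle.pull_pull hE π g (g ≫ π) rfl h ((h ≫ g) ≫ π)
      (Category.assoc _ _ _).symm (h ≫ g) rfl rfl,
      ← Subbundle.pull_pull hE π g (g ≫ π) rfl h ((h ≫ g) ≫ π)
      (Category.assoc _ _ _).symm (h ≫ g) rfl rfl] at this
  · choose W htW hW using hg
    refine Subbundle.le_of_cover hE (fun t => (W t).ι) (fun t => ⟨t, ?_⟩) (g ≫ π) _ _
      fun t V => ?_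
    · rw [Scheme.Opens.opensRange_ι]
      exact htW t
    · have := hW t i j hij V
      rwa [hpull, hpull] at this
  · choose V hV A hA using fun p : Fin k × Fin k => exists_equations_le hE π (F p.1) (F p.2) y
    have hle : ∀ p, ⨅ p, V p ≤ V p := iInf_le V
    refine ⟨⨅ p, V p, ?_, {a | ∃ (p : Fin k × Fin k) (_ : p.1 ≤ p.2), ∃ b ∈ A p,
      a = rres (hle p) b}, fun T g h => ?_⟩
    · change y ∈ ((⨅ p, V p : Y.Opens) : Set Y)
      rw [TopologicalSpace.Opens.coe_iInf, Set.mem_iInter]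
      exact hV
    · constructor
      · rintro hle' _ ⟨p, hp, b, hb, rfl⟩
        rw [appLE_rres]
        exact (hA p T g _).1 (hle' p.1 p.2 hp) b hb
      · intro h0 i j hij
        refine (hA (i, j) T g (h.trans (g.preimage_mono (hle _)))).2 fun b hb => ?_
        rw [← appLE_rres g h (hle (i, j))]
        exact h0 _ ⟨(i, j), hij, b, hb, rfl⟩

end Inclusion

section FlagScheme
variable {X : Scheme.{0}} {s : X ⟶ Spec (CommRingCat.of ℂ)} {r : ℕ} {𝔈 : HiggsBundle s r} {k : ℕ}
  {d : Fin k → ℕ}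

/-- The closed subscheme of the product of the Higgs Grassmannians where the universal subbundles
form a flag represents the Higgs flag functor. -/
theorem exists_flagScheme (H : ∀ i, HiggsGrassmannian 𝔈 (d i)) :
    ∃ (Fl : Over X) (R : (flagFunctor 𝔈 d).RepresentableBy Fl) (j : Fl ⟶ ∏ᶜ fun i => (H i).obj),
      IsClosedImmersion j.left ∧ ∀ (T : Over X) (h : T ⟶ Fl) (i : Fin k),
        (H i).grRep.homEquiv ((h ≫ j ≫ Pi.π _ i) ≫ (H i).ι) = Flag.sub (R.homEquiv h) i := by
  let P : Over X := ∏ᶜ fun i => (H i).obj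
  let p : ∀ i, P ⟶ (H i).gr := fun i => Pi.π (fun i => (H i).obj) i ≫ (H i).ι
  let F : ∀ i, Subbundle ((Scheme.Modules.pullback P.hom).obj 𝔈.E) (d i) :=
    fun i => (H i).grRep.homEquiv (p i)
  have hF : ∀ {T : Over X} (g : T ⟶ P) i, (H i).grRep.homEquiv (g ≫ p i) =
      (F i).pull 𝔈.locallyFree P.hom g.left T.hom (Over.w g) :=
    fun g i => (H i).grRep.homEquiv_comp g (p i)
  obtain ⟨Z, ι, hι, hZ⟩ := exists_closed_flag 𝔈.locallyFree P.hom F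
  let Fl : Over X := Over.mk (ι ≫ P.hom)
  let j : Fl ⟶ P := Over.homMk ι rfl
  -- a morphism to the product factors through `Z` if and only if it classifies a flag
  have hfac : ∀ {T : Over X} (g : T ⟶ P), (∃ h : T ⟶ Fl, h ≫ j = g) ↔
      ∀ i i', i ≤ i' → ∀ W,
        (show Subbundle ((Scheme.Modules.pullback T.hom).obj 𝔈.E) (d i) from
          (H i).grRep.homEquiv (g ≫ p i)).sec W ≤
        (show Subbundle ((Scheme.Modules.pullback T.hom).obj 𝔈.E) (d i') from
          (H i').grRep.homEquiv (g ≫ p i')).sec W := fun {T} g => by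
    simp only [hF]
    have key : ∀ (f : T.left ⟶ X) (w : g.left ≫ P.hom = f),
        (∀ i i', i ≤ i' → ∀ W, ((F i).pull 𝔈.locallyFree P.hom g.left f w).sec W ≤
          ((F i').pull 𝔈.locallyFree P.hom g.left f w).sec W) ↔ ∃ h, h ≫ ι = g.left := by
      rintro _ rfl
      exact hZ _ _
    refine Iff.trans ?_ (key T.hom (Over.w g)).symm
    constructor
    · rintro ⟨h, rfl⟩
      exact ⟨h.left, rfl⟩
    · rintro ⟨h, hh⟩
      refine ⟨Over.homMk h ?_, ?_⟩
      · change h ≫ ι ≫ P.hom = _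
        rw [← Category.assoc, hh, Over.w]
      · exact Over.OverMorphism.ext hh
  have hjm : Mono j := by
    have : Mono j.left := (inferInstance : Mono ι)
    exact Over.mono_of_mono_left j
  have hιm : ∀ i, Mono (H i).ι := fun i => by
    have := (H i).closed
    exact Over.mono_of_mono_left (H i).ι
  let φ : ∀ T : Over X, (T ⟶ Fl) → Flag 𝔈 T.hom d := fun T h =>
    { sub := fun i => (H i).grRep.homEquiv ((h ≫ j) ≫ p i)
      invariant := fun i => ((H i).zeroLocus T _).1 ⟨(h ≫ j) ≫ Pi.π _ i, Category.assoc _ _ _⟩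
      le := (hfac (h ≫ j)).1 ⟨h, rfl⟩ }
  have hφ : ∀ T, Function.Bijective (φ T) := fun T => by
    constructor
    · intro h h' e
      rw [← cancel_mono j]
      refine Pi.hom_ext _ _ fun i => ?_
      rw [← cancel_mono (H i).ι, Category.assoc, Category.assoc]
      exact (H i).grRep.homEquiv.injective (congrFun (congrArg Flag.sub e) i)
    · intro G
      have h1 : ∀ i, ∃ h : T ⟶ (H i).obj, (H i).grRep.homEquiv (h ≫ (H i).ι) = G.sub i := fun i => by
        have e := (H i).grRep.homEquiv.apply_symm_apply (G.sub i)
        obtain ⟨h, hh⟩ := ((H i).zeroLocus T ((H i).grRep.homEquiv.symm (G.sub i))).2 (by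
          rw [e]
          exact G.invariant i)
        exact ⟨h, by rw [hh, e]⟩
      choose q hq using h1
      have h2 : ∀ i, (H i).grRep.homEquiv (Pi.lift q ≫ p i) = G.sub i := fun i => by
        rw [← hq i, ← Category.assoc, Pi.lift_π]
      obtain ⟨h, hh⟩ := (hfac (Pi.lift q : T ⟶ P)).2 (by
        simp only [h2]
        exact G.le)
      refine ⟨h, Flag.ext (funext fun i => ?_)⟩
      change (H i).grRep.homEquiv ((h ≫ j) ≫ p i) = _
      rw [hh, h2]
  refine ⟨Fl, { homEquiv := fun {T} => Equiv.ofBijective (φ T) (hφ T), homEquiv_comp := ?_ }, j, hι,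
    fun T h i => ?_⟩
  · intro T T' f g
    refine Flag.ext (funext fun i => ?_)
    change (H i).grRep.homEquiv (((f ≫ g) ≫ j) ≫ p i) = _
    simp only [Category.assoc]
    rw [(H i).grRep.homEquiv_comp, ← Category.assoc]
    rfl
  · change _ = (H i).grRep.homEquiv ((h ≫ j) ≫ p i)
    simp only [p, Category.assoc]

end FlagScheme

end HiggsFlag

end

/-- Let `X` be a smooth variety over `ℂ`, `𝔈` a Higgs bundle of rank `r` on `X` and
`0 ≤ d₁ ≤ ⋯ ≤ d_k ≤ r`. The functor of flags of Higgs subbundles of ranks `d` is representable, the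
representing scheme is unique up to canonical isomorphism, and it is a closed subscheme of the
product (over `X`) of the Higgs Grassmannians of ranks `dᵢ`. -/
theorem mainTheorem11 (X : Scheme.{0}) (s : X ⟶ Spec (CommRingCat.of ℂ)) [Smooth s]
    [IsSeparated s] [QuasiCompact s] (r : ℕ) (𝔈 : HiggsFlag.HiggsBundle s r)
    (k : ℕ) (d : Fin k → ℕ) (hd : Monotone d) (hr : ∀ i, d i ≤ r) :
    (HiggsFlag.flagFunctor 𝔈 d).IsRepresentable ∧
    (∀ (Fl Fl' : Over X) (R : (HiggsFlag.flagFunctor 𝔈 d).RepresentableBy Fl)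
      (R' : (HiggsFlag.flagFunctor 𝔈 d).RepresentableBy Fl'),
      ∃! e : Fl ≅ Fl',
        (HiggsFlag.flagFunctor 𝔈 d).map e.hom.op (R'.homEquiv (𝟙 Fl')) = R.homEquiv (𝟙 Fl)) ∧
    (∀ i, Nonempty (HiggsFlag.HiggsGrassmannian 𝔈 (d i))) ∧
    (∀ (Fl : Over X) (R : (HiggsFlag.flagFunctor 𝔈 d).RepresentableBy Fl)
      (H : ∀ i, HiggsFlag.HiggsGrassmannian 𝔈 (d i)),
      ∃ j : ∀ i, Fl ⟶ (H i).obj,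
        (∀ i, (H i).grRep.homEquiv (j i ≫ (H i).ι) =
          HiggsFlag.Flag.sub (R.homEquiv (𝟙 Fl)) i) ∧
        IsClosedImmersion (Pi.lift j : Fl ⟶ ∏ᶜ fun i => (H i).obj).left) := by
  classical
  have hH : ∀ i, Nonempty (HiggsFlag.HiggsGrassmannian 𝔈 (d i)) := fun i =>
    HiggsFlag.nonempty_higgsGrassmannian 𝔈 (hr i)
  have hiso : ∀ {Fl Fl' : Over X} (R : (HiggsFlag.flagFunctor 𝔈 d).RepresentableBy Fl)
      (R' : (HiggsFlag.flagFunctor 𝔈 d).RepresentableBy Fl'),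
      ∃ e : Fl ≅ Fl', R'.homEquiv e.hom = R.homEquiv (𝟙 Fl) := fun R R' =>
    ⟨{  hom := R'.homEquiv.symm (R.homEquiv (𝟙 _))
        inv := R.homEquiv.symm (R'.homEquiv (𝟙 _))
        hom_inv_id := R.homEquiv.injective (by
          rw [R.homEquiv_comp, Equiv.apply_symm_apply, ← R'.homEquiv_eq, Equiv.apply_symm_apply])
        inv_hom_id := R'.homEquiv.injective (by
          rw [R'.homEquiv_comp, Equiv.apply_symm_apply, ← R.homEquiv_eq, Equiv.apply_symm_apply]) },
      R'.homEquiv.apply_symm_apply _⟩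
  refine ⟨?_, fun Fl Fl' R R' => ?_, hH, fun Fl R H => ?_⟩
  · obtain ⟨Fl, R, -⟩ := HiggsFlag.exists_flagScheme fun i => (hH i).some
    exact ⟨Fl, ⟨R⟩⟩
  · obtain ⟨e, he⟩ := hiso R R'
    refine ⟨e, (R'.homEquiv_eq e.hom).symm.trans he, fun e' he' => ?_⟩
    refine Iso.ext (R'.homEquiv.injective ?_)
    rw [he, R'.homEquiv_eq, he']
  · obtain ⟨Fl₀, R₀, j, hj, hR₀⟩ := HiggsFlag.exists_flagScheme H
    obtain ⟨e, he⟩ := hiso R R₀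
    refine ⟨fun i => e.hom ≫ j ≫ Pi.π _ i, fun i => by rw [hR₀, he], ?_⟩
    have h1 : (Pi.lift fun i => e.hom ≫ j ≫ Pi.π (fun i => (H i).obj) i) = e.hom ≫ j :=
      Pi.hom_ext _ _ fun i => by simp
    rw [h1, Over.comp_left]
    have h2 : IsIso e.hom.left := ((Over.forget X).mapIso e).isIso_hom
    infer_instance
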